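/- **Setting.** Let $(X,Z,Y(0),Y(1))$ have law $Q$, where $X$ takes values in a measurable space, $Z\in\{0,1\}$ and $Y(z)\in\mathbb R$, and put $Y=Y(Z)$. Write $e_z(x)=P(Z=z\mid X=x)$, $\mu_z(x)=E[Y\mid Z=z,X=x]$, $\sigma_z^2(x)=E[(Y-\mu_z(X))^2\mid Z=z,X=x]$, $\tau=E[Y(1)-Y(0)]$ and $\|f\|_2=(\int f^2\,dP_X)^{1/2}$. For a budget $B\in(0,1]$ let $$\pi^*(z,x)=\frac{\sqrt{\sigma_z^2(x)}}{e_z(x)}\,B\,\Big(E\big[\sqrt{\sigma_1^2(X)}+\sqrt{\sigma_0^2(X)}\big]\Big)^{-1}.$$ **Procedure (two batches, CSBAE cross-fitting with $K\ge 2$ folds).** Let $(X_i,Z_i,Y_i(0),Y_i(1))$, $i\ge 1$, be i.i.d. from $Q$, and let $U_i$ be i.i.d. uniform on $[0,1]$ and independent of them. For each $n$ the first $n$ units are partitioned into batches $t=1,2$ and folds $k=1,\dots,K$, where for a fixed $\kappa\in(0,1)$ the cell of batch $t$ and fold $k$ has $\kappa_t n/K+O(\sqrt n)$ elements, with $\kappa_1=\kappa$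 and $\kappa_2=1-\kappa$. Fix first-batch annotation probabilities $\pi_1(z)\in(0,1]$ (for instance $\pi_1\equiv B$). A learner is an arbitrary estimator of $(\mu_z,\sigma^2_z,e_z)$, jointly measurable in the sample and in $x$. Given estimates $\hat\sigma^2,\hat e$ from a sample $S$, the plug-in annotation probability is $\frac{\sqrt{\hat\sigma^2_z(x)}}{\hat e_z(x)}B\big(\frac1{|S|}\sum_{i\in S}(\sqrt{\hat\sigma_1^2(X_i)}+\sqrt{\hat\sigma_0^2(X_i)})\big)^{-1}$. 1. In the first batch, $R_i=\mathbf 1[U_i\le\pi_1(Z_i)]$. 2. In fold $k$ of the second batch, let $\hat\pi^{*,(k)}$ be the plug-in annotation probability computed from the observed records $(X,Z,R,RY)$ of the first batch of fold $k$. Set $\hat\pi_2^{(k)}(z,x)=\frac{1}{1-\kappa}\big(\hat\pi^{*,(k)}(z,x)-\kappa\pi_1(z)\big)$ and $R_i=\mathbf 1[U_i\le\hat\pi_2^{(k)}(Z_i,X_i)]$. 3. Let $\hat\mu^{(-k)},\hat e^{(-k)},\hat\pi^{(-k)}$ be the estimated outcome model, the estimated propensity score and the plug-in annotation probability from the observed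 records of both batches outside fold $k$. 4. With $k(i)$ the fold of unit $i$, put $$\hat\tau=\frac1n\sum_{i=1}^n(\hat\psi_{1,i}-\hat\psi_{0,i}),\qquad \hat\psi_{z,i}=\frac{\mathbf 1[Z_i=z]\,R_i\,(Y_i-\hat\mu_z^{(-k(i))}(X_i))}{\hat e_z^{(-k(i))}(X_i)\,\hat\pi^{(-k(i))}(z,X_i)}+\hat\mu_z^{(-k(i))}(X_i).$$ **Theorem.** Assume the following. - *Ignorability.* $Y(z)\perp Z\mid X$ for $z=0,1$. ($R$-ignorability holds by design: an annotation depends on its own unit only through $(Z,X)$ and an independent uniform variable.) - *Positivity.* For some $\varepsilon,\nu>0$, almost surely $\varepsilon<\pi^*(z,X)\le1$ for both $z$, and $1/\nu<e_1(X)<1-1/\nu$. For all large $n$, all $k$ and $z$, almost surely and for $P_X$-almost every $x$, $\hat e^{(-k)}_z(x)\ge1/\nu$ and $\hat\pi^{(-k)}(z,x)\ge\varepsilon$. - *Feasibility.* Almost surely $\kappa\pi_1(z)\le\pi^*(z,X)\le\kappa\pi_1(z)+(1-\kappa)$ for both $z$, that is, some second-batch probability in $[0,1]$ gives the mixture $\pi^*$.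 - *Moments and consistency.* $E[Y(z)^2]<\infty$ for both $z$. There are $K_\mu\ge0$ and $r_\mu>0$ such that $E[(\mu_z(X)-\hat\mu^{(-k)}_z(X))^2]\le K_\mu n^{-r_\mu}$ for all large $n$ and all $k,z$, where $X$ is independent of the training data. For all $k,z$, each of $\|\hat e^{(-k)}_z-e_z\|_2$, $\|\hat\pi^{(-k)}(z,\cdot)-\pi^*(z,\cdot)\|_2$ and $\|\hat\pi^{*,(k)}(z,\cdot)-\pi^*(z,\cdot)\|_2$ tends to $0$ in probability. - *Product error rates.* For all $k,z$, the product of $\sqrt n\,\|\hat\mu_z^{(-k)}-\mu_z\|_2$ with each of $\|\hat\pi^{(-k)}(z,\cdot)-\pi^*(z,\cdot)\|_2$, $\|\hat\pi^{*,(k)}(z,\cdot)-\pi^*(z,\cdot)\|_2$ and $\|\hat e_z^{(-k)}-e_z\|_2$ tends to $0$ in probability. Then $$\sqrt n\,(\hat\tau-\tau)\Rightarrow\mathcal N(0,V),\qquad V=\sum_{z\in\{0,1\}}E\Big[\frac{\sigma_z^2(X)}{e_z(X)\,\pi^*(z,X)}\Big]+\mathrm{Var}[\mu_1(X)-\mu_0(X)].$$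 Moreover $\pi^*$ minimizes $\sum_{z}E\big[\sigma_z^2(X)/(e_z(X)\pi(z,X))\big]$ over all measurable $\pi$ with $0<\pi(z,X)\le1$ almost surely for both $z$ and $E[\pi(Z,X)]\le B$, so $V$ is the smallest asymptotic variance under the budget. -/

import Mathlib

open MeasureTheory ProbabilityTheory Filter Topology
open scoped ENNReal

noncomputable section

namespace AdaptiveAIPW

/-! ### Population -/

/-- A full data unit `(X, Z, (Y(0), Y(1)))`; the treatment value `1` is `true`, `0` is `false`. -/
abbrev FullUnit (𝒳 : Type*) := 𝒳 × Bool × (Bool → ℝ)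

/-- An observed record `(X, Z, R, R * Y)`. -/
abbrev Rec (𝒳 : Type*) := 𝒳 × Bool × Bool × ℝ

section Population

variable {𝒳 : Type*}

/-- The covariate `X`. -/
def cov (u : FullUnit 𝒳) : 𝒳 := u.1

/-- The treatment `Z`. -/
def trt (u : FullUnit 𝒳) : Bool := u.2.1

/-- The potential outcome `Y(z)`. -/
def pot (z : Bool) (u : FullUnit 𝒳) : ℝ := u.2.2 z

/-- The realized outcome `Y = Y(Z)`. -/
def outcome (u : FullUnit 𝒳) : ℝ := pot (trt u) u

/-- Conditional independence `f ⟂ g | m`. -/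
def CondIndepGiven {Ω α β : Type*} [MeasurableSpace Ω] [MeasurableSpace α] [MeasurableSpace β]
    (P : Measure Ω) (m : MeasurableSpace Ω) (f : Ω → α) (g : Ω → β) : Prop :=
  ∀ (s : Set α) (t : Set β), MeasurableSet s → MeasurableSet t →
    P⟦f ⁻¹' s ∩ g ⁻¹' t | m⟧ =ᵐ[P] fun ω => (P⟦f ⁻¹' s | m⟧) ω * (P⟦g ⁻¹' t | m⟧) ω

variable [MeasurableSpace 𝒳] (Q : Measure (FullUnit 𝒳)) [IsProbabilityMeasure Q]

/-- The law of `X`. -/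
def covLaw : Measure 𝒳 := Q.map cov

/-- Treatment ignorability: `Y(z) ⟂ Z | X` for each `z`. -/
def TreatmentIgnorable : Prop :=
  ∀ z : Bool, CondIndepGiven Q (MeasurableSpace.comap cov inferInstance) (pot z) trt

/-- The propensity score `e_z(x) = P(Z = z | X = x)`. -/
def propensity (z : Bool) (x : 𝒳) : ℝ := (condDistrib trt cov Q x).real {z}

/-- The conditional law of `Y` given `Z = z` and `X = x`. -/
def outcomeLaw (z : Bool) (x : 𝒳) : Measure ℝ :=
  condDistrib outcome cov (ProbabilityTheory.cond Q (trt ⁻¹' {z})) x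

/-- The outcome model `μ_z(x) = E[Y | Z = z, X = x]`. -/
def outcomeMean (z : Bool) (x : 𝒳) : ℝ := ∫ y, y ∂(outcomeLaw Q z x)

/-- The conditional variance `σ²_z(x) = E[(Y - μ_z(X))² | Z = z, X = x]`. -/
def outcomeVar (z : Bool) (x : 𝒳) : ℝ := ∫ y, (y - outcomeMean Q z x) ^ 2 ∂(outcomeLaw Q z x)

/-- The average treatment effect `τ = E[Y(1) - Y(0)]`. -/
def ate : ℝ := ∫ u, (pot true u - pot false u) ∂Q

/-- The objective `∑_z E[σ²_z(X) / (e_z(X) π(z, X))]` of the budgeted allocation problem,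
as an extended nonnegative number. -/
def allocObjective (π : Bool → 𝒳 → ℝ) : ℝ≥0∞ :=
  ∑ z : Bool, ∫⁻ x, ENNReal.ofReal (outcomeVar Q z x / (propensity Q z x * π z x)) ∂(covLaw Q)

/-- Feasibility for the global budget problem: `0 < π(z, X) ≤ 1` and `E[π(Z, X)] ≤ B`. -/
def AllocFeasible (B : ℝ) (π : Bool → 𝒳 → ℝ) : Prop :=
  (∀ z, Measurable (π z)) ∧
  (∀ᵐ x ∂(covLaw Q), ∀ z, 0 < π z x ∧ π z x ≤ 1) ∧
  ∫ u, π (trt u) (cov u) ∂Q ≤ B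

/-- `π` solves the global budget problem: it minimizes the objective over all feasible
annotation probabilities. -/
def SolvesGlobalBudget (B : ℝ) (π : Bool → 𝒳 → ℝ) : Prop :=
  AllocFeasible Q B π ∧ ∀ π', AllocFeasible Q B π' → allocObjective Q π ≤ allocObjective Q π'

/-- The optimal annotation probability
`π*(z, x) = (√σ²_z(x) / e_z(x)) * B * (E[√σ²_1(X) + √σ²_0(X)])⁻¹`. -/
def optProb (B : ℝ) (z : Bool) (x : 𝒳) : ℝ :=
  √(outcomeVar Q z x) / propensity Q z x * B
    * (∫ x', (√(outcomeVar Q true x') + √(outcomeVar Q false x')) ∂(covLaw Q))⁻¹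

/-- The asymptotic variance
`∑_z E[σ²_z(X) / (e_z(X) π(z, X))] + Var[μ_1(X) - μ_0(X)]`. -/
def asympVar (π : Bool → 𝒳 → ℝ) : ℝ :=
  (∑ z : Bool, ∫ x, outcomeVar Q z x / (propensity Q z x * π z x) ∂(covLaw Q))
    + variance (fun x => outcomeMean Q true x - outcomeMean Q false x) (covLaw Q)

/-- Positivity of the treatment and annotation probabilities. -/
def Positivity (π : Bool → 𝒳 → ℝ) (ε ν : ℝ) : Prop :=
  ∀ᵐ x ∂(covLaw Q),
    (∀ z, ε < π z x ∧ π z x ≤ 1) ∧ 1 / ν < propensity Q true x ∧ propensity Q true x < 1 - 1 / ν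

/-- The `L²` distance `‖f(X) - g(X)‖₂` under the law of `X`. -/
def l2Dist (f g : 𝒳 → ℝ) : ℝ≥0∞ := eLpNorm (fun x => f x - g x) 2 (covLaw Q)

end Population

/-- Convergence to zero in probability of extended nonnegative random quantities. -/
def ToZeroInProb {Ω : Type*} [MeasurableSpace Ω] (P : Measure Ω) (f : ℕ → Ω → ℝ≥0∞) : Prop :=
  ∀ δ : ℝ≥0∞, 0 < δ → Tendsto (fun n => P {ω | δ ≤ f n ω}) atTop (𝓝 0)

/-! ### The two-batch procedure -/

/-- The parameters of the two-batch design: the proportion `κ` of the first batch, the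
(possibly treatment-specific) first-batch annotation probability `π₁`, the budget `B`, and, for
every sample size `n`, the batch (`0` is the first one, `1` the second one) and the fold of
each index `i < n`. -/
structure Design (K : ℕ) where
  κ : ℝ
  π₁ : Bool → ℝ
  B : ℝ
  batch : ℕ → ℕ → Fin 2
  fold : ℕ → ℕ → Fin K

namespace Design

variable {K : ℕ} (D : Design K)

/-- The indices of batch `t` and fold `k` among the first `n`. -/
def cell (n : ℕ) (t : Fin 2) (k : Fin K) : Finset ℕ :=
  (Finset.range n).filter fun i => D.batch n i = t ∧ D.fold n i = k

/-- The indices (of both batches) outside fold `k`. -/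
def outOfFold (n : ℕ) (k : Fin K) : Finset ℕ :=
  (Finset.range n).filter fun i => D.fold n i ≠ k

/-- The target proportion of batch `t`: `κ` for the first batch, `1 - κ` for the second one. -/
def proportion (t : Fin 2) : ℝ := if t = 0 then D.κ else 1 - D.κ

/-- Proportional batches and balanced folds: the cells have the sizes `κ n / K`, `(1 - κ) n / K`
up to an error `O(√n)` (which is at most of order one under plain rounding). -/
def Proportional : Prop :=
  ∃ C : ℝ, ∀ (n : ℕ) (t : Fin 2) (k : Fin K),
    |((D.cell n t k).card : ℝ) - D.proportion t * n / K| ≤ C * √(n : ℝ)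

end Design

/-- Arbitrary (jointly measurable) estimators of the three nuisance functions `μ_z`, `σ²_z`,
`e_z`. For each `n` and each set `S` of indices, they turn the observed records with indices in
`S` into functions of `(z, x)`. -/
structure Learners (𝒳 : Type*) [MeasurableSpace 𝒳] where
  mean : ℕ → (S : Finset ℕ) → (S → Rec 𝒳) → Bool → 𝒳 → ℝ
  var : ℕ → (S : Finset ℕ) → (S → Rec 𝒳) → Bool → 𝒳 → ℝ
  prop : ℕ → (S : Finset ℕ) → (S → Rec 𝒳) → Bool → 𝒳 → ℝ
  measurable_mean : ∀ (n : ℕ) (S : Finset ℕ) (z : Bool),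
    Measurable fun p : (S → Rec 𝒳) × 𝒳 => mean n S p.1 z p.2
  measurable_var : ∀ (n : ℕ) (S : Finset ℕ) (z : Bool),
    Measurable fun p : (S → Rec 𝒳) × 𝒳 => var n S p.1 z p.2
  measurable_prop : ∀ (n : ℕ) (S : Finset ℕ) (z : Bool),
    Measurable fun p : (S → Rec 𝒳) × 𝒳 => prop n S p.1 z p.2

section Procedure

variable {𝒳 : Type*} [MeasurableSpace 𝒳] {K : ℕ} (D : Design K) (L : Learners 𝒳)

/-- The plug-in solution of the global budget problem from the records with indices in `S`:
`(√σ̂²_z(x) / ê_z(x)) * B * (E_S[√σ̂²_1(X) + √σ̂²_0(X)])⁻¹`, where `σ̂²`, `ê` are estimated from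
`S` and `E_S` is the empirical mean over `S`. -/
def plugInProb (n : ℕ) (S : Finset ℕ) (r : S → Rec 𝒳) (z : Bool) (x : 𝒳) : ℝ :=
  √(L.var n S r z x) / L.prop n S r z x * D.B
    * ((∑ i : S, (√(L.var n S r true (r i).1) + √(L.var n S r false (r i).1))) / S.card)⁻¹

/-- The record of a unit `u` whose annotation is drawn with probability `p (Z, X)` through the
uniform variable `v`: `R = 1` if and only if `v ≤ p (Z, X)`. -/
def annotate (p : Bool → 𝒳 → ℝ) (u : FullUnit 𝒳) (v : ℝ) : Rec 𝒳 :=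
  (cov u, trt u, decide (v ≤ p (trt u) (cov u)),
    if v ≤ p (trt u) (cov u) then outcome u else 0)

/- Below, `d i` is the full data unit with index `i` together with its uniform variable. -/
variable (d : ℕ → FullUnit 𝒳 × ℝ)

/-- The records of the first batch. -/
def firstRec (i : ℕ) : Rec 𝒳 := annotate (fun z _ => D.π₁ z) (d i).1 (d i).2

/-- The estimated optimal annotation probability used for annotating the second batch in fold `k`;
it is computed from the first batch of the same fold. -/
def designProb (n : ℕ) (k : Fin K) : Bool → 𝒳 → ℝ :=
  plugInProb D L n (D.cell n 0 k) fun i => firstRec D d i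

/-- The annotation probability in the second batch of fold `k`. -/
def secondProb (n : ℕ) (k : Fin K) (z : Bool) (x : 𝒳) : ℝ :=
  1 / (1 - D.κ) * (designProb D L d n k z x - D.κ * D.π₁ z)

/-- All records, at sample size `n`. -/
def record (n i : ℕ) : Rec 𝒳 :=
  if D.batch n i = 0 then firstRec D d i
  else annotate (secondProb D L d n (D.fold n i)) (d i).1 (d i).2

/-- The out-of-fold outcome model, from the pooled records of both batches. -/
def meanHat (n : ℕ) (k : Fin K) : Bool → 𝒳 → ℝ :=
  L.mean n (D.outOfFold n k) fun i => record D L d n i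

/-- The out-of-fold propensity score, from the pooled records of both batches. -/
def propHat (n : ℕ) (k : Fin K) : Bool → 𝒳 → ℝ :=
  L.prop n (D.outOfFold n k) fun i => record D L d n i

/-- The out-of-fold annotation probability, from the pooled records of both batches. -/
def probHat (n : ℕ) (k : Fin K) : Bool → 𝒳 → ℝ :=
  plugInProb D L n (D.outOfFold n k) fun i => record D L d n i

/-- The AIPW score `1[Z = z] R (Y - μ_z(X)) / (e_z(X) π(z, X)) + μ_z(X)` of a record;
where `R = 1`, the last entry of the record is `Y`. -/
def score (m e π : Bool → 𝒳 → ℝ) (z : Bool) (r : Rec 𝒳) : ℝ :=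
  (if r.2.1 = z ∧ r.2.2.1 = true then r.2.2.2 - m z r.1 else 0) / (e z r.1 * π z r.1) + m z r.1

/-- The cross-fitted two-batch adaptive AIPW estimator. -/
def aipw (n : ℕ) : ℝ :=
  1 / (n : ℝ) * ∑ t : Fin 2, ∑ k : Fin K, ∑ i ∈ D.cell n t k,
    (score (meanHat D L d n k) (propHat D L d n k) (probHat D L d n k) true (record D L d n i)
      - score (meanHat D L d n k) (propHat D L d n k) (probHat D L d n k) false
          (record D L d n i))

end Procedure

/-! ### Conditions on the estimators -/

section Conditions

variable {𝒳 : Type*} [MeasurableSpace 𝒳] {K : ℕ} (Q : Measure (FullUnit 𝒳))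
  [IsProbabilityMeasure Q] (D : Design K) (L : Learners 𝒳)
  {Ω : Type*} [MeasurableSpace Ω] (P : Measure Ω) (W : ℕ → Ω → FullUnit 𝒳 × ℝ)

/-- Mean-square rate of the outcome model: `E[(μ_z(X) - μ̂_z(X))²] ≤ K_μ n^{-r_μ}` for some
`r_μ > 0` and all large `n`; the expectation is over the training data and an independent `X`. -/
def MeanConsistent : Prop :=
  ∃ Kμ rμ : ℝ, 0 ≤ Kμ ∧ 0 < rμ ∧ ∀ᶠ n : ℕ in atTop, ∀ (k : Fin K) (z : Bool),
    ∫⁻ ω, ∫⁻ x, ENNReal.ofReal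
        ((outcomeMean Q z x - meanHat D L (fun i => W i ω) n k z x) ^ 2) ∂(covLaw Q) ∂P
      ≤ ENNReal.ofReal (Kμ * (n : ℝ) ^ (-rμ))

/-- Mean-square consistency of the estimated propensity score and of the estimated annotation
probabilities (those used for annotation and those used in the estimator). -/
def PropensityAnnotationConsistent : Prop :=
  ∀ (k : Fin K) (z : Bool),
    ToZeroInProb P (fun n ω =>
      l2Dist Q (propHat D L (fun i => W i ω) n k z) (propensity Q z)) ∧
    ToZeroInProb P (fun n ω =>
      l2Dist Q (probHat D L (fun i => W i ω) n k z) (optProb Q D.B z)) ∧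
    ToZeroInProb P (fun n ω =>
      l2Dist Q (designProb D L (fun i => W i ω) n k z) (optProb Q D.B z))

/-- Product error rates: `√n ‖μ̂_z - μ_z‖₂ ‖π̂(z, ·) - π*(z, ·)‖₂ → 0` in probability, both for
the annotation probabilities of the estimator and for those of the second batch, and
`√n ‖μ̂_z - μ_z‖₂ ‖ê_z - e_z‖₂ → 0` in probability. -/
def ProductRates : Prop :=
  ∀ (k : Fin K) (z : Bool),
    ToZeroInProb P (fun n ω => ENNReal.ofReal √(n : ℝ)
      * l2Dist Q (meanHat D L (fun i => W i ω) n k z) (outcomeMean Q z)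
      * l2Dist Q (probHat D L (fun i => W i ω) n k z) (optProb Q D.B z)) ∧
    ToZeroInProb P (fun n ω => ENNReal.ofReal √(n : ℝ)
      * l2Dist Q (meanHat D L (fun i => W i ω) n k z) (outcomeMean Q z)
      * l2Dist Q (designProb D L (fun i => W i ω) n k z) (optProb Q D.B z)) ∧
    ToZeroInProb P (fun n ω => ENNReal.ofReal √(n : ℝ)
      * l2Dist Q (meanHat D L (fun i => W i ω) n k z) (outcomeMean Q z)
      * l2Dist Q (propHat D L (fun i => W i ω) n k z) (propensity Q z))

/-- Positivity of the estimated propensities and annotation probabilities that the estimator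
divides by, for all large `n`. -/
def EstimatedPositivity (ε ν : ℝ) : Prop :=
  ∀ᶠ n : ℕ in atTop, ∀ k : Fin K, ∀ᵐ ω ∂P, ∀ᵐ x ∂(covLaw Q), ∀ z : Bool,
    1 / ν ≤ propHat D L (fun i => W i ω) n k z x ∧ ε ≤ probHat D L (fun i => W i ω) n k z x

end Conditions

end AdaptiveAIPW

end

set_option linter.unusedSectionVars false

namespace AdaptiveAIPW

/-! ### Conditional laws of treatment and outcome given the covariate. -/

section PopulationFacts

variable {𝒳 : Type*} [MeasurableSpace 𝒳]

/-! The estimator is compared with an oracle that uses the true nuisances, divides by π*, and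
annotates with probability π₁ in the first batch and (π* - κπ₁)/(1 - κ) in the second, through the
same uniform variables as the actual procedure. `sqrt_mul_aipw_sub` writes √n(τ̂ - τ) exactly as a
normalized sum of oracle scores plus a remainder.

The oracle scores are independent and centered, with a law depending only on the batch, so
`tendstoInDistribution_grouped_sum` gives a normal limit. Since R² = R, the second moment of a score
is affine in the annotation probability. Averaging over the batches with weights κ and 1 - κ
therefore replaces the two probabilities by their mixture π*, which cancels one factor of the π*² in
the denominator (`mixture_integral_oracleScore_sq`).

The remainder is treated cell by cell. All estimates used on a cell are functions of the data
outside it: out-of-fold records involve out-of-fold units only, because every fold designs its own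
second batch, and that design uses only the first batch of the fold (`scoreDiff_mask`). Given these
data, the score differences of a cell are i.i.d. Their fluctuation is negligible by Chebyshev, as
their mean square tends to zero (`toZeroInProb_fluctuation`). Their mean is ∫ (μ̂ - μ)(1 - e p/(ê
π̂)), with p the annotation probability of the batch. Within one batch this is only of first order
in μ̂ - μ, since p need not be near π*; but the two batches, weighted by κ and 1 - κ, replace p by a
probability near π*, and only products of errors remain (`enorm_mixture_bias_le`). Cell sizes off by
O(√n) add bounded multiples of the one-batch biases, which vanish by consistency of μ̂.

Optimality of π* is the pointwise inequality σ²/b + l²b ≥ 2lσ with b = eπ, integrated with a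
suitable constant l (`solvesGlobalBudget_optProb`). -/

@[fun_prop]
lemma measurable_cov : Measurable (cov : FullUnit 𝒳 → 𝒳) := measurable_fst

@[fun_prop]
lemma measurable_trt : Measurable (trt : FullUnit 𝒳 → Bool) := measurable_fst.comp measurable_snd

@[fun_prop]
lemma measurable_pot (z : Bool) : Measurable (pot z : FullUnit 𝒳 → ℝ) :=
  (measurable_pi_apply z).comp (measurable_snd.comp measurable_snd)

lemma measurableSet_trt (z : Bool) : MeasurableSet (trt ⁻¹' {z} : Set (FullUnit 𝒳)) :=
  measurable_trt (measurableSet_singleton z)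

@[fun_prop]
lemma measurable_outcome : Measurable (outcome : FullUnit 𝒳 → ℝ) := by
  have : (outcome : FullUnit 𝒳 → ℝ) =
      fun u => if trt u = true then pot true u else pot false u := by
    ext u
    cases h : trt u <;> simp [outcome, h]
  rw [this]
  exact Measurable.ite (measurableSet_trt _) (measurable_pot _) (measurable_pot _)

variable (Q : Measure (FullUnit 𝒳)) [IsProbabilityMeasure Q]

instance : IsProbabilityMeasure (covLaw Q) :=
  Measure.isProbabilityMeasure_map measurable_cov.aemeasurable

/-- The regular version of the conditional law of `Y` given `Z = z` and `X`. -/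
noncomputable def outcomeKernel (z : Bool) : Kernel 𝒳 ℝ :=
  condDistrib outcome cov (ProbabilityTheory.cond Q (trt ⁻¹' {z}))

instance (z : Bool) : IsMarkovKernel (outcomeKernel Q z) := by
  unfold outcomeKernel; infer_instance

lemma outcomeKernel_apply (z : Bool) (x : 𝒳) : outcomeKernel Q z x = outcomeLaw Q z x := rfl

instance (z : Bool) (x : 𝒳) : IsProbabilityMeasure (outcomeLaw Q z x) := by
  rw [← outcomeKernel_apply]; infer_instance

@[fun_prop]
lemma measurable_propensity (z : Bool) : Measurable (propensity Q z) :=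
  (Kernel.measurable_coe _ (measurableSet_singleton z)).ennreal_toReal

lemma propensity_nonneg (z : Bool) (x : 𝒳) : 0 ≤ propensity Q z x := measureReal_nonneg

lemma propensity_le_one (z : Bool) (x : 𝒳) : propensity Q z x ≤ 1 := measureReal_le_one

lemma ofReal_propensity (z : Bool) (x : 𝒳) :
    ENNReal.ofReal (propensity Q z x) = condDistrib trt cov Q x {z} := by
  simp [propensity]

lemma propensity_add (x : 𝒳) : propensity Q true x + propensity Q false x = 1 := by
  have h : (Set.univ : Set Bool) = {true} ∪ {false} := by ext b; cases b <;> simp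
  have h1 : (condDistrib trt cov Q x).real Set.univ = 1 := probReal_univ
  rw [h, measureReal_union (by simp) (measurableSet_singleton _)] at h1
  exact h1

@[fun_prop]
lemma measurable_outcomeMean (z : Bool) : Measurable (outcomeMean Q z) := by
  have : StronglyMeasurable fun x => ∫ y, y ∂(outcomeKernel Q z x) :=
    (measurable_snd.stronglyMeasurable (f := fun p : 𝒳 × ℝ => p.2)).integral_kernel_prod_right'
  exact this.measurable

@[fun_prop]
lemma measurable_outcomeVar (z : Bool) : Measurable (outcomeVar Q z) := by
  have hm : Measurable fun p : 𝒳 × ℝ => (p.2 - outcomeMean Q z p.1) ^ 2 := by fun_prop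
  have : StronglyMeasurable fun x => ∫ y, (y - outcomeMean Q z x) ^ 2 ∂(outcomeKernel Q z x) :=
    hm.stronglyMeasurable.integral_kernel_prod_right'
  exact this.measurable

lemma outcomeVar_nonneg (z : Bool) (x : 𝒳) : 0 ≤ outcomeVar Q z x :=
  integral_nonneg fun _ => sq_nonneg _

@[fun_prop]
lemma measurable_optProb (B : ℝ) (z : Bool) : Measurable (optProb Q B z) := by
  unfold optProb; fun_prop

lemma measure_trt_inter (z : Bool) {A : Set 𝒳} (hA : MeasurableSet A) :
    Q (cov ⁻¹' A ∩ trt ⁻¹' {z}) = ∫⁻ x in A, ENNReal.ofReal (propensity Q z x) ∂(covLaw Q) := by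
  simp_rw [ofReal_propensity]
  rw [covLaw, setLIntegral_map hA (Kernel.measurable_coe _ (measurableSet_singleton z))
    measurable_cov, setLIntegral_preimage_condDistrib measurable_cov measurable_trt.aemeasurable
    (measurableSet_singleton z) hA]

lemma map_cov_restrict_trt (z : Bool) :
    (Q.restrict (trt ⁻¹' {z})).map cov =
      (covLaw Q).withDensity fun x => ENNReal.ofReal (propensity Q z x) := by
  ext A hA
  rw [Measure.map_apply measurable_cov hA, Measure.restrict_apply (measurable_cov hA),
    withDensity_apply _ hA, measure_trt_inter Q z hA]

/-- The outcome model is defined through the normalized law given Z = z; undoing the normalization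
turns it into a disintegration of `Q` restricted to one arm, with the propensity as density. -/
lemma map_restrict_trt (z : Bool) :
    (Q.restrict (trt ⁻¹' {z})).map (fun u => (cov u, outcome u)) =
      ((covLaw Q).withDensity fun x => ENNReal.ofReal (propensity Q z x)) ⊗ₘ outcomeKernel Q z := by
  -- An arm of probability zero cannot be renormalized; there both sides vanish.
  by_cases h0 : Q (trt ⁻¹' {z}) = 0
  · rw [← map_cov_restrict_trt, Measure.restrict_eq_zero.2 h0]
    simp
  have hr : Q.restrict (trt ⁻¹' {z}) =
      Q (trt ⁻¹' {z}) • ProbabilityTheory.cond Q (trt ⁻¹' {z}) := by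
    rw [ProbabilityTheory.cond, smul_smul, ENNReal.mul_inv_cancel h0 (measure_ne_top _ _), one_smul]
  rw [← map_cov_restrict_trt, hr, Measure.map_smul, Measure.map_smul, Measure.compProd_smul_left,
    outcomeKernel, compProd_map_condDistrib measurable_outcome.aemeasurable]

lemma lintegral_trt (z : Bool) {f : 𝒳 × ℝ → ℝ≥0∞} (hf : Measurable f) :
    ∫⁻ u in trt ⁻¹' {z}, f (cov u, outcome u) ∂Q =
      ∫⁻ x, ENNReal.ofReal (propensity Q z x) * ∫⁻ y, f (x, y) ∂(outcomeLaw Q z x) ∂(covLaw Q) := by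
  have hm : Measurable fun u : FullUnit 𝒳 => (cov u, outcome u) := by fun_prop
  rw [← lintegral_map hf hm, map_restrict_trt, Measure.lintegral_compProd hf,
    lintegral_withDensity_eq_lintegral_mul _ (by fun_prop) hf.lintegral_kernel_prod_right']
  rfl

/-- No moment condition is needed: without integrability of `y`, the centered function is not
integrable either, and its integral is zero by convention. -/
lemma integral_sub_outcomeMean (z : Bool) (x : 𝒳) :
    ∫ y, (y - outcomeMean Q z x) ∂(outcomeLaw Q z x) = 0 := by
  by_cases h : Integrable (fun y : ℝ => y) (outcomeLaw Q z x)
  · rw [integral_sub h (integrable_const _)]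
    simp [outcomeMean]
  · refine integral_undef fun h' => h ?_
    refine (h'.add (integrable_const (outcomeMean Q z x))).congr (ae_of_all _ fun y => ?_)
    simp

lemma setIntegral_trt_sub_outcomeMean (z : Bool) {φ : 𝒳 → ℝ} (hφ : Measurable φ) :
    ∫ u in trt ⁻¹' {z}, (outcome u - outcomeMean Q z (cov u)) * φ (cov u) ∂Q = 0 := by
  have hm : Measurable fun u : FullUnit 𝒳 => (cov u, outcome u) := by fun_prop
  have hf : Measurable fun p : 𝒳 × ℝ => (p.2 - outcomeMean Q z p.1) * φ p.1 := by fun_prop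
  by_cases hi : IntegrableOn
    (fun u => (outcome u - outcomeMean Q z (cov u)) * φ (cov u)) (trt ⁻¹' {z}) Q
  swap
  · exact integral_undef hi
  have h1 := integral_map (μ := Q.restrict (trt ⁻¹' {z})) hm.aemeasurable hf.aestronglyMeasurable
  have h2 := (integrable_map_measure (μ := Q.restrict (trt ⁻¹' {z})) hf.aestronglyMeasurable
    hm.aemeasurable).2 hi
  rw [map_restrict_trt] at h1 h2
  rw [← h1, Measure.integral_compProd h2]
  refine integral_eq_zero_of_ae (ae_of_all _ fun x => ?_)
  simp only [integral_mul_const, Pi.zero_apply]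
  rw [outcomeKernel_apply, integral_sub_outcomeMean, zero_mul]

end PopulationFacts

/-! ### Identification of the potential outcomes under ignorability. -/

section Ignorability

variable {𝒳 : Type*} [MeasurableSpace 𝒳]
variable (Q : Measure (FullUnit 𝒳)) [IsProbabilityMeasure Q]

/-- Under ignorability and overlap, the law of `(X, Y(z))` is obtained from that of `X` and the
conditional law of `Y` given `Z = z` and `X`. -/
lemma map_cov_pot (hign : TreatmentIgnorable Q) (z : Bool)
    (hpos : ∀ᵐ x ∂(covLaw Q), 0 < propensity Q z x) :
    Q.map (fun u => (cov u, pot z u)) = (covLaw Q) ⊗ₘ outcomeKernel Q z := by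
  have hm : Measurable fun u : FullUnit 𝒳 => (cov u, pot z u) := by fun_prop
  have : IsProbabilityMeasure (Q.map fun u => (cov u, pot z u)) :=
    Measure.isProbabilityMeasure_map hm.aemeasurable
  have hle : MeasurableSpace.comap (cov : FullUnit 𝒳 → 𝒳) inferInstance ≤
      (inferInstance : MeasurableSpace (FullUnit 𝒳)) :=
    measurable_cov.comap_le
  refine Measure.ext_prod fun {A s} hA hs => ?_
  rw [Measure.map_apply hm (hA.prod hs), Measure.compProd_apply_prod hA hs]
  have hT : (fun u : FullUnit 𝒳 => (cov u, pot z u)) ⁻¹' (A ×ˢ s) = cov ⁻¹' A ∩ pot z ⁻¹' s := by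
    ext u; simp
  rw [hT]
  -- real-valued versions of the conditional probabilities
  set κr : 𝒳 → ℝ := fun x => (outcomeKernel Q z x).real s
  have hκm : Measurable κr := (Kernel.measurable_coe _ hs).ennreal_toReal
  have hsm : MeasurableSet (pot z ⁻¹' s : Set (FullUnit 𝒳)) := measurable_pot z hs
  -- On the event Z = z the potential outcome is the observed one, so the joint conditional
  -- probability is known without ignorability.
  have h1 : Q⟦pot z ⁻¹' s ∩ trt ⁻¹' {z} | MeasurableSpace.comap cov inferInstance⟧ =ᵐ[Q]
      fun u => κr (cov u) * propensity Q z (cov u) := by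
    symm
    refine ae_eq_condExp_of_forall_setIntegral_eq hle ?_ ?_ ?_ ?_
    · exact (integrable_const (1 : ℝ)).indicator (hsm.inter (measurableSet_trt z))
    · intro B _ _
      refine (Integrable.of_bound (C := 1) (by fun_prop) (ae_of_all _ fun u => ?_)).integrableOn
      rw [Real.norm_of_nonneg (mul_nonneg measureReal_nonneg (propensity_nonneg _ _ _))]
      exact mul_le_one₀ measureReal_le_one (propensity_nonneg _ _ _) (propensity_le_one _ _ _)
    · rintro _ ⟨B, hB, rfl⟩ _
      have hL : ∫ u in cov ⁻¹' B, κr (cov u) * propensity Q z (cov u) ∂Q =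
          (∫⁻ x in B, ENNReal.ofReal (propensity Q z x) * outcomeKernel Q z x s
            ∂(covLaw Q)).toReal := by
        rw [← setIntegral_map (f := fun x => κr x * propensity Q z x) hB
          (hκm.mul (measurable_propensity Q z)).aestronglyMeasurable measurable_cov.aemeasurable]
        rw [integral_eq_lintegral_of_nonneg_ae (ae_of_all _ fun x => mul_nonneg measureReal_nonneg
          (propensity_nonneg _ _ _))
          (hκm.mul (measurable_propensity Q z)).aestronglyMeasurable]
        congr 1
        refine lintegral_congr fun x => ?_
        rw [mul_comm, ENNReal.ofReal_mul (propensity_nonneg _ _ _)]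
        simp
      rw [hL, integral_indicator_const _ (hsm.inter (measurableSet_trt z)), smul_eq_mul, mul_one,
        measureReal_def,
        Measure.restrict_apply (hsm.inter (measurableSet_trt z))]
      congr 1
      have hf : Measurable ((B ×ˢ s).indicator (1 : 𝒳 × ℝ → ℝ≥0∞)) :=
        measurable_one.indicator (hB.prod hs)
      have h2 := lintegral_trt Q z hf
      have h3 : ∫⁻ u in trt ⁻¹' {z}, (B ×ˢ s).indicator (1 : 𝒳 × ℝ → ℝ≥0∞) (cov u, outcome u) ∂Q =
          Q (pot z ⁻¹' s ∩ trt ⁻¹' {z} ∩ cov ⁻¹' B) := by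
        have : ∀ u ∈ trt ⁻¹' {z}, (B ×ˢ s).indicator (1 : 𝒳 × ℝ → ℝ≥0∞) (cov u, outcome u) =
            (pot z ⁻¹' s ∩ cov ⁻¹' B).indicator 1 u := by
          intro u hu
          have : outcome u = pot z u := by
            simp only [Set.mem_preimage, Set.mem_singleton_iff] at hu
            simp [outcome, hu]
          by_cases h1 : cov u ∈ B <;> by_cases h2 : pot z u ∈ s <;>
            simp [Set.indicator, this, h1, h2]
        rw [setLIntegral_congr_fun (measurableSet_trt z) this,
          lintegral_indicator_one (hsm.inter (measurable_cov hB)),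
          Measure.restrict_apply (hsm.inter (measurable_cov hB))]
        congr 1; ext u; simp only [Set.mem_inter_iff]; tauto
      rw [← h3, h2, ← lintegral_indicator hB]
      refine lintegral_congr fun x => ?_
      by_cases hx : x ∈ B
      · have : (fun y => (B ×ˢ s).indicator (1 : 𝒳 × ℝ → ℝ≥0∞) (x, y)) = s.indicator 1 := by
          ext y; by_cases hy : y ∈ s <;> simp [Set.indicator, hx, hy]
        rw [this, lintegral_indicator_one hs, Set.indicator_of_mem hx, outcomeKernel_apply]
      · simp [hx]
    · have hmc : Measurable[MeasurableSpace.comap (cov : FullUnit 𝒳 → 𝒳) inferInstance]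
          (cov : FullUnit 𝒳 → 𝒳) := comap_measurable _
      exact (((hκm.mul (measurable_propensity Q z)).comp hmc).stronglyMeasurable).aestronglyMeasurable
  have h2 : Q⟦trt ⁻¹' {z} | MeasurableSpace.comap cov inferInstance⟧ =ᵐ[Q]
      fun u => propensity Q z (cov u) :=
    (condDistrib_ae_eq_condExp measurable_cov measurable_trt (measurableSet_singleton z)).symm
  have h3 := hign z s {z} hs (measurableSet_singleton z)
  have hpos' : ∀ᵐ u ∂Q, 0 < propensity Q z (cov u) := ae_of_ae_map measurable_cov.aemeasurable hpos
  -- Ignorability factors the joint conditional probability, and overlap allows the propensity to be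
  -- cancelled.
  have h4 : Q⟦pot z ⁻¹' s | MeasurableSpace.comap cov inferInstance⟧ =ᵐ[Q]
      fun u => κr (cov u) := by
    filter_upwards [h1, h2, h3, hpos'] with u e1 e2 e3 hp
    rw [e1, e2] at e3
    exact (mul_right_cancel₀ hp.ne' e3).symm
  have h5 : (Q (cov ⁻¹' A ∩ pot z ⁻¹' s)).toReal = ∫ u in cov ⁻¹' A, κr (cov u) ∂Q := by
    rw [← setIntegral_congr_ae (measurable_cov hA) (h4.mono fun u hu _ => hu),
      setIntegral_condExp hle ((integrable_const (1 : ℝ)).indicator hsm) ⟨A, hA, rfl⟩,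
      integral_indicator_const _ hsm, smul_eq_mul, mul_one, measureReal_def,
      Measure.restrict_apply hsm, Set.inter_comm]
  rw [← ENNReal.toReal_eq_toReal_iff' (measure_ne_top _ _), h5,
    ← setIntegral_map hA hκm.aestronglyMeasurable measurable_cov.aemeasurable, ← covLaw,
    integral_eq_lintegral_of_nonneg_ae (ae_of_all _ fun x => measureReal_nonneg)
      hκm.aestronglyMeasurable]
  · congr 1
    refine lintegral_congr fun x => ?_
    simp
  · refine ((setLIntegral_mono measurable_const fun x _ => prob_le_one).trans_lt ?_).ne
    simp [measure_lt_top]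

variable {Q} in
lemma integrable_outcomeLaw_sq (hign : TreatmentIgnorable Q) (z : Bool)
    (hpos : ∀ᵐ x ∂(covLaw Q), 0 < propensity Q z x) (hmom : MemLp (pot z) 2 Q) :
    ∀ᵐ x ∂(covLaw Q), MemLp (fun y => y) 2 (outcomeLaw Q z x) := by
  have hm : Measurable fun u : FullUnit 𝒳 => (cov u, pot z u) := by fun_prop
  have h : Integrable (fun p : 𝒳 × ℝ => p.2 ^ 2) ((covLaw Q) ⊗ₘ outcomeKernel Q z) := by
    rw [← map_cov_pot Q hign z hpos, integrable_map_measure (by fun_prop) hm.aemeasurable]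
    exact hmom.integrable_sq
  filter_upwards [((Measure.integrable_compProd_iff (by fun_prop)).1 h).1] with x hx
  exact (memLp_two_iff_integrable_sq (by fun_prop)).2 hx

variable {Q} in
lemma integral_outcomeMean (hign : TreatmentIgnorable Q) (z : Bool)
    (hpos : ∀ᵐ x ∂(covLaw Q), 0 < propensity Q z x) (hmom : MemLp (pot z) 2 Q) :
    ∫ x, outcomeMean Q z x ∂(covLaw Q) = ∫ u, pot z u ∂Q := by
  have hm : Measurable fun u : FullUnit 𝒳 => (cov u, pot z u) := by fun_prop
  have h : Integrable (fun p : 𝒳 × ℝ => p.2) ((covLaw Q) ⊗ₘ outcomeKernel Q z) := by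
    rw [← map_cov_pot Q hign z hpos, integrable_map_measure (by fun_prop) hm.aemeasurable]
    exact hmom.integrable one_le_two
  have h2 := Measure.integral_compProd h
  rw [← map_cov_pot Q hign z hpos, integral_map hm.aemeasurable (by fun_prop)] at h2
  exact h2.symm

variable {Q} in
-- Jensen's inequality in the form of a nonnegative conditional variance: the squared conditional
-- mean is at most the conditional second moment.
lemma memLp_outcomeMean (hign : TreatmentIgnorable Q) (z : Bool)
    (hpos : ∀ᵐ x ∂(covLaw Q), 0 < propensity Q z x) (hmom : MemLp (pot z) 2 Q) :
    MemLp (outcomeMean Q z) 2 (covLaw Q) := by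
  have hm : Measurable fun u : FullUnit 𝒳 => (cov u, pot z u) := by fun_prop
  have h : Integrable (fun p : 𝒳 × ℝ => p.2 ^ 2) ((covLaw Q) ⊗ₘ outcomeKernel Q z) := by
    rw [← map_cov_pot Q hign z hpos, integrable_map_measure (by fun_prop) hm.aemeasurable]
    exact hmom.integrable_sq
  refine (memLp_two_iff_integrable_sq (by fun_prop)).2 ?_
  refine ((Measure.integrable_compProd_iff (by fun_prop)).1 h).2.mono (by fun_prop) ?_
  filter_upwards [integrable_outcomeLaw_sq hign z hpos hmom] with x hx
  have h0 : 0 ≤ ∫ y, ‖y ^ 2‖ ∂(outcomeLaw Q z x) := integral_nonneg fun _ => norm_nonneg _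
  have := variance_nonneg (fun y => y) (outcomeLaw Q z x)
  rw [variance_eq_sub hx] at this
  rw [Real.norm_of_nonneg (sq_nonneg _), outcomeKernel_apply, Real.norm_of_nonneg h0]
  simpa [outcomeMean] using this

variable {Q} in
-- Second moments rule out the default value zero that a Bochner integral takes when it diverges.
-- Later lemmas take this identity as the hypothesis `hσ`.
lemma ofReal_outcomeVar (hign : TreatmentIgnorable Q) (z : Bool)
    (hpos : ∀ᵐ x ∂(covLaw Q), 0 < propensity Q z x) (hmom : MemLp (pot z) 2 Q) :
    ∀ᵐ x ∂(covLaw Q), ∫⁻ y, ENNReal.ofReal ((y - outcomeMean Q z x) ^ 2) ∂(outcomeLaw Q z x) =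
      ENNReal.ofReal (outcomeVar Q z x) := by
  filter_upwards [integrable_outcomeLaw_sq hign z hpos hmom] with x hx
  exact (ofReal_integral_eq_lintegral_ofReal
    (hx.sub (memLp_const (outcomeMean Q z x))).integrable_sq (ae_of_all _ fun _ => sq_nonneg _)).symm

end Ignorability

/-! ### Convergence to zero in probability -/

section ToZero

variable {Ω : Type*} [MeasurableSpace Ω] {P : Measure Ω} {f g : ℕ → Ω → ℝ≥0∞}

lemma ToZeroInProb.mono (hg : ToZeroInProb P g) (h : ∀ᶠ n in atTop, ∀ᵐ ω ∂P, f n ω ≤ g n ω) :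
    ToZeroInProb P f := fun δ hδ =>
  tendsto_of_tendsto_of_tendsto_of_le_of_le' tendsto_const_nhds (hg δ hδ)
    (Eventually.of_forall fun _ => zero_le) <| h.mono fun n hn => measure_mono_ae <| by
      filter_upwards [hn] with ω hω h1 using le_trans h1 hω

lemma ToZeroInProb.add (hf : ToZeroInProb P f) (hg : ToZeroInProb P g) :
    ToZeroInProb P fun n ω => f n ω + g n ω := fun δ hδ => by
  have h := (hf (δ / 2) (ENNReal.half_pos hδ.ne')).add (hg (δ / 2) (ENNReal.half_pos hδ.ne'))
  rw [add_zero] at h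
  refine tendsto_of_tendsto_of_tendsto_of_le_of_le tendsto_const_nhds h (fun _ => zero_le) fun n =>
    (measure_mono fun ω hω => ?_).trans (measure_union_le _ _)
  by_contra hc
  simp only [Set.mem_union, Set.mem_ofPred_eq, not_or, not_le] at hc hω
  exact absurd hω (not_le.2 ((ENNReal.add_lt_add hc.1 hc.2).trans_eq (ENNReal.add_halves δ)))

lemma toZeroInProb_zero : ToZeroInProb P fun _ _ => 0 := fun δ hδ => by
  simp [hδ.ne']

lemma ToZeroInProb.sum {ι : Type*} {s : Finset ι} {f : ι → ℕ → Ω → ℝ≥0∞}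
    (h : ∀ i ∈ s, ToZeroInProb P (f i)) : ToZeroInProb P fun n ω => ∑ i ∈ s, f i n ω := by
  classical
  induction s using Finset.induction_on with
  | empty => simpa using toZeroInProb_zero
  | insert a s ha ih =>
    simp_rw [Finset.sum_insert ha]
    exact (h a (Finset.mem_insert_self _ _)).add
      (ih fun i hi => h i (Finset.mem_insert_of_mem hi))

lemma ToZeroInProb.const_mul (hf : ToZeroInProb P f) {c : ℝ≥0∞} (hc : c ≠ ∞) :
    ToZeroInProb P fun n ω => c * f n ω := fun δ hδ => by
  refine tendsto_of_tendsto_of_tendsto_of_le_of_le tendsto_const_nhds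
    (hf (δ / (c + 1)) (ENNReal.div_pos hδ.ne' (by simp [hc]))) (fun _ => zero_le) fun n =>
    measure_mono fun ω (hω : δ ≤ c * f n ω) => ?_
  refine ENNReal.div_le_of_le_mul' (hω.trans ?_)
  gcongr
  exact le_self_add

lemma ToZeroInProb.sq (hf : ToZeroInProb P f) : ToZeroInProb P fun n ω => f n ω ^ 2 :=
    fun δ hδ => by
  refine tendsto_of_tendsto_of_tendsto_of_le_of_le tendsto_const_nhds
    -- Below the level one, squaring only decreases, so capping the threshold at one suffices.
    (hf (min δ 1) (lt_min hδ one_pos)) (fun _ => zero_le) fun n =>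
    measure_mono fun ω (hω : δ ≤ f n ω ^ 2) => ?_
  by_contra hc
  simp only [Set.mem_ofPred_eq, not_le, lt_min_iff] at hc
  refine absurd hω (not_le.2 (lt_of_le_of_lt ?_ hc.1))
  rw [_root_.sq]
  exact mul_le_of_le_one_left zero_le hc.2.le

lemma ToZeroInProb.sqrt (hf : ToZeroInProb P fun n ω => f n ω ^ 2) : ToZeroInProb P f :=
    fun δ hδ => by
  refine tendsto_of_tendsto_of_tendsto_of_le_of_le tendsto_const_nhds
    (hf (δ ^ 2) (pow_ne_zero 2 hδ.ne').bot_lt) (fun _ => zero_le) fun n =>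
    measure_mono fun ω (hω : δ ≤ f n ω) => ?_
  exact pow_le_pow_left₀ zero_le hω 2

lemma toZeroInProb_of_lintegral (hf : ∀ n, AEMeasurable (f n) P)
    (h : Tendsto (fun n => ∫⁻ ω, f n ω ∂P) atTop (𝓝 0)) : ToZeroInProb P f := fun δ hδ => by
  -- Markov's inequality divides by a finite threshold; an infinite one is replaced by the level
  -- one.
  by_cases htop : δ = ∞
  · refine tendsto_of_tendsto_of_tendsto_of_le_of_le tendsto_const_nhds h
      (fun _ => zero_le) fun n => ?_
    calc P {ω | δ ≤ f n ω} ≤ P {ω | 1 ≤ f n ω} :=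
          measure_mono fun ω (hω : δ ≤ f n ω) => (le_top.trans (htop ▸ hω) : (1 : ℝ≥0∞) ≤ f n ω)
      _ = 1 * P {ω | 1 ≤ f n ω} := (one_mul _).symm
      _ ≤ _ := mul_meas_ge_le_lintegral₀ (hf n) 1
  have h2 := ENNReal.Tendsto.div_const h (Or.inr hδ.ne' : (0 : ℝ≥0∞) ≠ 0 ∨ δ ≠ 0)
  rw [ENNReal.zero_div] at h2
  exact tendsto_of_tendsto_of_tendsto_of_le_of_le tendsto_const_nhds h2 (fun _ => zero_le)
    fun n => meas_ge_le_lintegral_div (hf n) hδ.ne' htop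

lemma ToZeroInProb.tendstoInMeasure {X : ℕ → Ω → ℝ}
    (h : ToZeroInProb P fun n ω => ‖X n ω‖ₑ) : TendstoInMeasure P X atTop 0 := fun δ hδ => by
  simpa [edist_zero_right] using h δ hδ

end ToZero

/-! ### A conditional weak law for cross-fitted sums -/

section ConditionalWeakLaw

variable {Ω : Type*} [MeasurableSpace Ω] {P : Measure Ω} [IsProbabilityMeasure P]
  {E : Type*} [MeasurableSpace E] {W : ℕ → Ω → E} {ρ : Measure E} [IsProbabilityMeasure ρ]

open scoped Classical in
/-- The sequence `d` with the entries outside `J` replaced by the default value `e₀`. -/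
def mask (J : Finset ℕ) (e₀ : E) (d : ℕ → E) (i : ℕ) : E := if i ∈ J then d i else e₀

lemma mask_of_mem {J : Finset ℕ} {e₀ : E} {d : ℕ → E} {i : ℕ} (hi : i ∈ J) :
    mask J e₀ d i = d i := by simp [mask, hi]

lemma measurable_mask (J : Finset ℕ) (e₀ : E) : Measurable (mask J e₀) := by
  refine measurable_pi_lambda _ fun i => ?_
  by_cases hi : i ∈ J
  · simpa [mask, hi] using measurable_pi_apply i
  · simp [mask, hi]

/-- Nuisance estimates are written as functions of the whole data sequence. Masking makes their
dependence on the coordinates in `J` alone explicit without changing the type, so independence of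
disjoint blocks applies. -/
lemma indepFun_mask (hW : ∀ i, Measurable (W i)) (hindep : iIndepFun W P) {J C : Finset ℕ}
    (hdisj : Disjoint J C) (e₀ : E) :
    IndepFun (fun ω => mask J e₀ fun i => W i ω) (fun ω (i : C) => W i ω) P := by
  classical
  have h := hindep.indepFun_finset J C hdisj hW
  have hφ : Measurable fun (v : J → E) (i : ℕ) => if hi : i ∈ J then v ⟨i, hi⟩ else e₀ := by
    refine measurable_pi_lambda _ fun i => ?_
    by_cases hi : i ∈ J
    · simpa [hi] using measurable_pi_apply _
    · simp [hi]
  have h2 := h.comp hφ measurable_id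
  convert h2 using 1
  · ext ω i
    by_cases hi : i ∈ J <;> simp [mask, hi]
  · rfl

/-- Chebyshev's inequality under the product law, with the variance of each summand bounded by its
second moment. -/
lemma pi_sum_sub_integral_ge_le {C : Type*} [Fintype C] {h : E → ℝ} (hm : Measurable h)
    {η a : ℝ} (ha : 0 < a) (hη : ∫⁻ w, ENNReal.ofReal (h w ^ 2) ∂ρ ≤ ENNReal.ofReal η)
    (hη0 : 0 ≤ η) :
    (Measure.pi fun _ : C => ρ) {v | a ≤ |∑ i, (h (v i) - ∫ w, h w ∂ρ)|} ≤
      ENNReal.ofReal (Fintype.card C * η / a ^ 2) := by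
  have hint : Integrable (fun w => h w ^ 2) ρ := by
    refine ⟨by fun_prop, ?_⟩
    rw [hasFiniteIntegral_iff_ofReal (ae_of_all _ fun _ => sq_nonneg _)]
    exact hη.trans_lt ENNReal.ofReal_lt_top
  have hL : MemLp h 2 ρ := (memLp_two_iff_integrable_sq (by fun_prop)).2 hint
  have hLi : ∀ i : C, MemLp (fun v : C → E => h (v i)) 2 (Measure.pi fun _ : C => ρ) :=
    fun i => hL.comp_measurePreserving (measurePreserving_eval _ i)
  have hsum : MemLp (fun v : C → E => ∑ i, h (v i)) 2 (Measure.pi fun _ : C => ρ) :=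
    memLp_finsetSum _ fun i _ => hLi i
  have hvar : variance (fun v : C → E => ∑ i, h (v i)) (Measure.pi fun _ : C => ρ) =
      Fintype.card C * variance h ρ := by
    have := variance_sum_pi (μ := fun _ : C => ρ) (X := fun _ => h) fun _ => hL
    have h2 : (∑ i : C, fun ω : C → E => h (ω i)) = fun v => ∑ i, h (v i) := by
      ext v; simp
    rw [h2] at this
    simpa using this
  have hmean : ∫ v, ∑ i, h (v i) ∂(Measure.pi fun _ : C => ρ) =
      Fintype.card C * ∫ w, h w ∂ρ := by
    rw [integral_finsetSum _ fun i _ => (hLi i).integrable one_le_two]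
    have : ∀ i : C, ∫ v : C → E, h (v i) ∂(Measure.pi fun _ : C => ρ) = ∫ w, h w ∂ρ := fun i =>
      integral_comp_eval (μ := fun _ : C => ρ) (by fun_prop)
    simp [this]
  have h1 := meas_ge_le_variance_div_sq hsum ha
  rw [hvar, hmean] at h1
  have h3 : variance h ρ ≤ η := by
    refine (variance_le_expectation_sq (by fun_prop)).trans ?_
    rw [← ENNReal.ofReal_le_ofReal_iff hη0]
    refine le_trans (le_of_eq ?_) hη
    exact ofReal_integral_eq_lintegral_ofReal hint (ae_of_all _ fun _ => sq_nonneg _)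
  calc _ = (Measure.pi fun _ : C => ρ) {v | a ≤ |∑ i, h (v i) - Fintype.card C * ∫ w, h w ∂ρ|} := by
        simp [Finset.sum_sub_distrib]
    _ ≤ _ := h1.trans (ENNReal.ofReal_le_ofReal (by gcongr))

/-- Conditional Chebyshev inequality: the nuisance `G` is independent of the summation sample. -/
lemma measure_sum_sub_integral_ge_le {S : Type*} [MeasurableSpace S] {G : Ω → S}
    (hG : Measurable G) (hW : ∀ i, Measurable (W i)) (hindep : iIndepFun W P)
    (hlaw : ∀ i, P.map (W i) = ρ) (C : Finset ℕ)
    (hGC : IndepFun G (fun ω (i : C) => W i ω) P) {h : S → E → ℝ}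
    (hm : Measurable (Function.uncurry h)) {η a : ℝ} (ha : 0 < a) (hη : 0 ≤ η) :
    P {ω | a ≤ |∑ i ∈ C, (h (G ω) (W i ω) - ∫ w, h (G ω) w ∂ρ)|} ≤
      P {ω | ENNReal.ofReal η ≤ ∫⁻ w, ENNReal.ofReal (h (G ω) w ^ 2) ∂ρ} +
        ENNReal.ofReal (C.card * η / a ^ 2) := by
  have hWC : Measurable fun ω (i : C) => W i ω := measurable_pi_lambda _ fun i => hW i
  have hlawC : P.map (fun ω (i : C) => W i ω) = Measure.pi fun _ : C => ρ := by
    rw [iIndepFun.map_fun_eq_pi_map (fun i : C => (hW i).aemeasurable) (hindep.restrict C)]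
    simp_rw [hlaw]
  have hjoint : P.map (fun ω => (G ω, fun i : C => W i ω)) =
      (P.map G).prod (Measure.pi fun _ : C => ρ) := by
    rw [(indepFun_iff_map_prod_eq_prod_map_map hG.aemeasurable hWC.aemeasurable).1 hGC, hlawC]
  have hint : Measurable fun g => ∫ w, h g w ∂ρ :=
    (hm.stronglyMeasurable.integral_prod_right' (ν := ρ)).measurable
  have hsum : Measurable fun p : S × (C → E) => |∑ i : C, (h p.1 (p.2 i) - ∫ w, h p.1 w ∂ρ)| := by
    refine measurable_norm.comp (g := fun r : ℝ => ‖r‖) (Finset.measurable_sum _ fun i _ => ?_)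
    refine Measurable.sub ?_ (hint.comp measurable_fst)
    exact hm.comp (measurable_fst.prodMk ((measurable_pi_apply i).comp measurable_snd))
  set T : Set (S × (C → E)) := {p | a ≤ |∑ i : C, (h p.1 (p.2 i) - ∫ w, h p.1 w ∂ρ)|} with hT
  have hTm : MeasurableSet T := measurableSet_le measurable_const hsum
  have hVm : Measurable fun g => ∫⁻ w, ENNReal.ofReal (h g w ^ 2) ∂ρ := by
    have : Measurable fun p : S × E => ENNReal.ofReal (Function.uncurry h p ^ 2) := by fun_prop
    exact this.lintegral_prod_right'
  have hset : {ω | a ≤ |∑ i ∈ C, (h (G ω) (W i ω) - ∫ w, h (G ω) w ∂ρ)|} =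
      (fun ω => (G ω, fun i : C => W i ω)) ⁻¹' T := by
    ext ω
    simp only [hT, Set.mem_ofPred_eq, Set.mem_preimage]
    rw [Finset.sum_coe_sort C fun i => h (G ω) (W i ω) - ∫ w, h (G ω) w ∂ρ]
  set D : Set S := {g | ENNReal.ofReal η ≤ ∫⁻ w, ENNReal.ofReal (h g w ^ 2) ∂ρ} with hD
  have hDm : MeasurableSet D := measurableSet_le measurable_const hVm
  have : IsProbabilityMeasure (P.map G) := Measure.isProbabilityMeasure_map hG.aemeasurable
  rw [hset, ← Measure.map_apply (hG.prodMk hWC) hTm, hjoint, Measure.prod_apply hTm]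
  -- For fixed nuisance `g`, either its second moment reaches η and the probability is bounded by
  -- one, or Chebyshev applies.
  calc _ ≤ ∫⁻ g, (D.indicator 1 g + ENNReal.ofReal (C.card * η / a ^ 2)) ∂(P.map G) := by
        refine lintegral_mono fun g => ?_
        by_cases hg : g ∈ D
        · rw [Set.indicator_of_mem hg]
          exact prob_le_one.trans le_self_add
        · rw [Set.indicator_of_notMem hg, zero_add]
          simp only [hD, Set.mem_ofPred_eq, not_le] at hg
          have := pi_sum_sub_integral_ge_le (C := C) (hm.of_uncurry_left (x := g)) ha hg.le hη
          simpa [hT] using this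
    _ = P.map G D + ENNReal.ofReal (C.card * η / a ^ 2) := by
        rw [lintegral_add_right _ measurable_const, lintegral_indicator_one hDm]
        simp
    _ = _ := by rw [Measure.map_apply hG hDm]; rfl

/-- At the level `√n * b`, with at most n summands of second moment below η, the conditional
Chebyshev bound is η/b², uniformly in n. A small η makes it small, and the second moments fall below
η with probability tending to one. -/
lemma toZeroInProb_sum_sub_integral (hW : ∀ i, Measurable (W i)) (hindep : iIndepFun W P)
    (hlaw : ∀ i, P.map (W i) = ρ) {J C : ℕ → Finset ℕ} (hdisj : ∀ n, Disjoint (J n) (C n))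
    (hcard : ∀ n, (C n).card ≤ n) (e₀ : E) {h : ℕ → (ℕ → E) → E → ℝ}
    (hm : ∀ n, Measurable (Function.uncurry (h n)))
    (hV : ToZeroInProb P fun n ω =>
      ∫⁻ w, ENNReal.ofReal (h n (mask (J n) e₀ fun i => W i ω) w ^ 2) ∂ρ) :
    ToZeroInProb P fun n ω => ‖(√(n : ℝ))⁻¹ * ∑ i ∈ C n,
      (h n (mask (J n) e₀ fun i => W i ω) (W i ω) -
        ∫ w, h n (mask (J n) e₀ fun i => W i ω) w ∂ρ)‖ₑ := by
  intro δ hδ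
  obtain ⟨b, hb0, hbδ⟩ : ∃ b : ℝ, 0 < b ∧ ENNReal.ofReal b ≤ δ := by
    by_cases htop : δ = ∞
    · exact ⟨1, one_pos, by simp [htop]⟩
    · exact ⟨δ.toReal, ENNReal.toReal_pos hδ.ne' htop, ENNReal.ofReal_toReal_le⟩
  rw [ENNReal.tendsto_atTop_zero]
  intro γ hγ
  obtain ⟨c, hc0, hcγ⟩ : ∃ c : ℝ, 0 < c ∧ ENNReal.ofReal c ≤ γ / 2 := by
    have h2 : 0 < γ / 2 := ENNReal.half_pos hγ.ne'
    by_cases htop : γ / 2 = ∞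
    · exact ⟨1, one_pos, by simp [htop]⟩
    · exact ⟨(γ / 2).toReal, ENNReal.toReal_pos h2.ne' htop, ENNReal.ofReal_toReal_le⟩
  -- Chosen so that the Chebyshev bound η/b² equals c, hence at most half of the allowed
  -- probability.
  set η : ℝ := c * b ^ 2 with hη
  have hη0 : 0 < η := by positivity
  have h1 := (ENNReal.tendsto_atTop_zero.1 (hV (ENNReal.ofReal η) (ENNReal.ofReal_pos.2 hη0)))
    (γ / 2) (ENNReal.half_pos hγ.ne')
  obtain ⟨N, hN⟩ := h1
  refine ⟨N + 1, fun n hn => ?_⟩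
  have hn0 : (0 : ℝ) < n := by exact_mod_cast (Nat.succ_pos N).trans_le hn
  have hGm : Measurable fun ω => mask (J n) e₀ fun i => W i ω :=
    (measurable_mask (J n) e₀).comp (measurable_pi_lambda _ hW)
  have hs : 0 < √(n : ℝ) := Real.sqrt_pos.2 hn0
  have key := measure_sum_sub_integral_ge_le hGm hW hindep hlaw (C n)
    (indepFun_mask hW hindep (hdisj n) e₀) (hm n) (mul_pos hs hb0) hη0.le
  refine (measure_mono ?_).trans (key.trans ?_)
  · intro ω hω
    simp only [Set.mem_ofPred_eq] at hω ⊢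
    have h3 := hbδ.trans hω
    rw [← ofReal_norm, ENNReal.ofReal_le_ofReal_iff (norm_nonneg _), norm_mul, norm_inv,
      Real.norm_of_nonneg hs.le, inv_mul_eq_div, le_div_iff₀ hs, mul_comm] at h3
    exact h3
  · rw [← ENNReal.add_halves γ]
    refine add_le_add (hN n (by omega)) (le_trans (ENNReal.ofReal_le_ofReal ?_) hcγ)
    rw [mul_pow, Real.sq_sqrt hn0.le, div_le_iff₀ (by positivity), hη]
    have : ((C n).card : ℝ) ≤ n := by exact_mod_cast hcard n
    calc ((C n).card : ℝ) * (c * b ^ 2) ≤ n * (c * b ^ 2) := by gcongr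
      _ = c * (n * b ^ 2) := by ring

end ConditionalWeakLaw

/-! ### Central limit theorem for finitely many groups -/

section GroupedCLT

variable {Ω : Type*} [MeasurableSpace Ω] {P : Measure Ω} [IsProbabilityMeasure P]

lemma charFun_map_sub_isLittleO {X : Ω → ℝ} (hX : MemLp X 2 P) (h0 : ∫ ω, X ω ∂P = 0) :
    (fun t => charFun (P.map X) t - (1 - (∫ ω, X ω ^ 2 ∂P : ℝ) * (t : ℂ) ^ 2 / 2)) =o[𝓝 0]
      fun t : ℝ => t ^ 2 := by
  have hm : AEMeasurable X P := hX.aestronglyMeasurable.aemeasurable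
  have : IsProbabilityMeasure (P.map X) := Measure.isProbabilityMeasure_map hm
  have hint : MemLp id 2 (P.map X) := (memLp_map_measure_iff (by fun_prop) hm).2 hX
  have h1 : ∀ t : ℝ, taylorWithinEval (charFun (P.map X)) 2 Set.univ 0 t =
      1 - (∫ ω, X ω ^ 2 ∂P : ℝ) * (t : ℂ) ^ 2 / 2 := fun t => by
    rw [taylorWithinEval_charFun_two_zero hm hint, h0]
    simp
  simp_rw [← h1]
  convert! taylor_isLittleO_univ (x₀ := (0 : ℝ)) (contDiff_charFun (n := 2) hint) using 2
  simp

/-- The limit (1 + w/n)ⁿ → exp w, with the exponent n replaced by one asymptotic to c n; the proof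
takes logarithms. -/
lemma tendsto_pow_of_tendsto_mul_sub_one {z : ℕ → ℂ} {w : ℂ} {m : ℕ → ℕ} {c : ℝ}
    (hz : Tendsto (fun n : ℕ => (n : ℂ) * (z n - 1)) atTop (𝓝 w))
    (hm : Tendsto (fun n : ℕ => (m n : ℝ) / n) atTop (𝓝 c)) :
    Tendsto (fun n => z n ^ m n) atTop (𝓝 (Complex.exp (c * w))) := by
  have h1 := Complex.tendsto_nat_mul_log_one_add_of_tendsto hz
  have hm' : Tendsto (fun n : ℕ => ((m n : ℂ) / n)) atTop (𝓝 (c : ℂ)) := by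
    have := (Complex.continuous_ofReal.tendsto c).comp hm
    refine this.congr fun n => by simp
  have h2 := (Complex.continuous_exp.tendsto _).comp (hm'.mul h1)
  have hz1 : Tendsto (fun n => z n - 1) atTop (𝓝 0) := by
    have h3 : Tendsto (fun n : ℕ => ((n : ℂ))⁻¹) atTop (𝓝 0) := tendsto_inv_atTop_nhds_zero_nat
    have h4 := h3.mul hz
    rw [zero_mul] at h4
    refine h4.congr' ?_
    filter_upwards [eventually_ne_atTop 0] with n hn
    rw [inv_mul_cancel_left₀ (by exact_mod_cast hn)]
  -- Needed to recover `z n` as the exponential of its logarithm.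
  have hne : ∀ᶠ n in atTop, z n ≠ 0 := by
    have h5 : Tendsto z atTop (𝓝 1) := by simpa using hz1.add_const 1
    exact h5.eventually_ne one_ne_zero
  refine h2.congr' ?_
  filter_upwards [eventually_ne_atTop 0, hne] with n hn hzn
  have hn' : (n : ℂ) ≠ 0 := by exact_mod_cast hn
  simp only [Function.comp, add_sub_cancel]
  rw [← mul_assoc, div_mul_cancel₀ _ hn', Complex.exp_nat_mul, Complex.exp_log hzn]

lemma tendsto_charFun_pow {X : Ω → ℝ} (hX : MemLp X 2 P) (h0 : ∫ ω, X ω ∂P = 0) {m : ℕ → ℕ}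
    {c : ℝ} (hm : Tendsto (fun n : ℕ => (m n : ℝ) / n) atTop (𝓝 c)) (t : ℝ) :
    Tendsto (fun n : ℕ => charFun (P.map X) ((√(n : ℝ))⁻¹ * t) ^ m n) atTop
      (𝓝 (Complex.exp (c * (-(∫ ω, X ω ^ 2 ∂P : ℝ) * (t : ℂ) ^ 2 / 2)))) := by
  refine tendsto_pow_of_tendsto_mul_sub_one ?_ hm
  have hlim : Tendsto (fun n : ℕ => (√(n : ℝ))⁻¹ * t) atTop (𝓝 0) := by
    rw [← zero_mul t]
    exact .mul_const t (tendsto_inv_atTop_zero.comp <| Real.tendsto_sqrt_atTop.comp <|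
      tendsto_natCast_atTop_atTop)
  have h1 := (charFun_map_sub_isLittleO hX h0).comp_tendsto hlim
  have h2 : (fun n : ℕ => charFun (P.map X) ((√(n : ℝ))⁻¹ * t) -
      (1 - (∫ ω, X ω ^ 2 ∂P : ℝ) * (t : ℂ) ^ 2 / 2 / n)) =o[atTop] fun n : ℕ => (n : ℝ)⁻¹ := by
    refine (h1.congr' ?_ ?_).of_const_mul_right (c := t ^ 2)
    · refine Eventually.of_forall fun n => ?_
      have : ((√(n : ℝ) : ℝ) : ℂ) ^ 2 = n := by
        rw [← Complex.ofReal_pow, Real.sq_sqrt (Nat.cast_nonneg _)]; simp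
      simp only [Function.comp, Complex.ofReal_mul, Complex.ofReal_inv, mul_pow, inv_pow, this]
      ring
    · refine Eventually.of_forall fun n => ?_
      simp only [Function.comp, mul_pow, inv_pow, Real.sq_sqrt (Nat.cast_nonneg n)]
      ring
  have h3 := h2.tendsto_inv_smul_nhds_zero.add_const
    (-(∫ ω, X ω ^ 2 ∂P : ℝ) * (t : ℂ) ^ 2 / 2)
  rw [zero_add] at h3
  refine h3.congr' ?_
  filter_upwards [eventually_ne_atTop 0] with n hn
  have hn' : (n : ℂ) ≠ 0 := by exact_mod_cast hn
  simp only [inv_inv, Complex.real_smul, Complex.ofReal_natCast]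
  field_simp
  ring

variable {E : Type*} [MeasurableSpace E] {W : ℕ → Ω → E} {ρ : Measure E}
  {ι : Type*} [Fintype ι] [DecidableEq ι]

/-- The assignment of indices to groups may change with n, but the characteristic function of the
sum depends only on the group sizes: it is a finite product of powers, each converging to a Gaussian
factor with weight `c t`. -/
theorem tendstoInDistribution_grouped_sum (hW : ∀ i, Measurable (W i)) (hindep : iIndepFun W P)
    (hlaw : ∀ i, P.map (W i) = ρ) {f : ι → E → ℝ} (hf : ∀ t, Measurable (f t))
    (hf2 : ∀ t, MemLp (f t) 2 ρ) (hf0 : ∀ t, ∫ w, f t w ∂ρ = 0) {b : ℕ → ℕ → ι} {c : ι → ℝ}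
    (hb : ∀ t, Tendsto (fun n : ℕ => (((Finset.range n).filter fun i => b n i = t).card : ℝ) / n)
      atTop (𝓝 (c t))) (hc : ∀ t, 0 ≤ c t) :
    TendstoInDistribution
      (fun (n : ℕ) (ω : Ω) => (√(n : ℝ))⁻¹ * ∑ i ∈ Finset.range n, f (b n i) (W i ω))
      atTop (id : ℝ → ℝ) (fun _ => P)
      (gaussianReal 0 (∑ t, c t * ∫ w, f t w ^ 2 ∂ρ).toNNReal) where
  forall_aemeasurable n :=
    (Finset.measurable_sum _ fun i _ => (hf _).comp (hW i)).const_mul _ |>.aemeasurable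
  tendsto := by
    have hρ : IsProbabilityMeasure ρ := by
      rw [← hlaw 0]; exact Measure.isProbabilityMeasure_map (hW 0).aemeasurable
    refine ProbabilityMeasure.tendsto_iff_tendsto_charFun.2 fun s => ?_
    have hv : 0 ≤ ∑ t, c t * ∫ w, f t w ^ 2 ∂ρ :=
      Finset.sum_nonneg fun t _ => mul_nonneg (hc t) (integral_nonneg fun _ => sq_nonneg _)
    have hprod : ∀ n : ℕ, charFun (P.map fun ω => (√(n : ℝ))⁻¹ *
        ∑ i ∈ Finset.range n, f (b n i) (W i ω)) s =
        ∏ t, charFun (ρ.map (f t)) ((√(n : ℝ))⁻¹ * s) ^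
          ((Finset.range n).filter fun i => b n i = t).card := fun n => by
      have hm : ∀ i, Measurable fun ω => f (b n i) (W i ω) := fun i => (hf _).comp (hW i)
      have hind : iIndepFun (fun i ω => f (b n i) (W i ω)) P :=
        hindep.comp (fun i => f (b n i)) fun i => hf _
      rw [charFun_map_mul_comp (Finset.measurable_sum _ fun i _ => hm i).aemeasurable,
        (hind.restrict _).charFun_map_fun_finsetSum_eq_prod fun i _ => (hm i).aemeasurable,
        Finset.prod_apply]
      rw [← Finset.prod_fiberwise (Finset.range n) (b n)]
      refine Finset.prod_congr rfl fun t _ => Finset.prod_eq_pow_card fun i hi => ?_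
      rw [← hlaw i, Measure.map_map (hf t) (hW i), ← (Finset.mem_filter.1 hi).2]
      rfl
    have hlim := tendsto_finsetProd Finset.univ fun t (_ : t ∈ Finset.univ) =>
      tendsto_charFun_pow (hf2 t) (hf0 t) (hb t) s
    simp only [ProbabilityMeasure.coe_mk, Measure.map_id, charFun_gaussianReal]
    simp_rw [hprod]
    convert hlim using 2
    rw [← Complex.exp_sum]
    congr 1
    rw [Real.coe_toNNReal _ hv, Complex.ofReal_sum, Finset.sum_mul, Finset.sum_div,
      Complex.ofReal_zero, mul_zero, zero_mul, zero_sub, ← Finset.sum_neg_distrib]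
    refine Finset.sum_congr rfl fun t _ => ?_
    rw [Complex.ofReal_mul]
    ring

end GroupedCLT

/-! ### Measurability of the procedure and its dependence on the data -/

section ProcedureMeasurability

variable {𝒳 : Type*} [MeasurableSpace 𝒳] {K : ℕ} (D : Design K) (L : Learners 𝒳)
  {A : Type*} [MeasurableSpace A]

lemma measurable_bool_select {β : Type*} [MeasurableSpace β] {g : Bool → A → β} {τ : A → Bool}
    (hg : ∀ z, Measurable (g z)) (hτ : Measurable τ) : Measurable fun a => g (τ a) a := by
  have : (fun a => g (τ a) a) = fun a => if τ a = true then g true a else g false a := by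
    ext a; cases h : τ a <;> simp
  rw [this]
  exact Measurable.ite (hτ (measurableSet_singleton true)) (hg _) (hg _)

lemma measurable_annotate {p : A → Bool → 𝒳 → ℝ}
    (hp : ∀ z, Measurable fun q : A × 𝒳 => p q.1 z q.2) :
    Measurable fun q : A × (FullUnit 𝒳 × ℝ) => annotate (p q.1) q.2.1 q.2.2 := by
  have hu : Measurable fun q : A × (FullUnit 𝒳 × ℝ) => q.2.1 := by fun_prop
  have hthr : Measurable fun q : A × (FullUnit 𝒳 × ℝ) => p q.1 (trt q.2.1) (cov q.2.1) :=
    measurable_bool_select (g := fun z (q : A × (FullUnit 𝒳 × ℝ)) => p q.1 z (cov q.2.1))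
      (τ := fun q => trt q.2.1)
      (fun z => (hp z).comp (measurable_fst.prodMk (measurable_cov.comp hu)))
      (measurable_trt.comp hu)
  have hset : MeasurableSet
      {q : A × (FullUnit 𝒳 × ℝ) | q.2.2 ≤ p q.1 (trt q.2.1) (cov q.2.1)} :=
    measurableSet_le (by fun_prop) hthr
  refine (measurable_cov.comp hu).prodMk ((measurable_trt.comp hu).prodMk (Measurable.prodMk ?_ ?_))
  · simpa [Bool.decide_eq_true] using
      (Measurable.ite hset (measurable_const (a := true)) (measurable_const (a := false)))
  · exact Measurable.ite hset (measurable_outcome.comp hu) measurable_const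

lemma measurable_firstRec (i : ℕ) :
    Measurable fun d : ℕ → FullUnit 𝒳 × ℝ => firstRec D d i :=
  (measurable_annotate (A := Unit) (p := fun _ z _ => D.π₁ z) fun _ => measurable_const).comp
    (measurable_const (a := ()) |>.prodMk (measurable_pi_apply i))

lemma measurable_plugInProb (n : ℕ) (S : Finset ℕ) (z : Bool) :
    Measurable fun q : (S → Rec 𝒳) × 𝒳 => plugInProb D L n S q.1 z q.2 := by
  unfold plugInProb
  have hs : ∀ z, Measurable fun q : (S → Rec 𝒳) × 𝒳 =>
      ∑ i : S, √(L.var n S q.1 z (q.1 i).1) := fun z =>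
    Finset.measurable_sum _ fun i _ => ((L.measurable_var n S z).comp
      (measurable_fst.prodMk (measurable_fst.comp
        ((measurable_pi_apply i).comp measurable_fst)))).sqrt
  simp_rw [Finset.sum_add_distrib]
  exact ((((L.measurable_var n S z).sqrt.div (L.measurable_prop n S z)).mul_const _).mul
    (((hs true).add (hs false)).div_const _).inv)

lemma measurable_designProb (n : ℕ) (k : Fin K) (z : Bool) :
    Measurable fun q : (ℕ → FullUnit 𝒳 × ℝ) × 𝒳 => designProb D L q.1 n k z q.2 :=
  (measurable_plugInProb D L n (D.cell n 0 k) z).comp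
    (f := fun q : (ℕ → FullUnit 𝒳 × ℝ) × 𝒳 =>
      ((fun i : D.cell n 0 k => firstRec D q.1 i, q.2) : (D.cell n 0 k → Rec 𝒳) × 𝒳))
    ((measurable_pi_lambda _ fun i : D.cell n 0 k =>
      (measurable_firstRec D i).comp measurable_fst).prodMk measurable_snd)

lemma measurable_secondProb (n : ℕ) (k : Fin K) (z : Bool) :
    Measurable fun q : (ℕ → FullUnit 𝒳 × ℝ) × 𝒳 => secondProb D L q.1 n k z q.2 :=
  ((measurable_designProb D L n k z).sub_const _).const_mul _

lemma measurable_record (n i : ℕ) :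
    Measurable fun d : ℕ → FullUnit 𝒳 × ℝ => record D L d n i := by
  unfold record
  split_ifs
  · exact measurable_firstRec D i
  · exact (measurable_annotate (p := fun d => secondProb D L d n (D.fold n i))
      (measurable_secondProb D L n (D.fold n i))).comp
      (measurable_id.prodMk (measurable_pi_apply i))

lemma measurable_records (n : ℕ) (S : Finset ℕ) :
    Measurable fun q : (ℕ → FullUnit 𝒳 × ℝ) × 𝒳 =>
      ((fun i : S => record D L q.1 n i, q.2) : (S → Rec 𝒳) × 𝒳) :=
  (measurable_pi_lambda _ fun i : S => (measurable_record D L n i).comp measurable_fst).prodMk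
    measurable_snd

lemma measurable_meanHat (n : ℕ) (k : Fin K) (z : Bool) :
    Measurable fun q : (ℕ → FullUnit 𝒳 × ℝ) × 𝒳 => meanHat D L q.1 n k z q.2 :=
  (L.measurable_mean n _ z).comp (measurable_records D L n _)

lemma measurable_propHat (n : ℕ) (k : Fin K) (z : Bool) :
    Measurable fun q : (ℕ → FullUnit 𝒳 × ℝ) × 𝒳 => propHat D L q.1 n k z q.2 :=
  (L.measurable_prop n _ z).comp (measurable_records D L n _)

lemma measurable_probHat (n : ℕ) (k : Fin K) (z : Bool) :
    Measurable fun q : (ℕ → FullUnit 𝒳 × ℝ) × 𝒳 => probHat D L q.1 n k z q.2 :=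
  (measurable_plugInProb D L n _ z).comp (measurable_records D L n _)

lemma measurable_score {m e π : A → Bool → 𝒳 → ℝ} (z : Bool)
    (hm : Measurable fun q : A × 𝒳 => m q.1 z q.2) (he : Measurable fun q : A × 𝒳 => e q.1 z q.2)
    (hπ : Measurable fun q : A × 𝒳 => π q.1 z q.2) :
    Measurable fun q : A × Rec 𝒳 => score (m q.1) (e q.1) (π q.1) z q.2 := by
  have hx : Measurable fun q : A × Rec 𝒳 => (q.1, q.2.1) := by fun_prop
  have hset : MeasurableSet {q : A × Rec 𝒳 | q.2.2.1 = z ∧ q.2.2.2.1 = true} :=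
    (measurableSet_eq_fun (by fun_prop) measurable_const).inter
      (measurableSet_eq_fun (by fun_prop) measurable_const)
  unfold score
  refine Measurable.add (Measurable.div (Measurable.ite hset ?_ measurable_const) ?_) (hm.comp hx)
  · exact Measurable.sub (by fun_prop) (hm.comp hx)
  · exact (he.comp hx).mul (hπ.comp hx)

lemma measurable_aipw (n : ℕ) :
    Measurable fun d : ℕ → FullUnit 𝒳 × ℝ => aipw D L d n := by
  have hs : ∀ (k : Fin K) (i : ℕ) (z : Bool), Measurable fun d : ℕ → FullUnit 𝒳 × ℝ =>
      score (meanHat D L d n k) (propHat D L d n k) (probHat D L d n k) z (record D L d n i) :=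
    fun k i z => (measurable_score (m := fun d => meanHat D L d n k)
      (e := fun d => propHat D L d n k) (π := fun d => probHat D L d n k) z
      (measurable_meanHat D L n k z) (measurable_propHat D L n k z)
      (measurable_probHat D L n k z)).comp (measurable_id.prodMk (measurable_record D L n i))
  unfold aipw
  refine (Finset.measurable_sum _ fun t _ => Finset.measurable_sum _ fun k _ =>
    Finset.measurable_sum _ fun i _ => ?_).const_mul _
  exact (hs k i true).sub (hs k i false)

variable {d d' : ℕ → FullUnit 𝒳 × ℝ} {n : ℕ} {k : Fin K}

lemma designProb_congr (h : ∀ i ∈ D.cell n 0 k, d i = d' i) :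
    designProb D L d n k = designProb D L d' n k := by
  unfold designProb
  congr 1
  ext1 i
  simp [firstRec, h i i.2]

/-- The only other units that influence a record are those of the first batch of its own fold,
through the design of the second batch. -/
lemma record_congr {i : ℕ} (hi : d i = d' i) (h : ∀ j ∈ D.cell n 0 (D.fold n i), d j = d' j) :
    record D L d n i = record D L d' n i := by
  have h2 : secondProb D L d n (D.fold n i) = secondProb D L d' n (D.fold n i) := by
    unfold secondProb
    rw [designProb_congr D L h]
  simp [record, firstRec, hi, h2]

/-- Since annotation in a fold is designed within that fold, adaptivity does not leak the units of
fold `k` into the records outside it. This is what makes cross-fitting valid. -/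
lemma records_outOfFold_congr (h : ∀ i ∈ D.outOfFold n k, d i = d' i) :
    (fun i : D.outOfFold n k => record D L d n i) =
      fun i : D.outOfFold n k => record D L d' n i := by
  ext1 i
  have hi := (Finset.mem_filter.1 i.2).2
  refine record_congr D L (h i i.2) fun j hj => h j ?_
  simp only [Design.cell, Design.outOfFold, Finset.mem_filter] at hj ⊢
  exact ⟨hj.1, hj.2.2 ▸ hi⟩

lemma meanHat_congr (h : ∀ i ∈ D.outOfFold n k, d i = d' i) :
    meanHat D L d n k = meanHat D L d' n k := by
  unfold meanHat; rw [records_outOfFold_congr D L h]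

lemma propHat_congr (h : ∀ i ∈ D.outOfFold n k, d i = d' i) :
    propHat D L d n k = propHat D L d' n k := by
  unfold propHat; rw [records_outOfFold_congr D L h]

lemma probHat_congr (h : ∀ i ∈ D.outOfFold n k, d i = d' i) :
    probHat D L d n k = probHat D L d' n k := by
  unfold probHat; rw [records_outOfFold_congr D L h]

end ProcedureMeasurability

/-! ### Moments of the augmented score of one unit -/

section UnitMoments

/-- The uniform law on `[0, 1]`. -/
noncomputable abbrev unifLaw : Measure ℝ := volume.restrict (Set.Icc (0 : ℝ) 1)

instance : IsProbabilityMeasure unifLaw := ⟨by simp [unifLaw]⟩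

/-- An estimated second-batch probability may leave [0, 1]; the effective annotation probability is
its truncation. -/
lemma unifLaw_real_Iic (p : ℝ) : unifLaw.real {v | v ≤ p} = max 0 (min 1 p) := by
  have h : {v : ℝ | v ≤ p} ∩ Set.Icc 0 1 = Set.Icc 0 (min 1 p) := by
    ext v; simp only [Set.mem_inter_iff, Set.mem_ofPred_eq, Set.mem_Icc, le_min_iff]; tauto
  rw [measureReal_def, unifLaw,
    Measure.restrict_apply (show MeasurableSet {v : ℝ | v ≤ p} from measurableSet_Iic), h, Real.volume_Icc, sub_zero,
    ENNReal.toReal_ofReal', max_comm]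

variable {𝒳 : Type*} [MeasurableSpace 𝒳]

/-- The annotation indicator `1[v ≤ p(x)]`. -/
noncomputable def annInd (p : 𝒳 → ℝ) (x : 𝒳) (v : ℝ) : ℝ := if v ≤ p x then 1 else 0

/-- The treatment indicator `1[Z = z]`. -/
noncomputable def trtInd (z : Bool) (u : FullUnit 𝒳) : ℝ := if trt u = z then 1 else 0

/-- The inverse probability weight `1[v ≤ p(x)] / (e(x) π(x))`. -/
noncomputable def ipw (e π p : 𝒳 → ℝ) (x : 𝒳) (v : ℝ) : ℝ := annInd p x v / (e x * π x)

/-- The augmented inverse probability weighted score for the treatment value `z`, as a function of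
the full unit and of its uniform variable. -/
noncomputable def augScore (z : Bool) (m e π p : 𝒳 → ℝ) (w : FullUnit 𝒳 × ℝ) : ℝ :=
  trtInd z w.1 * ((outcome w.1 - m (cov w.1)) * ipw e π p (cov w.1) w.2) + m (cov w.1)

lemma score_annotate (m e π p : Bool → 𝒳 → ℝ) (z : Bool) (w : FullUnit 𝒳 × ℝ) :
    score m e π z (annotate p w.1 w.2) = augScore z (m z) (e z) (π z) (p z) w := by
  unfold score annotate augScore trtInd ipw annInd
  by_cases h1 : trt w.1 = z
  · subst h1
    by_cases h2 : w.2 ≤ p (trt w.1) (cov w.1)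
    · simp [h2, div_eq_mul_inv]
    · simp [h2]
  · simp [h1]

/-- With `m'` the true outcome model, the first term is a true residual times a weight error, which
has mean zero; all the bias sits in the second term. -/
lemma augScore_sub (z : Bool) (m e π p m' e' π' p' : 𝒳 → ℝ) (w : FullUnit 𝒳 × ℝ) :
    augScore z m e π p w - augScore z m' e' π' p' w =
      trtInd z w.1 * ((outcome w.1 - m' (cov w.1)) *
        (ipw e π p (cov w.1) w.2 - ipw e' π' p' (cov w.1) w.2)) +
      (m (cov w.1) - m' (cov w.1)) * (1 - trtInd z w.1 * ipw e π p (cov w.1) w.2) := by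
  unfold augScore; ring

lemma trtInd_nonneg (z : Bool) (u : FullUnit 𝒳) : 0 ≤ trtInd z u := by
  unfold trtInd; split_ifs <;> norm_num

lemma trtInd_le_one (z : Bool) (u : FullUnit 𝒳) : trtInd z u ≤ 1 := by
  unfold trtInd; split_ifs <;> norm_num

lemma trtInd_eq_indicator (z : Bool) (u : FullUnit 𝒳) (r : ℝ) :
    trtInd z u * r = (trt ⁻¹' {z}).indicator (fun _ => r) u := by
  by_cases h : trt u = z <;> simp [trtInd, h]

lemma annInd_nonneg (p : 𝒳 → ℝ) (x : 𝒳) (v : ℝ) : 0 ≤ annInd p x v := by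
  unfold annInd; split_ifs <;> norm_num

lemma annInd_le_one (p : 𝒳 → ℝ) (x : 𝒳) (v : ℝ) : annInd p x v ≤ 1 := by
  unfold annInd; split_ifs <;> norm_num

@[fun_prop]
lemma measurable_trtInd (z : Bool) : Measurable (trtInd z : FullUnit 𝒳 → ℝ) :=
  Measurable.ite (measurableSet_trt z) measurable_const measurable_const

lemma measurable_annInd {p : 𝒳 → ℝ} (hp : Measurable p) :
    Measurable fun q : 𝒳 × ℝ => annInd p q.1 q.2 :=
  Measurable.ite (measurableSet_le (by fun_prop) (by fun_prop)) measurable_const measurable_const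

lemma measurable_ipw {e π p : 𝒳 → ℝ} (he : Measurable e) (hπ : Measurable π) (hp : Measurable p) :
    Measurable fun q : 𝒳 × ℝ => ipw e π p q.1 q.2 :=
  (measurable_annInd hp).div (by fun_prop)

lemma measurable_augScore (z : Bool) {m e π p : 𝒳 → ℝ} (hm : Measurable m) (he : Measurable e)
    (hπ : Measurable π) (hp : Measurable p) : Measurable (augScore z m e π p) := by
  have h : Measurable fun w : FullUnit 𝒳 × ℝ => ipw e π p (cov w.1) w.2 :=
    (measurable_ipw he hπ hp).comp (f := fun w : FullUnit 𝒳 × ℝ => (cov w.1, w.2)) (by fun_prop)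
  unfold augScore
  fun_prop

lemma integral_annInd (p : 𝒳 → ℝ) (x : 𝒳) :
    ∫ v, annInd p x v ∂unifLaw = max 0 (min 1 (p x)) := by
  have : annInd p x = {v : ℝ | v ≤ p x}.indicator fun _ => (1 : ℝ) := by
    ext v; simp [annInd, Set.indicator]
  rw [this, integral_indicator_const _ (show MeasurableSet {v : ℝ | v ≤ p x} from measurableSet_Iic), ← unifLaw_real_Iic, smul_eq_mul, mul_one]

/-- Two annotations driven by the same uniform variable differ only when it falls between the two
thresholds. The bound is of first order in the difference, which is enough for consistency. -/
lemma lintegral_annInd_sub_sq_le (p p' : 𝒳 → ℝ) (x : 𝒳) :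
    ∫⁻ v, ENNReal.ofReal ((annInd p x v - annInd p' x v) ^ 2) ∂unifLaw ≤
      ENNReal.ofReal |p x - p' x| := by
  have h : ∀ v, ENNReal.ofReal ((annInd p x v - annInd p' x v) ^ 2) ≤
      (Set.uIoc (p' x) (p x)).indicator 1 v := fun v => by
    by_cases hv : v ∈ Set.uIoc (p' x) (p x)
    · rw [Set.indicator_of_mem hv]
      refine ENNReal.ofReal_le_one.2 ?_
      unfold annInd; split_ifs <;> norm_num
    · rw [Set.indicator_of_notMem hv, nonpos_iff_eq_zero, ENNReal.ofReal_eq_zero]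
      simp only [Set.mem_uIoc, not_or, not_and, not_le] at hv
      have : v ≤ p x ↔ v ≤ p' x := by
        constructor <;> intro hle <;> by_contra hc <;> push Not at hc
        · exact absurd (hv.1 hc) (not_lt.2 hle)
        · exact absurd (hv.2 hc) (not_lt.2 hle)
      simp [annInd, this]
  calc _ ≤ ∫⁻ v, (Set.uIoc (p' x) (p x)).indicator 1 v ∂unifLaw := lintegral_mono h
    _ = unifLaw (Set.uIoc (p' x) (p x)) := lintegral_indicator_one measurableSet_uIoc
    _ ≤ volume (Set.uIoc (p' x) (p x)) := Measure.restrict_le_self _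
    _ = _ := Real.volume_uIoc

variable (Q : Measure (FullUnit 𝒳)) [IsProbabilityMeasure Q]

/-- The joint law of a unit and of its uniform variable. -/
noncomputable abbrev unitLaw : Measure (FullUnit 𝒳 × ℝ) := Q.prod unifLaw

lemma measurePreserving_cov_unitLaw :
    MeasurePreserving (fun w : FullUnit 𝒳 × ℝ => cov w.1) (unitLaw Q) (covLaw Q) := by
  have h1 : MeasurePreserving (cov : FullUnit 𝒳 → 𝒳) Q (covLaw Q) := ⟨measurable_cov, rfl⟩
  exact h1.comp measurePreserving_fst

/-- Given X, the uniform variable is independent of the unit, so the second moment factors into that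
of the residual on the arm and that of `r`. -/
lemma lintegral_trtInd_residual_sq (z : Bool)
    (hσ : ∀ᵐ x ∂(covLaw Q), ∫⁻ y, ENNReal.ofReal ((y - outcomeMean Q z x) ^ 2)
      ∂(outcomeLaw Q z x) = ENNReal.ofReal (outcomeVar Q z x))
    {r : 𝒳 → ℝ → ℝ} (hr : Measurable fun q : 𝒳 × ℝ => r q.1 q.2) :
    ∫⁻ w, ENNReal.ofReal ((trtInd z w.1 * ((outcome w.1 - outcomeMean Q z (cov w.1)) *
        r (cov w.1) w.2)) ^ 2) ∂(unitLaw Q) =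
      ∫⁻ x, ENNReal.ofReal (propensity Q z x * outcomeVar Q z x) *
        ∫⁻ v, ENNReal.ofReal (r x v ^ 2) ∂unifLaw ∂(covLaw Q) := by
  have hrc : Measurable fun w : FullUnit 𝒳 × ℝ => r (cov w.1) w.2 :=
    hr.comp (f := fun w : FullUnit 𝒳 × ℝ => (cov w.1, w.2)) (by fun_prop)
  have hm : Measurable fun w : FullUnit 𝒳 × ℝ => ENNReal.ofReal ((trtInd z w.1 *
      ((outcome w.1 - outcomeMean Q z (cov w.1)) * r (cov w.1) w.2)) ^ 2) := by fun_prop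
  have hin : ∀ v, ∫⁻ u, ENNReal.ofReal ((trtInd z u * ((outcome u - outcomeMean Q z (cov u)) *
        r (cov u) v)) ^ 2) ∂Q =
      ∫⁻ x, ENNReal.ofReal (propensity Q z x * outcomeVar Q z x) * ENNReal.ofReal (r x v ^ 2)
        ∂(covLaw Q) := fun v => by
    have hrv : Measurable fun x => r x v := hr.comp (measurable_id.prodMk measurable_const)
    have hf : Measurable fun q : 𝒳 × ℝ =>
        ENNReal.ofReal ((q.2 - outcomeMean Q z q.1) ^ 2) * ENNReal.ofReal (r q.1 v ^ 2) := by
      fun_prop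
    have h1 := lintegral_trt Q z hf
    rw [← lintegral_indicator (measurableSet_trt z)] at h1
    calc _ = _ := lintegral_congr fun u => ?_
      _ = _ := h1
      _ = _ := lintegral_congr_ae ?_
    · rw [trtInd_eq_indicator]
      by_cases hu : u ∈ trt ⁻¹' {z}
      · simp only [Set.indicator_of_mem hu]
        rw [mul_pow, ENNReal.ofReal_mul (sq_nonneg _)]
      · simp [Set.indicator_of_notMem hu]
    · filter_upwards [hσ] with x hx
      rw [lintegral_mul_const _ (by fun_prop), hx, ENNReal.ofReal_mul (propensity_nonneg _ _ _),
        mul_assoc]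
  rw [lintegral_prod_symm' _ hm]
  simp_rw [hin]
  have hm2 : Measurable fun q : 𝒳 × ℝ =>
      ENNReal.ofReal (propensity Q z q.1 * outcomeVar Q z q.1) *
        ENNReal.ofReal (r q.1 q.2 ^ 2) := by fun_prop
  rw [← lintegral_lintegral_swap (f := fun x v =>
    ENNReal.ofReal (propensity Q z x * outcomeVar Q z x) * ENNReal.ofReal (r x v ^ 2))
    hm2.aemeasurable]
  refine lintegral_congr fun x => lintegral_const_mul _ ?_
  have : Measurable fun v => r x v := hr.comp measurable_prodMk_left
  fun_prop

/-- Freezing the uniform variable reduces this to the centering of the residual within an arm. -/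
lemma integral_trtInd_residual (z : Bool) {r : 𝒳 → ℝ → ℝ}
    (hr : Measurable fun q : 𝒳 × ℝ => r q.1 q.2) :
    ∫ w, trtInd z w.1 * ((outcome w.1 - outcomeMean Q z (cov w.1)) * r (cov w.1) w.2)
      ∂(unitLaw Q) = 0 := by
  by_cases hi : Integrable (fun w : FullUnit 𝒳 × ℝ =>
    trtInd z w.1 * ((outcome w.1 - outcomeMean Q z (cov w.1)) * r (cov w.1) w.2)) (unitLaw Q)
  swap
  · exact integral_undef hi
  rw [integral_prod_symm _ hi]
  refine integral_eq_zero_of_ae (ae_of_all _ fun v => ?_)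
  simp only [Pi.zero_apply]
  rw [← setIntegral_trt_sub_outcomeMean Q z (φ := fun x => r x v)
    (hr.comp (measurable_id.prodMk measurable_const)), ← integral_indicator (measurableSet_trt z)]
  refine integral_congr_ae (ae_of_all _ fun u => ?_)
  simp only
  rw [trtInd_eq_indicator]
  rfl

lemma integral_trtInd_mul (z : Bool) {h : 𝒳 → ℝ → ℝ}
    (hm : Measurable fun q : 𝒳 × ℝ => h q.1 q.2)
    (hi : Integrable (fun w : FullUnit 𝒳 × ℝ => trtInd z w.1 * h (cov w.1) w.2) (unitLaw Q)) :
    ∫ w, trtInd z w.1 * h (cov w.1) w.2 ∂(unitLaw Q) =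
      ∫ x, propensity Q z x * ∫ v, h x v ∂unifLaw ∂(covLaw Q) := by
  have hH : StronglyMeasurable fun x => ∫ v, h x v ∂unifLaw :=
    hm.stronglyMeasurable.integral_prod_right'
  rw [integral_prod _ hi]
  simp_rw [integral_const_mul, trtInd_eq_indicator]
  have h1 : ∀ u : FullUnit 𝒳, (trt ⁻¹' {z}).indicator (fun _ => ∫ v, h (cov u) v ∂unifLaw) u =
      (trt ⁻¹' {z}).indicator (fun u => ∫ v, h (cov u) v ∂unifLaw) u := fun u => rfl
  simp_rw [h1]
  rw [integral_indicator (measurableSet_trt z), ← integral_map measurable_cov.aemeasurable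
    hH.aestronglyMeasurable (f := fun x => ∫ v, h x v ∂unifLaw), map_cov_restrict_trt,
    integral_withDensity_eq_integral_toReal_smul (by fun_prop) (by simp)]
  simp [ENNReal.toReal_ofReal (propensity_nonneg Q z _)]

end UnitMoments

/-! ### Perturbation of the score by the nuisance estimates -/

section Perturbation

variable {𝒳 : Type*} [MeasurableSpace 𝒳] (Q : Measure (FullUnit 𝒳)) [IsProbabilityMeasure Q]

lemma l2Dist_sq (f g : 𝒳 → ℝ) :
    l2Dist Q f g ^ 2 = ∫⁻ x, ENNReal.ofReal ((f x - g x) ^ 2) ∂(covLaw Q) := by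
  have h := eLpNorm_nnreal_pow_eq_lintegral (f := fun x => f x - g x) (μ := covLaw Q) (p := 2)
    two_ne_zero
  simp only [NNReal.coe_ofNat, ENNReal.rpow_ofNat, ENNReal.coe_ofNat] at h
  rw [l2Dist, h]
  refine lintegral_congr fun x => ?_
  rw [Real.enorm_eq_ofReal_abs, ← ENNReal.ofReal_pow (abs_nonneg _), sq_abs]

lemma lintegral_abs_sub_le {f g : 𝒳 → ℝ} (hf : Measurable f) (hg : Measurable g) :
    ∫⁻ x, ENNReal.ofReal |f x - g x| ∂(covLaw Q) ≤ l2Dist Q f g := by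
  have h := eLpNorm_le_eLpNorm_of_exponent_le (p := 1) (q := 2) (μ := covLaw Q)
    (f := fun x => f x - g x) one_le_two (by fun_prop)
  rw [eLpNorm_one_eq_lintegral_enorm] at h
  rw [l2Dist]
  simpa only [Real.enorm_eq_ofReal_abs] using h

lemma lintegral_abs_mul_abs_le {f g f' g' : 𝒳 → ℝ} (hf : Measurable f) (hg : Measurable g)
    (hf' : Measurable f') (hg' : Measurable g') :
    ∫⁻ x, ENNReal.ofReal |f x - g x| * ENNReal.ofReal |f' x - g' x| ∂(covLaw Q) ≤
      l2Dist Q f g * l2Dist Q f' g' := by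
  have h := ENNReal.lintegral_mul_le_Lp_mul_Lq (covLaw Q) Real.HolderConjugate.two_two
    (f := fun x => ENNReal.ofReal |f x - g x|) (g := fun x => ENNReal.ofReal |f' x - g' x|)
    (by fun_prop) (by fun_prop)
  refine h.trans (le_of_eq ?_)
  have h2 : ∀ {f g : 𝒳 → ℝ},
      (∫⁻ x, ENNReal.ofReal |f x - g x| ^ (2 : ℝ) ∂(covLaw Q)) ^ (1 / (2 : ℝ)) = l2Dist Q f g := by
    intro f g
    rw [l2Dist, eLpNorm_eq_lintegral_rpow_enorm_toReal two_ne_zero ENNReal.ofNat_ne_top]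
    simp [Real.enorm_eq_ofReal_abs]
  rw [h2, h2]

variable {ε ν : ℝ}

lemma inv_mul_sub_inv_mul_abs_le (hε : 0 < ε) (hν : 0 < ν) {e π e' π' : ℝ} (he : 1 / ν ≤ e)
    (hπ : ε ≤ π) (he' : 1 / ν ≤ e') (hπ' : ε ≤ π') :
    |1 / (e * π) - 1 / (e' * π')| ≤ ν ^ 2 / ε * |e - e'| + ν / ε ^ 2 * |π - π'| := by
  have hν' : 0 < 1 / ν := by positivity
  have e0 : 0 < e := hν'.trans_le he
  have e0' : 0 < e' := hν'.trans_le he'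
  have p0 : 0 < π := hε.trans_le hπ
  have p0' : 0 < π' := hε.trans_le hπ'
  have ie : 1 / e ≤ ν := by rw [div_le_comm₀ e0 hν]; exact he
  have ie' : 1 / e' ≤ ν := by rw [div_le_comm₀ e0' hν]; exact he'
  have ip : 1 / π ≤ 1 / ε := one_div_le_one_div_of_le hε hπ
  have ip' : 1 / π' ≤ 1 / ε := one_div_le_one_div_of_le hε hπ'
  -- Telescoping: first `e` is exchanged for `e'`, then `π` for `π'`.
  have h : 1 / (e * π) - 1 / (e' * π') =
      (1 / e * (1 / e') * (1 / π)) * (e' - e) + (1 / e' * (1 / π) * (1 / π')) * (π' - π) := by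
    field_simp
    ring
  rw [h]
  refine (abs_add_le _ _).trans (add_le_add ?_ ?_)
  · rw [abs_mul, abs_of_pos (by positivity), abs_sub_comm]
    refine mul_le_mul_of_nonneg_right ?_ (abs_nonneg _)
    calc 1 / e * (1 / e') * (1 / π) ≤ ν * ν * (1 / ε) := by gcongr
      _ = ν ^ 2 / ε := by ring
  · rw [abs_mul, abs_of_pos (by positivity), abs_sub_comm]
    refine mul_le_mul_of_nonneg_right ?_ (abs_nonneg _)
    calc 1 / e' * (1 / π) * (1 / π') ≤ ν * (1 / ε) * (1 / ε) := by gcongr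
      _ = ν / ε ^ 2 := by ring

lemma inv_mul_nonneg_le (hε : 0 < ε) (hν : 0 < ν) {e π : ℝ} (he : 1 / ν ≤ e) (hπ : ε ≤ π) :
    0 ≤ 1 / (e * π) ∧ 1 / (e * π) ≤ ν / ε := by
  have hν' : 0 < 1 / ν := by positivity
  have e0 : 0 < e := hν'.trans_le he
  have p0 : 0 < π := hε.trans_le hπ
  refine ⟨by positivity, ?_⟩
  have ie : 1 / e ≤ ν := by rw [div_le_comm₀ e0 hν]; exact he
  have ip : 1 / π ≤ 1 / ε := one_div_le_one_div_of_le hε hπ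
  calc 1 / (e * π) = 1 / e * (1 / π) := by field_simp
    _ ≤ ν * (1 / ε) := by gcongr
    _ = ν / ε := by ring

lemma ipw_nonneg_le (hε : 0 < ε) (hν : 0 < ν) {e π : 𝒳 → ℝ} (p : 𝒳 → ℝ) {x : 𝒳}
    (he : 1 / ν ≤ e x) (hπ : ε ≤ π x) (v : ℝ) : 0 ≤ ipw e π p x v ∧ ipw e π p x v ≤ ν / ε := by
  obtain ⟨h0, h1⟩ := inv_mul_nonneg_le hε hν he hπ
  have : ipw e π p x v = annInd p x v * (1 / (e x * π x)) := by rw [ipw]; ring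
  rw [this]
  exact ⟨mul_nonneg (annInd_nonneg _ _ _) h0,
    (mul_le_of_le_one_left h0 (annInd_le_one _ _ _)).trans h1⟩

/-- The constant in the mean-square perturbation bound for the weights. -/
noncomputable def weightConst (ε ν : ℝ) : ℝ :=
  4 * (ν ^ 2 / ε) ^ 2 + 4 * (ν / ε ^ 2) ^ 2 + 2 * (ν / ε) ^ 2

lemma weightConst_nonneg (ε ν : ℝ) : 0 ≤ weightConst ε ν := by unfold weightConst; positivity

lemma lintegral_ipw_sub_sq_le (hε : 0 < ε) (hν : 0 < ν) {e π p e' π' p' : 𝒳 → ℝ} {x : 𝒳}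
    (he : 1 / ν ≤ e x) (hπ : ε ≤ π x) (he' : 1 / ν ≤ e' x) (hπ' : ε ≤ π' x) :
    ∫⁻ v, ENNReal.ofReal ((ipw e π p x v - ipw e' π' p' x v) ^ 2) ∂unifLaw ≤
      ENNReal.ofReal (weightConst ε ν) * (ENNReal.ofReal ((e x - e' x) ^ 2) +
        ENNReal.ofReal ((π x - π' x) ^ 2) + ENNReal.ofReal |p x - p' x|) := by
  have hab := inv_mul_sub_inv_mul_abs_le hε hν he hπ he' hπ'
  obtain ⟨hb0, hb1⟩ := inv_mul_nonneg_le hε hν he' hπ'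
  set a := 1 / (e x * π x)
  set b := 1 / (e' x * π' x)
  have hA1 : 0 ≤ 4 * (ν ^ 2 / ε) ^ 2 := by positivity
  have hA2 : 0 ≤ 4 * (ν / ε ^ 2) ^ 2 := by positivity
  have hA3 : 0 ≤ 2 * (ν / ε) ^ 2 := by positivity
  have hsq : (a - b) ^ 2 ≤ 2 * (ν ^ 2 / ε) ^ 2 * (e x - e' x) ^ 2 +
      2 * (ν / ε ^ 2) ^ 2 * (π x - π' x) ^ 2 := by
    rw [← sq_abs (a - b)]
    calc |a - b| ^ 2 ≤ (ν ^ 2 / ε * |e x - e' x| + ν / ε ^ 2 * |π x - π' x|) ^ 2 := by gcongr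
      _ ≤ 2 * (ν ^ 2 / ε * |e x - e' x|) ^ 2 + 2 * (ν / ε ^ 2 * |π x - π' x|) ^ 2 := by
        nlinarith [sq_nonneg (ν ^ 2 / ε * |e x - e' x| - ν / ε ^ 2 * |π x - π' x|)]
      _ = _ := by rw [mul_pow, mul_pow, sq_abs, sq_abs]; ring
  set T := (e x - e' x) ^ 2 + (π x - π' x) ^ 2 with hT
  have hT0 : 0 ≤ T := by positivity
  have hpt : ∀ v, ENNReal.ofReal ((ipw e π p x v - ipw e' π' p' x v) ^ 2) ≤
      ENNReal.ofReal (weightConst ε ν) * ENNReal.ofReal T + ENNReal.ofReal (weightConst ε ν) *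
        ENNReal.ofReal ((annInd p x v - annInd p' x v) ^ 2) := fun v => by
    rw [← ENNReal.ofReal_mul (weightConst_nonneg _ _), ← ENNReal.ofReal_mul (weightConst_nonneg _ _),
      ← ENNReal.ofReal_add (mul_nonneg (weightConst_nonneg _ _) hT0)
        (mul_nonneg (weightConst_nonneg _ _) (sq_nonneg _))]
    refine ENNReal.ofReal_le_ofReal ?_
    -- The error of the inverse probability is separated from the error of the annotation indicator.
    have h1 : ipw e π p x v - ipw e' π' p' x v =
        annInd p x v * (a - b) + (annInd p x v - annInd p' x v) * b := by
      simp only [ipw, a, b]; ring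
    have hR0 := annInd_nonneg p x v
    have hR1 := annInd_le_one p x v
    set R := annInd p x v
    set S := annInd p x v - annInd p' x v
    have h2 : R ^ 2 ≤ 1 := pow_le_one₀ hR0 hR1
    have h3 : b ^ 2 ≤ (ν / ε) ^ 2 := by gcongr
    rw [h1]
    calc (R * (a - b) + S * b) ^ 2 ≤ 2 * (R ^ 2 * (a - b) ^ 2) + 2 * (S ^ 2 * b ^ 2) := by
          nlinarith [sq_nonneg (R * (a - b) - S * b)]
      _ ≤ 2 * (1 * (2 * (ν ^ 2 / ε) ^ 2 * (e x - e' x) ^ 2 +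
            2 * (ν / ε ^ 2) ^ 2 * (π x - π' x) ^ 2)) + 2 * (S ^ 2 * (ν / ε) ^ 2) := by
          gcongr
      _ = 4 * (ν ^ 2 / ε) ^ 2 * (e x - e' x) ^ 2 + 4 * (ν / ε ^ 2) ^ 2 * (π x - π' x) ^ 2 +
            2 * (ν / ε) ^ 2 * S ^ 2 := by ring
      _ ≤ weightConst ε ν * (e x - e' x) ^ 2 + weightConst ε ν * (π x - π' x) ^ 2 +
            weightConst ε ν * S ^ 2 := by
          unfold weightConst
          gcongr <;> linarith
      _ = _ := by rw [hT]; ring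
  refine (lintegral_mono hpt).trans ?_
  have hmeas : Measurable fun v => annInd p x v - annInd p' x v :=
    (Measurable.ite measurableSet_Iic measurable_const measurable_const).sub
      (Measurable.ite measurableSet_Iic measurable_const measurable_const)
  rw [lintegral_add_left measurable_const, lintegral_const, measure_univ, mul_one,
    lintegral_const_mul _ (by fun_prop), mul_add]
  refine add_le_add ?_ (mul_le_mul_right (lintegral_annInd_sub_sq_le p p' x) _)
  rw [hT, ENNReal.ofReal_add (sq_nonneg _) (sq_nonneg _)]

variable {z : Bool} {M : ℝ}
  (hσ : ∀ᵐ x ∂(covLaw Q), ∫⁻ y, ENNReal.ofReal ((y - outcomeMean Q z x) ^ 2)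
      ∂(outcomeLaw Q z x) = ENNReal.ofReal (outcomeVar Q z x))
  (hM : ∀ᵐ x ∂(covLaw Q), outcomeVar Q z x ≤ M)

include hM in
lemma ae_propensity_mul_outcomeVar_le :
    ∀ᵐ x ∂(covLaw Q), propensity Q z x * outcomeVar Q z x ≤ M := by
  filter_upwards [hM] with x hx
  exact (mul_le_of_le_one_left (outcomeVar_nonneg _ _ _) (propensity_le_one _ _ _)).trans hx

include hσ hM in
lemma memLp_trtInd_residual {r : 𝒳 → ℝ → ℝ} (hr : Measurable fun q : 𝒳 × ℝ => r q.1 q.2) {c : ℝ}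
    (hc : ∀ᵐ x ∂(covLaw Q), ∀ v, |r x v| ≤ c) :
    MemLp (fun w : FullUnit 𝒳 × ℝ => trtInd z w.1 * ((outcome w.1 - outcomeMean Q z (cov w.1)) *
        r (cov w.1) w.2)) 2 (unitLaw Q) := by
  have hrc : Measurable fun w : FullUnit 𝒳 × ℝ => r (cov w.1) w.2 :=
    hr.comp (f := fun w : FullUnit 𝒳 × ℝ => (cov w.1, w.2)) (by fun_prop)
  refine (memLp_two_iff_integrable_sq (by fun_prop)).2 ⟨by fun_prop, ?_⟩
  rw [hasFiniteIntegral_iff_ofReal (ae_of_all _ fun _ => sq_nonneg _),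
    lintegral_trtInd_residual_sq Q z hσ hr]
  have : ∫⁻ x, ENNReal.ofReal (propensity Q z x * outcomeVar Q z x) *
        ∫⁻ v, ENNReal.ofReal (r x v ^ 2) ∂unifLaw ∂(covLaw Q) ≤
      ∫⁻ x, ENNReal.ofReal M * ENNReal.ofReal (c ^ 2) ∂(covLaw Q) := by
    refine lintegral_mono_ae ?_
    filter_upwards [hc, ae_propensity_mul_outcomeVar_le Q hM] with x hx h2
    refine mul_le_mul' (ENNReal.ofReal_le_ofReal h2) ?_
    calc _ ≤ ∫⁻ _, ENNReal.ofReal (c ^ 2) ∂unifLaw := lintegral_mono fun v =>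
          ENNReal.ofReal_le_ofReal (sq_le_sq' (abs_le.1 (hx v)).1 (abs_le.1 (hx v)).2)
      _ = _ := by simp
  refine this.trans_lt ?_
  rw [lintegral_const, measure_univ, mul_one]
  exact ENNReal.mul_lt_top ENNReal.ofReal_lt_top ENNReal.ofReal_lt_top

variable {m e π p π' p' : 𝒳 → ℝ} (hm : Measurable m) (he : Measurable e) (hπ : Measurable π)
  (hp : Measurable p) (hπ' : Measurable π') (hp' : Measurable p')
  (hε : 0 < ε) (hν : 0 < ν)
  (hpos : ∀ᵐ x ∂(covLaw Q), 1 / ν ≤ e x ∧ ε ≤ π x)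
  (hpos' : ∀ᵐ x ∂(covLaw Q), 1 / ν ≤ propensity Q z x ∧ ε ≤ π' x)

include hσ hM hm he hπ hp hπ' hp' hε hν hpos hpos' in
-- Bounded conditional variance turns weight errors into the first group of terms; bounded weights
-- turn the error of the outcome model into the last one. Consistency alone, without rates, makes
-- the bound vanish.
lemma lintegral_augScore_sub_sq_le :
    ∫⁻ w, ENNReal.ofReal ((augScore z m e π p w -
        augScore z (outcomeMean Q z) (propensity Q z) π' p' w) ^ 2) ∂(unitLaw Q) ≤
      ENNReal.ofReal (2 * M * weightConst ε ν) * (l2Dist Q e (propensity Q z) ^ 2 +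
        l2Dist Q π π' ^ 2 + l2Dist Q p p') +
      ENNReal.ofReal (2 * (1 + ν / ε) ^ 2) * l2Dist Q m (outcomeMean Q z) ^ 2 := by
  have hrm : Measurable fun q : 𝒳 × ℝ =>
      ipw e π p q.1 q.2 - ipw (propensity Q z) π' p' q.1 q.2 :=
    (measurable_ipw he hπ hp).sub (measurable_ipw (by fun_prop) hπ' hp')
  have hrc : Measurable fun w : FullUnit 𝒳 × ℝ =>
      ipw e π p (cov w.1) w.2 - ipw (propensity Q z) π' p' (cov w.1) w.2 :=
    hrm.comp (f := fun w : FullUnit 𝒳 × ℝ => (cov w.1, w.2)) (by fun_prop)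
  have hpt : ∀ᵐ w ∂(unitLaw Q), ENNReal.ofReal ((augScore z m e π p w -
        augScore z (outcomeMean Q z) (propensity Q z) π' p' w) ^ 2) ≤
      2 * ENNReal.ofReal ((trtInd z w.1 * ((outcome w.1 - outcomeMean Q z (cov w.1)) *
        (ipw e π p (cov w.1) w.2 - ipw (propensity Q z) π' p' (cov w.1) w.2))) ^ 2) +
      ENNReal.ofReal (2 * (1 + ν / ε) ^ 2) *
        ENNReal.ofReal ((m (cov w.1) - outcomeMean Q z (cov w.1)) ^ 2) := by
    filter_upwards [(measurePreserving_cov_unitLaw Q).quasiMeasurePreserving.ae hpos] with w hw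
    rw [augScore_sub]
    obtain ⟨h0, h1⟩ := ipw_nonneg_le hε hν p hw.1 hw.2 w.2
    have hI0 := trtInd_nonneg z w.1
    have hI1 := trtInd_le_one z w.1
    set I := trtInd z w.1
    set q := ipw e π p (cov w.1) w.2
    set a := I * ((outcome w.1 - outcomeMean Q z (cov w.1)) *
      (q - ipw (propensity Q z) π' p' (cov w.1) w.2))
    set g := m (cov w.1) - outcomeMean Q z (cov w.1)
    have hq : (1 - I * q) ^ 2 ≤ (1 + ν / ε) ^ 2 := by
      have h3 : 0 ≤ I * q := mul_nonneg hI0 h0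
      have h4 : I * q ≤ ν / ε := (mul_le_of_le_one_left h0 hI1).trans h1
      exact sq_le_sq' (by linarith) (by linarith)
    rw [← ENNReal.ofReal_ofNat 2, ← ENNReal.ofReal_mul (by norm_num),
      ← ENNReal.ofReal_mul (by positivity), ← ENNReal.ofReal_add (by positivity) (by positivity)]
    refine ENNReal.ofReal_le_ofReal ?_
    calc (a + g * (1 - I * q)) ^ 2 ≤ 2 * a ^ 2 + 2 * (g ^ 2 * (1 - I * q) ^ 2) := by
          nlinarith [sq_nonneg (a - g * (1 - I * q))]
      _ ≤ 2 * a ^ 2 + 2 * (g ^ 2 * (1 + ν / ε) ^ 2) := by gcongr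
      _ = _ := by ring
  refine (lintegral_mono_ae hpt).trans ?_
  rw [lintegral_add_right _ (by fun_prop), lintegral_const_mul _ (by fun_prop),
    lintegral_const_mul _ (by fun_prop)]
  refine add_le_add ?_ (le_of_eq ?_)
  · rw [lintegral_trtInd_residual_sq Q z hσ
      (r := fun x v => ipw e π p x v - ipw (propensity Q z) π' p' x v) hrm]
    have h3 : ∫⁻ x, ENNReal.ofReal (propensity Q z x * outcomeVar Q z x) *
        ∫⁻ v, ENNReal.ofReal ((ipw e π p x v - ipw (propensity Q z) π' p' x v) ^ 2) ∂unifLaw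
          ∂(covLaw Q) ≤ ∫⁻ x, ENNReal.ofReal (M * weightConst ε ν) *
        (ENNReal.ofReal ((e x - propensity Q z x) ^ 2) +
        ENNReal.ofReal ((π x - π' x) ^ 2) + ENNReal.ofReal |p x - p' x|) ∂(covLaw Q) := by
      refine lintegral_mono_ae ?_
      filter_upwards [hpos, hpos', ae_propensity_mul_outcomeVar_le Q hM] with x h1 h2 h3
      rw [ENNReal.ofReal_mul' (weightConst_nonneg _ _), mul_assoc]
      exact mul_le_mul' (ENNReal.ofReal_le_ofReal h3)
        (lintegral_ipw_sub_sq_le hε hν h1.1 h1.2 h2.1 h2.2)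
    rw [mul_assoc 2 M, ENNReal.ofReal_mul two_pos.le, ENNReal.ofReal_ofNat, mul_assoc]
    refine mul_le_mul_right (h3.trans ?_) _
    rw [lintegral_const_mul _ (by fun_prop), lintegral_add_right _ (by fun_prop),
      lintegral_add_right _ (by fun_prop), l2Dist_sq, l2Dist_sq]
    gcongr
    exact lintegral_abs_sub_le Q hp hp'
  · rw [l2Dist_sq, (measurePreserving_cov_unitLaw Q).lintegral_comp
      (f := fun x => ENNReal.ofReal ((m x - outcomeMean Q z x) ^ 2)) (by fun_prop)]

variable (hfin : l2Dist Q m (outcomeMean Q z) < ∞)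

include hm he hπ hp hfin hε hν hpos in
lemma integrable_meanDiff_mul :
    Integrable (fun w : FullUnit 𝒳 × ℝ => (m (cov w.1) - outcomeMean Q z (cov w.1)) *
      (trtInd z w.1 * ipw e π p (cov w.1) w.2)) (unitLaw Q) ∧
    Integrable (fun x => m x - outcomeMean Q z x) (covLaw Q) := by
  have hL : MemLp (fun x => m x - outcomeMean Q z x) 2 (covLaw Q) := ⟨by fun_prop, hfin⟩
  have hi := hL.integrable one_le_two
  refine ⟨?_, hi⟩
  have hqc : Measurable fun w : FullUnit 𝒳 × ℝ => ipw e π p (cov w.1) w.2 :=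
    (measurable_ipw he hπ hp).comp (f := fun w : FullUnit 𝒳 × ℝ => (cov w.1, w.2)) (by fun_prop)
  refine ((measurePreserving_cov_unitLaw Q).integrable_comp_of_integrable hi).mul_bdd (c := ν / ε)
    (by fun_prop) ?_
  filter_upwards [(measurePreserving_cov_unitLaw Q).quasiMeasurePreserving.ae hpos] with w hw
  obtain ⟨h0, h1⟩ := ipw_nonneg_le hε hν p hw.1 hw.2 w.2
  rw [Real.norm_of_nonneg (mul_nonneg (trtInd_nonneg _ _) h0)]
  exact (mul_le_of_le_one_left h0 (trtInd_le_one _ _)).trans h1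

include hσ hM hm he hπ hp hπ' hp' hε hν hpos hpos' hfin in
-- The residual term integrates to zero, so the oracle probabilities disappear. What is left
-- vanishes both when the outcome model is right and when the weights are.
lemma integral_augScore_sub :
    ∫ w, (augScore z m e π p w - augScore z (outcomeMean Q z) (propensity Q z) π' p' w)
      ∂(unitLaw Q) =
    ∫ x, (m x - outcomeMean Q z x) *
      (1 - propensity Q z x * (max 0 (min 1 (p x)) / (e x * π x))) ∂(covLaw Q) := by
  have hrm : Measurable fun q : 𝒳 × ℝ =>
      ipw e π p q.1 q.2 - ipw (propensity Q z) π' p' q.1 q.2 :=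
    (measurable_ipw he hπ hp).sub (measurable_ipw (by fun_prop) hπ' hp')
  have hbd : ∀ᵐ x ∂(covLaw Q), ∀ v,
      |ipw e π p x v - ipw (propensity Q z) π' p' x v| ≤ ν / ε := by
    filter_upwards [hpos, hpos'] with x h1 h2 v
    obtain ⟨a0, a1⟩ := ipw_nonneg_le hε hν p h1.1 h1.2 v
    obtain ⟨b0, b1⟩ := ipw_nonneg_le (e := propensity Q z) hε hν p' h2.1 h2.2 v
    exact abs_le.2 ⟨by linarith, by linarith⟩
  have hi1 := (memLp_trtInd_residual Q hσ hM (r := fun x v =>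
    ipw e π p x v - ipw (propensity Q z) π' p' x v) hrm hbd).integrable one_le_two
  obtain ⟨hi2, hi3⟩ := integrable_meanDiff_mul Q hm he hπ hp hε hν hpos hfin
  have hi4 : Integrable (fun w : FullUnit 𝒳 × ℝ => m (cov w.1) - outcomeMean Q z (cov w.1))
      (unitLaw Q) := (measurePreserving_cov_unitLaw Q).integrable_comp_of_integrable hi3
  have h0 := integral_trtInd_residual Q z (r := fun x v =>
    ipw e π p x v - ipw (propensity Q z) π' p' x v) hrm
  have hcong : ∀ w : FullUnit 𝒳 × ℝ, augScore z m e π p w -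
      augScore z (outcomeMean Q z) (propensity Q z) π' p' w =
      trtInd z w.1 * ((outcome w.1 - outcomeMean Q z (cov w.1)) *
        (ipw e π p (cov w.1) w.2 - ipw (propensity Q z) π' p' (cov w.1) w.2)) +
      (((m (cov w.1) - outcomeMean Q z (cov w.1)) - (m (cov w.1) - outcomeMean Q z (cov w.1)) *
        (trtInd z w.1 * ipw e π p (cov w.1) w.2))) := fun w => by rw [augScore_sub]; ring
  simp_rw [hcong]
  rw [integral_add hi1 (hi4.sub' hi2), h0, zero_add, integral_sub hi4 hi2]
  have h5 : ∀ w : FullUnit 𝒳 × ℝ, (m (cov w.1) - outcomeMean Q z (cov w.1)) *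
      (trtInd z w.1 * ipw e π p (cov w.1) w.2) =
      trtInd z w.1 * ((m (cov w.1) - outcomeMean Q z (cov w.1)) * ipw e π p (cov w.1) w.2) :=
    fun w => by ring
  simp_rw [h5] at hi2 ⊢
  have hhm : Measurable fun q : 𝒳 × ℝ => (m q.1 - outcomeMean Q z q.1) * ipw e π p q.1 q.2 :=
    Measurable.mul (by fun_prop) (measurable_ipw he hπ hp)
  have h6 : ∫ w : FullUnit 𝒳 × ℝ, (m (cov w.1) - outcomeMean Q z (cov w.1)) ∂(unitLaw Q) =
      ∫ x, (m x - outcomeMean Q z x) ∂(covLaw Q) := by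
    rw [← (measurePreserving_cov_unitLaw Q).map_eq, integral_map (by fun_prop) (by fun_prop)]
  have h7 : ∀ x, ∫ v, (m x - outcomeMean Q z x) * ipw e π p x v ∂unifLaw =
      (m x - outcomeMean Q z x) * (max 0 (min 1 (p x)) / (e x * π x)) := fun x => by
    simp_rw [ipw]
    rw [integral_const_mul, integral_div, integral_annInd]
  have h8 : Integrable (fun x => propensity Q z x *
      ((m x - outcomeMean Q z x) * (max 0 (min 1 (p x)) / (e x * π x)))) (covLaw Q) := by
    have : (fun x => propensity Q z x *
        ((m x - outcomeMean Q z x) * (max 0 (min 1 (p x)) / (e x * π x)))) = fun x =>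
        (m x - outcomeMean Q z x) *
          (propensity Q z x * (max 0 (min 1 (p x)) / (e x * π x))) := by
      ext x; ring
    rw [this]
    refine hi3.mul_bdd (c := ν / ε) (by fun_prop) ?_
    filter_upwards [hpos] with x hx
    obtain ⟨a0, a1⟩ := inv_mul_nonneg_le hε hν hx.1 hx.2
    have hc0 : 0 ≤ max 0 (min 1 (p x)) := le_max_left _ _
    have hc1 : max 0 (min 1 (p x)) ≤ 1 := max_le zero_le_one (min_le_left _ _)
    rw [div_eq_mul_one_div, Real.norm_of_nonneg
      (mul_nonneg (propensity_nonneg _ _ _) (mul_nonneg hc0 a0))]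
    exact (mul_le_of_le_one_left (mul_nonneg hc0 a0) (propensity_le_one _ _ _)).trans
      ((mul_le_of_le_one_left a0 hc1).trans a1)
  rw [integral_trtInd_mul Q z (h := fun x v => (m x - outcomeMean Q z x) * ipw e π p x v) hhm hi2, h6]
  simp_rw [h7]
  rw [← integral_sub hi3 h8]
  refine integral_congr_ae (ae_of_all _ fun x => ?_)
  simp only
  ring

end Perturbation

/-! ### Bias of the score within one batch and over the mixture of batches. -/

section MeanPerturbation

variable {𝒳 : Type*} [MeasurableSpace 𝒳] (Q : Measure (FullUnit 𝒳)) [IsProbabilityMeasure Q]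
  {ε ν : ℝ} {z : Bool} {M : ℝ}

/-- Truncation to [0, 1] brings a number no farther from a point of [0, 1], so invalid estimated
probabilities do no harm. -/
lemma abs_max_min_sub_le {a b : ℝ} (hb0 : 0 ≤ b) (hb1 : b ≤ 1) :
    |max 0 (min 1 a) - b| ≤ |a - b| := by
  rcases le_total a 0 with h | h
  · rw [min_eq_right (h.trans zero_le_one), max_eq_left h, zero_sub, abs_neg, abs_of_nonneg hb0,
      abs_of_nonpos (by linarith)]
    linarith
  · rcases le_total a 1 with h1 | h1
    · rw [min_eq_right h1, max_eq_right h]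
    · rw [min_eq_left h1, max_eq_right zero_le_one, abs_of_nonneg (by linarith),
        abs_of_nonneg (by linarith)]
      linarith

lemma abs_one_sub_weight_ratio_le (hε : 0 < ε) (hν : 0 < ν) {e π e' π' P : ℝ} (he : 1 / ν ≤ e)
    (hπ : ε ≤ π) (he' : 0 ≤ e') (he1' : e' ≤ 1) (hπ' : 0 ≤ π') (hπ1' : π' ≤ 1) :
    |1 - e' * (P / (e * π))| ≤ (1 / ε + ν / ε) * (|π - π'| + |e - e'| + |P - π'|) := by
  obtain ⟨a0, a1⟩ := inv_mul_nonneg_le hε hν he hπ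
  have e0 : 0 < e := lt_of_lt_of_le (by positivity) he
  have p0 : 0 < π := hε.trans_le hπ
  have ip : 1 / π ≤ 1 / ε := one_div_le_one_div_of_le hε hπ
  -- The ratio equals one when `e = e'` and `P = π = π'`; each term carries one of the three
  -- deviations from this.
  have h : 1 - e' * (P / (e * π)) =
      (1 / π) * (π - π') + (1 / (e * π)) * (π' * (e - e')) - (1 / (e * π)) * (e' * (P - π')) := by
    field_simp
    ring
  have hc1 : 0 ≤ 1 / ε := by positivity
  have hc2 : 0 ≤ ν / ε := by positivity
  have t1 : |(1 / π) * (π - π')| ≤ 1 / ε * |π - π'| := by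
    rw [abs_mul, abs_of_pos (by positivity)]
    gcongr
  have t2 : |(1 / (e * π)) * (π' * (e - e'))| ≤ ν / ε * |e - e'| := by
    rw [abs_mul, abs_mul, abs_of_nonneg a0, abs_of_nonneg hπ']
    exact mul_le_mul a1 (mul_le_of_le_one_left (abs_nonneg _) hπ1') (by positivity) hc2
  have t3 : |(1 / (e * π)) * (e' * (P - π'))| ≤ ν / ε * |P - π'| := by
    rw [abs_mul, abs_mul, abs_of_nonneg a0, abs_of_nonneg he']
    exact mul_le_mul a1 (mul_le_of_le_one_left (abs_nonneg _) he1') (by positivity) hc2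
  rw [h]
  calc _ ≤ 1 / ε * |π - π'| + ν / ε * |e - e'| + ν / ε * |P - π'| :=
        (abs_sub _ _).trans (add_le_add ((abs_add_le _ _).trans (add_le_add t1 t2)) t3)
    _ ≤ _ := by
        nlinarith [mul_nonneg hc1 (abs_nonneg (e - e')), mul_nonneg hc1 (abs_nonneg (P - π')),
          mul_nonneg hc2 (abs_nonneg (π - π'))]

variable (hσ : ∀ᵐ x ∂(covLaw Q), ∫⁻ y, ENNReal.ofReal ((y - outcomeMean Q z x) ^ 2)
      ∂(outcomeLaw Q z x) = ENNReal.ofReal (outcomeVar Q z x))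
  (hM : ∀ᵐ x ∂(covLaw Q), outcomeVar Q z x ≤ M)
  {m e π p π' p' : 𝒳 → ℝ} (hm : Measurable m) (he : Measurable e) (hπ : Measurable π)
  (hp : Measurable p) (hπ' : Measurable π') (hp' : Measurable p')
  (hε : 0 < ε) (hν : 0 < ν)
  (hpos : ∀ᵐ x ∂(covLaw Q), 1 / ν ≤ e x ∧ ε ≤ π x)
  (hpos' : ∀ᵐ x ∂(covLaw Q), 1 / ν ≤ propensity Q z x ∧ ε ≤ π' x)
  (hfin : l2Dist Q m (outcomeMean Q z) < ∞)

include hm he hπ hp hε hν hpos hfin in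
lemma integrable_meanDiff_mul_one_sub :
    Integrable (fun x => (m x - outcomeMean Q z x) *
      (1 - propensity Q z x * (max 0 (min 1 (p x)) / (e x * π x)))) (covLaw Q) := by
  have hL : MemLp (fun x => m x - outcomeMean Q z x) 2 (covLaw Q) := ⟨by fun_prop, hfin⟩
  refine (hL.integrable one_le_two).mul_bdd (c := 1 + ν / ε) (by fun_prop) ?_
  filter_upwards [hpos] with x hx
  obtain ⟨a0, a1⟩ := inv_mul_nonneg_le hε hν hx.1 hx.2
  have hc0 : 0 ≤ max 0 (min 1 (p x)) := le_max_left _ _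
  have hc1 : max 0 (min 1 (p x)) ≤ 1 := max_le zero_le_one (min_le_left _ _)
  rw [div_eq_mul_one_div]
  have h2 := mul_nonneg (propensity_nonneg Q z x) (mul_nonneg hc0 a0)
  have h3 := (mul_le_of_le_one_left (mul_nonneg hc0 a0) (propensity_le_one Q z x)).trans
      ((mul_le_of_le_one_left a0 hc1).trans a1)
  exact abs_le.2 ⟨by linarith, by linarith⟩

include hσ hM hm he hπ hp hπ' hp' hε hν hpos hpos' hfin in
-- A crude one-batch bound, of first order in the outcome model only. It suffices for the part of a
-- cell size that deviates from proportionality.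
lemma enorm_integral_augScore_sub_le :
    ‖∫ w, (augScore z m e π p w - augScore z (outcomeMean Q z) (propensity Q z) π' p' w)
      ∂(unitLaw Q)‖ₑ ≤ ENNReal.ofReal (1 + ν / ε) * l2Dist Q m (outcomeMean Q z) := by
  rw [integral_augScore_sub Q hσ hM hm he hπ hp hπ' hp' hε hν hpos hpos' hfin]
  refine (enorm_integral_le_lintegral_enorm _).trans ?_
  calc _ ≤ ∫⁻ x, ENNReal.ofReal (1 + ν / ε) * ENNReal.ofReal |m x - outcomeMean Q z x|
        ∂(covLaw Q) := by
        refine lintegral_mono_ae ?_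
        filter_upwards [hpos] with x hx
        obtain ⟨a0, a1⟩ := inv_mul_nonneg_le hε hν hx.1 hx.2
        have hc0 : 0 ≤ max 0 (min 1 (p x)) := le_max_left _ _
        have hc1 : max 0 (min 1 (p x)) ≤ 1 := max_le zero_le_one (min_le_left _ _)
        have h2 := mul_nonneg (propensity_nonneg Q z x) (mul_nonneg hc0 a0)
        have h3 := (mul_le_of_le_one_left (mul_nonneg hc0 a0) (propensity_le_one Q z x)).trans
          ((mul_le_of_le_one_left a0 hc1).trans a1)
        rw [enorm_mul, mul_comm, Real.enorm_eq_ofReal_abs, Real.enorm_eq_ofReal_abs,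
          div_eq_mul_one_div]
        gcongr
        exact abs_le.2 ⟨by linarith, by linarith⟩
    _ ≤ _ := by
        rw [lintegral_const_mul _ (by fun_prop)]
        exact mul_le_mul_right (lintegral_abs_sub_le Q hm (by fun_prop)) _

/-- The biases of the two batches compensate up to products of estimation errors: the mixture of
the annotation probabilities of the two batches is close to the target. -/
lemma enorm_mixture_bias_le (hσ : ∀ᵐ x ∂(covLaw Q),
      ∫⁻ y, ENNReal.ofReal ((y - outcomeMean Q z x) ^ 2)
      ∂(outcomeLaw Q z x) = ENNReal.ofReal (outcomeVar Q z x))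
    (hM : ∀ᵐ x ∂(covLaw Q), outcomeVar Q z x ≤ M)
    {m e π p π' : 𝒳 → ℝ} (hm : Measurable m) (he : Measurable e) (hπ : Measurable π)
    (hp : Measurable p) (hπ' : Measurable π') (hε : 0 < ε) (hν : 0 < ν)
    (hpos : ∀ᵐ x ∂(covLaw Q), 1 / ν ≤ e x ∧ ε ≤ π x)
    (hpos' : ∀ᵐ x ∂(covLaw Q), 1 / ν ≤ propensity Q z x ∧ ε ≤ π' x)
    (hfin : l2Dist Q m (outcomeMean Q z) < ∞)
    (hle : ∀ᵐ x ∂(covLaw Q), π' x ≤ 1) {κ π₁ : ℝ} (hκ1 : κ < 1)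
    (hπ₁0 : 0 ≤ π₁) (hπ₁1 : π₁ ≤ 1)
    (hfeas : ∀ᵐ x ∂(covLaw Q), κ * π₁ ≤ π' x ∧ π' x ≤ κ * π₁ + (1 - κ)) :
    ‖κ * ∫ w, (augScore z m e π (fun _ => π₁) w -
          augScore z (outcomeMean Q z) (propensity Q z) π' (fun _ => π₁) w) ∂(unitLaw Q) +
      (1 - κ) * ∫ w, (augScore z m e π (fun x => 1 / (1 - κ) * (p x - κ * π₁)) w -
          augScore z (outcomeMean Q z) (propensity Q z) π'
            (fun x => 1 / (1 - κ) * (π' x - κ * π₁)) w) ∂(unitLaw Q)‖ₑ ≤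
      ENNReal.ofReal (1 / ε + ν / ε) * (l2Dist Q m (outcomeMean Q z) *
        (l2Dist Q π π' + l2Dist Q e (propensity Q z) + l2Dist Q p π')) := by
  have hκ : 0 < 1 - κ := by linarith
  set p₂ : 𝒳 → ℝ := fun x => 1 / (1 - κ) * (p x - κ * π₁) with hp₂
  have hp₂m : Measurable p₂ := by fun_prop
  have hi1 := integrable_meanDiff_mul_one_sub Q hm he hπ (p := fun _ => π₁) measurable_const
    hε hν hpos hfin
  have hi2 := integrable_meanDiff_mul_one_sub Q hm he hπ hp₂m hε hν hpos hfin
  rw [integral_augScore_sub Q hσ hM hm he hπ measurable_const hπ' measurable_const hε hν hpos hpos'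
    hfin, integral_augScore_sub Q hσ hM hm he hπ hp₂m hπ' (by fun_prop) hε hν hpos hpos' hfin,
    ← integral_const_mul, ← integral_const_mul, ← integral_add (hi1.const_mul _) (hi2.const_mul _)]
  refine (enorm_integral_le_lintegral_enorm _).trans ?_
  calc _ ≤ ∫⁻ x, ENNReal.ofReal (1 / ε + ν / ε) *
        (ENNReal.ofReal |m x - outcomeMean Q z x| * ENNReal.ofReal |π x - π' x| +
          ENNReal.ofReal |m x - outcomeMean Q z x| * ENNReal.ofReal |e x - propensity Q z x| +
          ENNReal.ofReal |m x - outcomeMean Q z x| * ENNReal.ofReal |p x - π' x|)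
        ∂(covLaw Q) := by
        refine lintegral_mono_ae ?_
        filter_upwards [hpos, hpos', hle, hfeas] with x h1 h2 h3 h4
        -- The effective annotation probability of the mixture of the two batches.
        set P := κ * π₁ + (1 - κ) * max 0 (min 1 (p₂ x)) with hP
        have hPd : |P - π' x| ≤ |p x - π' x| := by
          -- Feasibility puts the oracle second-batch probability in [0, 1], as the truncation bound
          -- requires.
          have hb0 : 0 ≤ 1 / (1 - κ) * (π' x - κ * π₁) := mul_nonneg (by positivity) (by linarith)
          have hb1 : 1 / (1 - κ) * (π' x - κ * π₁) ≤ 1 := by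
            rw [one_div, inv_mul_le_iff₀ hκ]; linarith
          have h5 := abs_max_min_sub_le (a := p₂ x) hb0 hb1
          have h6 : P - π' x =
              (1 - κ) * (max 0 (min 1 (p₂ x)) - 1 / (1 - κ) * (π' x - κ * π₁)) := by
            rw [hP]; field_simp; ring
          have h7 : p x - π' x = (1 - κ) * (p₂ x - 1 / (1 - κ) * (π' x - κ * π₁)) := by
            rw [hp₂]; field_simp; ring
          rw [h6, h7, abs_mul, abs_mul]
          gcongr
        have h8 := abs_one_sub_weight_ratio_le hε hν (P := P) h1.1 h1.2
          (propensity_nonneg Q z x) (propensity_le_one Q z x) (hε.le.trans h2.2) h3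
        -- The bias integrand is affine in the annotation probability, so the two batches merge into
        -- one with probability `P`.
        have h9 : κ * ((m x - outcomeMean Q z x) *
              (1 - propensity Q z x * (max 0 (min 1 π₁) / (e x * π x)))) +
            (1 - κ) * ((m x - outcomeMean Q z x) *
              (1 - propensity Q z x * (max 0 (min 1 (p₂ x)) / (e x * π x)))) =
            (m x - outcomeMean Q z x) * (1 - propensity Q z x * (P / (e x * π x))) := by
          rw [min_eq_right hπ₁1, max_eq_right hπ₁0, hP]; ring
        have hc : 0 ≤ 1 / ε + ν / ε := by positivity
        rw [h9, enorm_mul, Real.enorm_eq_ofReal_abs, Real.enorm_eq_ofReal_abs, ← mul_add, ← mul_add,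
          mul_left_comm, ← ENNReal.ofReal_add (abs_nonneg _) (abs_nonneg _),
          ← ENNReal.ofReal_add (by positivity) (abs_nonneg _), ← ENNReal.ofReal_mul hc]
        gcongr
        exact h8.trans (by gcongr)
    _ ≤ _ := by
        rw [lintegral_const_mul _ (by fun_prop), lintegral_add_right _ (by fun_prop),
          lintegral_add_right _ (by fun_prop)]
        refine mul_le_mul_right ?_ _
        rw [mul_add, mul_add]
        exact add_le_add (add_le_add (lintegral_abs_mul_abs_le Q hm (by fun_prop) hπ hπ')
          (lintegral_abs_mul_abs_le Q hm (by fun_prop) he (by fun_prop)))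
          (lintegral_abs_mul_abs_le Q hm (by fun_prop) hp hπ')

end MeanPerturbation

/-! ### Mean and variance of the oracle score -/

section OracleMoments

variable {𝒳 : Type*} [MeasurableSpace 𝒳] (Q : Measure (FullUnit 𝒳)) [IsProbabilityMeasure Q]
  {ε ν M : ℝ}

/-- The weighted residual `1[Z = z] (Y - μ_z(X)) 1[v ≤ p(X)] / (e_z(X) π(X))`. -/
noncomputable def wResidual (z : Bool) (π p : 𝒳 → ℝ) (w : FullUnit 𝒳 × ℝ) : ℝ :=
  trtInd z w.1 * ((outcome w.1 - outcomeMean Q z (cov w.1)) *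
    ipw (propensity Q z) π p (cov w.1) w.2)

/-- A unit belongs to one arm only. -/
lemma wResidual_mul_wResidual (π p π' p' : 𝒳 → ℝ) (w : FullUnit 𝒳 × ℝ) :
    wResidual Q true π p w * wResidual Q false π' p' w = 0 := by
  unfold wResidual trtInd
  cases h : trt w.1 <;> simp

section OneArm

variable {z : Bool}
  (hσ : ∀ᵐ x ∂(covLaw Q), ∫⁻ y, ENNReal.ofReal ((y - outcomeMean Q z x) ^ 2)
      ∂(outcomeLaw Q z x) = ENNReal.ofReal (outcomeVar Q z x))
  (hM : ∀ᵐ x ∂(covLaw Q), outcomeVar Q z x ≤ M)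
  {π p : 𝒳 → ℝ} (hπ : Measurable π) (hp : Measurable p) (hε : 0 < ε) (hν : 0 < ν)
  (hpos : ∀ᵐ x ∂(covLaw Q), 1 / ν ≤ propensity Q z x ∧ ε ≤ π x)

include hσ hM hπ hp hε hν hpos in
lemma memLp_wResidual : MemLp (wResidual Q z π p) 2 (unitLaw Q) := by
  refine memLp_trtInd_residual Q hσ hM (r := ipw (propensity Q z) π p)
    (measurable_ipw (by fun_prop) hπ hp) (c := ν / ε) ?_
  filter_upwards [hpos] with x hx v
  obtain ⟨a0, a1⟩ := ipw_nonneg_le (e := propensity Q z) hε hν p hx.1 hx.2 v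
  exact abs_le.2 ⟨by linarith [div_pos hν hε], a1⟩

include hπ hp in
lemma integral_wResidual : ∫ w, wResidual Q z π p w ∂(unitLaw Q) = 0 :=
  integral_trtInd_residual Q z (r := ipw (propensity Q z) π p)
    (measurable_ipw (by fun_prop) hπ hp)

include hπ hp in
lemma integral_wResidual_mul {φ : 𝒳 → ℝ} (hφ : Measurable φ) :
    ∫ w, wResidual Q z π p w * φ (cov w.1) ∂(unitLaw Q) = 0 := by
  rw [← integral_trtInd_residual Q z (r := fun x v => ipw (propensity Q z) π p x v * φ x)
    ((measurable_ipw (by fun_prop) hπ hp).mul (by fun_prop))]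
  refine integral_congr_ae (ae_of_all _ fun w => ?_)
  simp only [wResidual]
  ring

variable (hp01 : ∀ᵐ x ∂(covLaw Q), 0 ≤ p x ∧ p x ≤ 1)

include hM hπ hp hε hν hpos hp01 in
lemma integrable_outcomeVar_mul :
    Integrable (fun x => outcomeVar Q z x * p x / (propensity Q z x * π x ^ 2)) (covLaw Q) := by
  refine Integrable.of_bound (C := M * (ν / ε ^ 2)) (Measurable.aestronglyMeasurable (by fun_prop)) ?_
  filter_upwards [hM, hpos, hp01] with x h1 h2 h3
  have e0 : 0 < propensity Q z x := lt_of_lt_of_le (by positivity) h2.1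
  have p0 : 0 < π x := hε.trans_le h2.2
  have ie : 1 / propensity Q z x ≤ ν := by rw [div_le_comm₀ e0 hν]; exact h2.1
  have ip : 1 / π x ≤ 1 / ε := one_div_le_one_div_of_le hε h2.2
  have hv := outcomeVar_nonneg Q z x
  have hM0 : 0 ≤ M := hv.trans h1
  rw [Real.norm_of_nonneg (div_nonneg (mul_nonneg hv h3.1) (by positivity))]
  calc _ = (outcomeVar Q z x * p x) * ((1 / propensity Q z x) * (1 / π x) ^ 2) := by field_simp
    _ ≤ (M * 1) * (ν * (1 / ε) ^ 2) := by
        gcongr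
        · exact h3.1
        · exact h3.2
    _ = _ := by ring

include hσ hπ hp hε hν hpos hp01 in
-- The squared annotation indicator is the indicator itself, so `p` enters linearly while the weight
-- contributes `π` squared. This linearity drives the variance of the mixture.
lemma integral_wResidual_sq : ∫ w, wResidual Q z π p w ^ 2 ∂(unitLaw Q) =
    ∫ x, outcomeVar Q z x * p x / (propensity Q z x * π x ^ 2) ∂(covLaw Q) := by
  have hrm : Measurable fun q : 𝒳 × ℝ => ipw (propensity Q z) π p q.1 q.2 :=
    measurable_ipw (by fun_prop) hπ hp
  have hrc : Measurable fun w : FullUnit 𝒳 × ℝ => ipw (propensity Q z) π p (cov w.1) w.2 :=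
    hrm.comp (f := fun w : FullUnit 𝒳 × ℝ => (cov w.1, w.2)) (by fun_prop)
  have hwm : Measurable (wResidual Q z π p) := by unfold wResidual; fun_prop
  rw [integral_eq_lintegral_of_nonneg_ae (ae_of_all _ fun _ => sq_nonneg _) (by fun_prop),
    integral_eq_lintegral_of_nonneg_ae _ (Measurable.aestronglyMeasurable (by fun_prop))]
  · congr 1
    refine (lintegral_trtInd_residual_sq Q z hσ (r := ipw (propensity Q z) π p) hrm).trans ?_
    refine lintegral_congr_ae ?_
    filter_upwards [hpos, hp01] with x h2 h3
    have e0 : 0 < propensity Q z x := lt_of_lt_of_le (by positivity) h2.1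
    have p0 : 0 < π x := hε.trans_le h2.2
    have hv := outcomeVar_nonneg Q z x
    have h4 : ∫⁻ v, ENNReal.ofReal (ipw (propensity Q z) π p x v ^ 2) ∂unifLaw =
        ENNReal.ofReal (p x / (propensity Q z x * π x) ^ 2) := by
      have h5 : ∀ v, ipw (propensity Q z) π p x v ^ 2 =
          annInd p x v / (propensity Q z x * π x) ^ 2 := fun v => by
        rw [ipw, div_pow]
        congr 1
        unfold annInd; split_ifs <;> norm_num
      simp_rw [h5]
      have hm : Measurable (annInd p x) :=
        Measurable.ite measurableSet_Iic measurable_const measurable_const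
      have hi : Integrable (annInd p x) unifLaw := by
        refine Integrable.of_bound (C := 1) hm.aestronglyMeasurable (ae_of_all _ fun v => ?_)
        rw [Real.norm_of_nonneg (annInd_nonneg _ _ _)]
        exact annInd_le_one _ _ _
      rw [← ofReal_integral_eq_lintegral_ofReal (hi.div_const _)
        (ae_of_all _ fun v => div_nonneg (annInd_nonneg _ _ _) (sq_nonneg _)), integral_div,
        integral_annInd, min_eq_right h3.2, max_eq_right h3.1]
    rw [h4, ← ENNReal.ofReal_mul (mul_nonneg e0.le hv)]
    congr 1
    field_simp
  · filter_upwards [hpos, hp01] with x h2 h3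
    have e0 : 0 < propensity Q z x := lt_of_lt_of_le (by positivity) h2.1
    exact div_nonneg (mul_nonneg (outcomeVar_nonneg Q z x) h3.1) (by positivity)

end OneArm

/-- The centered oracle score. -/
noncomputable def oracleScore (π p : Bool → 𝒳 → ℝ) (w : FullUnit 𝒳 × ℝ) : ℝ :=
  augScore true (outcomeMean Q true) (propensity Q true) (π true) (p true) w -
    augScore false (outcomeMean Q false) (propensity Q false) (π false) (p false) w - ate Q

lemma oracleScore_eq (π p : Bool → 𝒳 → ℝ) (w : FullUnit 𝒳 × ℝ) : oracleScore Q π p w =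
    wResidual Q true (π true) (p true) w - wResidual Q false (π false) (p false) w +
      (outcomeMean Q true (cov w.1) - outcomeMean Q false (cov w.1) - ate Q) := by
  simp only [oracleScore, augScore, wResidual]; ring

lemma measurable_oracleScore {π p : Bool → 𝒳 → ℝ} (hπ : ∀ z, Measurable (π z))
    (hp : ∀ z, Measurable (p z)) : Measurable (oracleScore Q π p) :=
  ((measurable_augScore true (by fun_prop) (by fun_prop) (hπ _) (hp _)).sub
    (measurable_augScore false (by fun_prop) (by fun_prop) (hπ _) (hp _))).sub_const _

variable
  (hσ : ∀ z, ∀ᵐ x ∂(covLaw Q), ∫⁻ y, ENNReal.ofReal ((y - outcomeMean Q z x) ^ 2)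
      ∂(outcomeLaw Q z x) = ENNReal.ofReal (outcomeVar Q z x))
  (hM : ∀ z, ∀ᵐ x ∂(covLaw Q), outcomeVar Q z x ≤ M)
  {π p : Bool → 𝒳 → ℝ} (hπ : ∀ z, Measurable (π z)) (hp : ∀ z, Measurable (p z))
  (hε : 0 < ε) (hν : 0 < ν)
  (hpos : ∀ z, ∀ᵐ x ∂(covLaw Q), 1 / ν ≤ propensity Q z x ∧ ε ≤ π z x)
  (hμ : ∀ z, MemLp (outcomeMean Q z) 2 (covLaw Q))
  (hate : ∫ x, (outcomeMean Q true x - outcomeMean Q false x) ∂(covLaw Q) = ate Q)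

include hμ in
lemma memLp_centered_effect :
    MemLp (fun w : FullUnit 𝒳 × ℝ => outcomeMean Q true (cov w.1) - outcomeMean Q false (cov w.1)
      - ate Q) 2 (unitLaw Q) :=
  (((hμ true).sub (hμ false)).sub (memLp_const _)).comp_measurePreserving
    (measurePreserving_cov_unitLaw Q)

include hσ hM hπ hp hε hν hpos hμ in
lemma memLp_oracleScore : MemLp (oracleScore Q π p) 2 (unitLaw Q) := by
  have h : oracleScore Q π p = fun w => wResidual Q true (π true) (p true) w -
      wResidual Q false (π false) (p false) w +
      (outcomeMean Q true (cov w.1) - outcomeMean Q false (cov w.1) - ate Q) := by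
    ext w; exact oracleScore_eq Q π p w
  rw [h]
  exact ((memLp_wResidual Q (hσ _) (hM _) (hπ _) (hp _) hε hν (hpos _)).sub
    (memLp_wResidual Q (hσ _) (hM _) (hπ _) (hp _) hε hν (hpos _))).add
    (memLp_centered_effect Q hμ)

include hσ hM hπ hp hε hν hpos hμ hate in
lemma integral_oracleScore : ∫ w, oracleScore Q π p w ∂(unitLaw Q) = 0 := by
  have h1 := fun z => (memLp_wResidual Q (hσ z) (hM z) (hπ z) (hp z) hε hν (hpos z)).integrable
    one_le_two
  have h2 := (memLp_centered_effect Q hμ).integrable one_le_two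
  have hi : Integrable (fun x => outcomeMean Q true x - outcomeMean Q false x) (covLaw Q) :=
    ((hμ true).integrable one_le_two).sub ((hμ false).integrable one_le_two)
  simp_rw [oracleScore_eq]
  rw [integral_add ((h1 true).sub' (h1 false)) h2, integral_sub (h1 true) (h1 false),
    integral_wResidual Q (hπ _) (hp _), integral_wResidual Q (hπ _) (hp _)]
  have h3 : ∫ w : FullUnit 𝒳 × ℝ, (outcomeMean Q true (cov w.1) - outcomeMean Q false (cov w.1)
      - ate Q) ∂(unitLaw Q) =
      ∫ x, (outcomeMean Q true x - outcomeMean Q false x - ate Q) ∂(covLaw Q) := by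
    rw [← (measurePreserving_cov_unitLaw Q).map_eq, integral_map (by fun_prop) (by fun_prop)]
  rw [h3, integral_sub hi (integrable_const _), hate]
  simp

variable (hp01 : ∀ z, ∀ᵐ x ∂(covLaw Q), 0 ≤ p z x ∧ p z x ≤ 1)

include hσ hM hπ hp hε hν hpos hμ hate hp01 in
-- The two weighted residuals and the centered effect are pairwise orthogonal: the arms are
-- disjoint, and the residuals are centered given X.
lemma integral_oracleScore_sq : ∫ w, oracleScore Q π p w ^ 2 ∂(unitLaw Q) =
    ∑ z : Bool, ∫ x, outcomeVar Q z x * p z x / (propensity Q z x * π z x ^ 2) ∂(covLaw Q) +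
      variance (fun x => outcomeMean Q true x - outcomeMean Q false x) (covLaw Q) := by
  have h1 := fun z => memLp_wResidual Q (hσ z) (hM z) (hπ z) (hp z) hε hν (hpos z)
  have h2 := memLp_centered_effect Q hμ
  set φ : 𝒳 → ℝ := fun x => outcomeMean Q true x - outcomeMean Q false x - ate Q with hφ
  have hφm : Measurable φ := by fun_prop
  have hexp : ∀ w, oracleScore Q π p w ^ 2 =
      wResidual Q true (π true) (p true) w ^ 2 + wResidual Q false (π false) (p false) w ^ 2 +
      φ (cov w.1) ^ 2 + 2 * (wResidual Q true (π true) (p true) w * φ (cov w.1)) -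
      2 * (wResidual Q false (π false) (p false) w * φ (cov w.1)) := fun w => by
    rw [oracleScore_eq]
    have := wResidual_mul_wResidual Q (π true) (p true) (π false) (p false) w
    linear_combination (-2) * this
  have hφ2 : Integrable (fun w : FullUnit 𝒳 × ℝ => φ (cov w.1) ^ 2) (unitLaw Q) := h2.integrable_sq
  have hc := fun z => ((h1 z).integrable_mul h2)
  have hc' : ∀ z, Integrable (fun w => 2 * (wResidual Q z (π z) (p z) w * φ (cov w.1)))
      (unitLaw Q) := fun z => (hc z).const_mul 2
  have hs : ∀ z, Integrable (fun w => wResidual Q z (π z) (p z) w ^ 2) (unitLaw Q) :=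
    fun z => (h1 z).integrable_sq
  simp_rw [hexp]
  have ha : Integrable (fun w => wResidual Q true (π true) (p true) w ^ 2 +
      wResidual Q false (π false) (p false) w ^ 2) (unitLaw Q) := (hs true).add (hs false)
  have hb : Integrable (fun w => wResidual Q true (π true) (p true) w ^ 2 +
      wResidual Q false (π false) (p false) w ^ 2 + φ (cov w.1) ^ 2) (unitLaw Q) := ha.add hφ2
  have hd : Integrable (fun w => wResidual Q true (π true) (p true) w ^ 2 +
      wResidual Q false (π false) (p false) w ^ 2 + φ (cov w.1) ^ 2 +
      2 * (wResidual Q true (π true) (p true) w * φ (cov w.1))) (unitLaw Q) := hb.add (hc' true)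
  rw [integral_sub hd (hc' false), integral_add hb (hc' true),
    integral_add ha hφ2, integral_add (hs true) (hs false), integral_const_mul, integral_const_mul,
    integral_wResidual_mul Q (hπ _) (hp _) hφm, integral_wResidual_mul Q (hπ _) (hp _) hφm,
    integral_wResidual_sq Q (hσ _) (hπ _) (hp _) hε hν (hpos _) (hp01 _),
    integral_wResidual_sq Q (hσ _) (hπ _) (hp _) hε hν (hpos _) (hp01 _),
    variance_eq_integral (by fun_prop), hate, Fintype.sum_bool,
    ← (measurePreserving_cov_unitLaw Q).map_eq,
    integral_map (f := fun x => (outcomeMean Q true x - outcomeMean Q false x - ate Q) ^ 2)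
      (by fun_prop) (by fun_prop)]
  simp [hφ]

/-- The oracle scores of the two batches, mixed with the proportions of the batches, have the
variance of the mixture design. -/
lemma mixture_integral_oracleScore_sq (hσ : ∀ z, ∀ᵐ x ∂(covLaw Q),
      ∫⁻ y, ENNReal.ofReal ((y - outcomeMean Q z x) ^ 2)
      ∂(outcomeLaw Q z x) = ENNReal.ofReal (outcomeVar Q z x))
    (hM : ∀ z, ∀ᵐ x ∂(covLaw Q), outcomeVar Q z x ≤ M)
    {π p q : Bool → 𝒳 → ℝ} (hπ : ∀ z, Measurable (π z)) (hp : ∀ z, Measurable (p z))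
    (hq : ∀ z, Measurable (q z)) (hε : 0 < ε) (hν : 0 < ν)
    (hpos : ∀ z, ∀ᵐ x ∂(covLaw Q), 1 / ν ≤ propensity Q z x ∧ ε ≤ π z x)
    (hμ : ∀ z, MemLp (outcomeMean Q z) 2 (covLaw Q))
    (hate : ∫ x, (outcomeMean Q true x - outcomeMean Q false x) ∂(covLaw Q) = ate Q)
    (hp01 : ∀ z, ∀ᵐ x ∂(covLaw Q), 0 ≤ p z x ∧ p z x ≤ 1)
    (hq01 : ∀ z, ∀ᵐ x ∂(covLaw Q), 0 ≤ q z x ∧ q z x ≤ 1) {κ : ℝ}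
    (hmix : ∀ z x, κ * p z x + (1 - κ) * q z x = π z x) :
    κ * ∫ w, oracleScore Q π p w ^ 2 ∂(unitLaw Q) +
      (1 - κ) * ∫ w, oracleScore Q π q w ^ 2 ∂(unitLaw Q) = asympVar Q π := by
  -- By linearity in the annotation probability, the numerator becomes the mixture π and cancels one
  -- factor of π².
  have hz : ∀ z, κ * ∫ x, outcomeVar Q z x * p z x / (propensity Q z x * π z x ^ 2) ∂(covLaw Q) +
      (1 - κ) * ∫ x, outcomeVar Q z x * q z x / (propensity Q z x * π z x ^ 2) ∂(covLaw Q) =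
      ∫ x, outcomeVar Q z x / (propensity Q z x * π z x) ∂(covLaw Q) := fun z => by
    rw [← integral_const_mul, ← integral_const_mul, ← integral_add
      ((integrable_outcomeVar_mul Q (hM z) (hπ z) (hp z) hε hν (hpos z) (hp01 z)).const_mul _)
      ((integrable_outcomeVar_mul Q (hM z) (hπ z) (hq z) hε hν (hpos z) (hq01 z)).const_mul _)]
    refine integral_congr_ae ?_
    filter_upwards [hpos z] with x hx
    have e0 : 0 < propensity Q z x := lt_of_lt_of_le (by positivity) hx.1
    have p0 : 0 < π z x := hε.trans_le hx.2
    have := hmix z x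
    field_simp
    linear_combination (outcomeVar Q z x) * this
  rw [integral_oracleScore_sq Q hσ hM hπ hp hε hν hpos hμ hate hp01,
    integral_oracleScore_sq Q hσ hM hπ hq hε hν hpos hμ hate hq01, asympVar, Fintype.sum_bool,
    Fintype.sum_bool, Fintype.sum_bool, ← hz true, ← hz false]
  ring

end OracleMoments

/-! ### The budgeted allocation problem -/

section Allocation

variable {𝒳 : Type*} [MeasurableSpace 𝒳] (Q : Measure (FullUnit 𝒳)) [IsProbabilityMeasure Q]
  {B ε ν : ℝ}

/-- The normalizing constant `E[√σ²_1(X) + √σ²_0(X)]`. -/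
noncomputable def sdSum : ℝ :=
  ∫ x, (√(outcomeVar Q true x) + √(outcomeVar Q false x)) ∂(covLaw Q)

lemma optProb_eq (z : Bool) (x : 𝒳) :
    optProb Q B z x = √(outcomeVar Q z x) / propensity Q z x * B * (sdSum Q)⁻¹ := rfl

variable {Q}

lemma Positivity.propensity_lt {π : Bool → 𝒳 → ℝ} (h : Positivity Q π ε ν) :
    ∀ᵐ x ∂(covLaw Q), ∀ z, 1 / ν < propensity Q z x := by
  filter_upwards [h] with x hx z
  cases z
  · linarith [propensity_add Q x, hx.2.2]
  · exact hx.2.1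

lemma Positivity.bounds {π : Bool → 𝒳 → ℝ} (h : Positivity Q π ε ν) (z : Bool) :
    ∀ᵐ x ∂(covLaw Q), 1 / ν ≤ propensity Q z x ∧ ε ≤ π z x := by
  filter_upwards [h, h.propensity_lt] with x h1 h2
  exact ⟨(h2 z).le, (h1.1 z).1.le⟩

lemma Positivity.propensity_pos {π : Bool → 𝒳 → ℝ} (h : Positivity Q π ε ν) (hν : 0 < ν)
    (z : Bool) : ∀ᵐ x ∂(covLaw Q), 0 < propensity Q z x := by
  filter_upwards [h.propensity_lt] with x hx
  exact lt_trans (by positivity) (hx z)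

/-- A vanishing (or divergent, hence zero by convention) expectation would make π* zero, against its
lower bound ε. -/
lemma sdSum_pos (hε : 0 < ε) (hB : 0 < B) (h : Positivity Q (optProb Q B) ε ν) :
    0 < sdSum Q := by
  obtain ⟨x, hx⟩ := h.exists
  have h1 : 0 < optProb Q B true x := hε.trans (hx.1 true).1
  rw [optProb_eq] at h1
  have h2 : 0 ≤ √(outcomeVar Q true x) / propensity Q true x * B :=
    mul_nonneg (div_nonneg (Real.sqrt_nonneg _) (propensity_nonneg _ _ _)) hB.le
  exact inv_pos.1 (pos_of_mul_pos_right h1 h2)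

/-- The constraint π* ≤ 1 already forces bounded conditional variances, so no separate assumption is
needed. -/
lemma sqrt_outcomeVar_le (hε : 0 < ε) (hν : 0 < ν) (hB : 0 < B)
    (h : Positivity Q (optProb Q B) ε ν) (z : Bool) :
    ∀ᵐ x ∂(covLaw Q), √(outcomeVar Q z x) ≤ sdSum Q / B := by
  have hS := sdSum_pos hε hB h
  filter_upwards [h, h.propensity_pos hν z] with x hx he
  have h1 := (hx.1 z).2
  rw [optProb_eq, ← div_eq_mul_inv, div_le_one hS, div_mul_eq_mul_div, div_le_iff₀ he] at h1
  rw [le_div_iff₀ hB]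
  exact h1.trans (mul_le_of_le_one_right hS.le (propensity_le_one _ _ _))

lemma outcomeVar_le (hε : 0 < ε) (hν : 0 < ν) (hB : 0 < B)
    (h : Positivity Q (optProb Q B) ε ν) (z : Bool) :
    ∀ᵐ x ∂(covLaw Q), outcomeVar Q z x ≤ (sdSum Q / B) ^ 2 := by
  filter_upwards [sqrt_outcomeVar_le hε hν hB h z] with x hx
  rw [← Real.sq_sqrt (outcomeVar_nonneg Q z x)]
  exact pow_le_pow_left₀ (Real.sqrt_nonneg _) hx 2

lemma lintegral_sqrt_outcomeVar (hε : 0 < ε) (hν : 0 < ν) (hB : 0 < B)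
    (h : Positivity Q (optProb Q B) ε ν) :
    ∑ z : Bool, ∫⁻ x, ENNReal.ofReal √(outcomeVar Q z x) ∂(covLaw Q) =
      ENNReal.ofReal (sdSum Q) := by
  have hi : ∀ z, Integrable (fun x => √(outcomeVar Q z x)) (covLaw Q) := fun z => by
    refine Integrable.of_bound (C := sdSum Q / B) (by fun_prop) ?_
    filter_upwards [sqrt_outcomeVar_le hε hν hB h z] with x hx
    rwa [Real.norm_of_nonneg (Real.sqrt_nonneg _)]
  rw [sdSum, integral_add (hi _) (hi _), ENNReal.ofReal_add
    (integral_nonneg fun _ => Real.sqrt_nonneg _) (integral_nonneg fun _ => Real.sqrt_nonneg _),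
    ofReal_integral_eq_lintegral_ofReal (hi _) (ae_of_all _ fun _ => Real.sqrt_nonneg _),
    ofReal_integral_eq_lintegral_ofReal (hi _) (ae_of_all _ fun _ => Real.sqrt_nonneg _),
    Fintype.sum_bool]

variable (Q) in
lemma lintegral_alloc {π : Bool → 𝒳 → ℝ} (hπ : ∀ z, Measurable (π z)) :
    ∫⁻ u, ENNReal.ofReal (π (trt u) (cov u)) ∂Q =
      ∑ z : Bool, ∫⁻ x, ENNReal.ofReal (propensity Q z x * π z x) ∂(covLaw Q) := by
  have h1 : ∀ z, ∫⁻ u in trt ⁻¹' {z}, ENNReal.ofReal (π (trt u) (cov u)) ∂Q =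
      ∫⁻ x, ENNReal.ofReal (propensity Q z x * π z x) ∂(covLaw Q) := fun z => by
    have h2 : ∀ u ∈ trt ⁻¹' {z}, ENNReal.ofReal (π (trt u) (cov u)) =
        ENNReal.ofReal (π z (cov u)) := fun u (hu : trt u = z) => by rw [hu]
    rw [setLIntegral_congr_fun (measurableSet_trt z) h2,
      ← lintegral_map (f := fun x => ENNReal.ofReal (π z x)) (by fun_prop) measurable_cov,
      map_cov_restrict_trt, lintegral_withDensity_eq_lintegral_mul _ (by fun_prop) (by fun_prop)]
    refine lintegral_congr fun x => ?_
    rw [ENNReal.ofReal_mul (propensity_nonneg _ _ _)]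
    rfl
  have hc : (trt ⁻¹' {true} : Set (FullUnit 𝒳))ᶜ = trt ⁻¹' {false} := by
    ext u; simp
  rw [← lintegral_add_compl _ (measurableSet_trt true), hc, h1, h1, Fintype.sum_bool]

lemma measurable_alloc {π : Bool → 𝒳 → ℝ} (hπ : ∀ z, Measurable (π z)) :
    Measurable fun u : FullUnit 𝒳 => π (trt u) (cov u) :=
  measurable_bool_select (g := fun z (u : FullUnit 𝒳) => π z (cov u))
    (fun z => (hπ z).comp measurable_cov) measurable_trt

lemma ofReal_integral_alloc {π : Bool → 𝒳 → ℝ} (hπ : ∀ z, Measurable (π z))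
    (h01 : ∀ᵐ x ∂(covLaw Q), ∀ z, 0 < π z x ∧ π z x ≤ 1) :
    ENNReal.ofReal (∫ u, π (trt u) (cov u) ∂Q) =
      ∑ z : Bool, ∫⁻ x, ENNReal.ofReal (propensity Q z x * π z x) ∂(covLaw Q) := by
  have h : ∀ᵐ u ∂Q, ∀ z, 0 < π z (cov u) ∧ π z (cov u) ≤ 1 :=
    ae_of_ae_map measurable_cov.aemeasurable h01
  rw [← lintegral_alloc Q hπ, ofReal_integral_eq_lintegral_ofReal]
  · refine Integrable.of_bound (C := 1) (measurable_alloc hπ).aestronglyMeasurable ?_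
    filter_upwards [h] with u hu
    rw [Real.norm_of_nonneg (hu _).1.le]
    exact (hu _).2
  · filter_upwards [h] with u hu using (hu _).1.le

/-- The optimal joint probability of treatment and annotation is proportional to the conditional
standard deviation: the equality case of the inequality behind optimality. -/
lemma propensity_mul_optProb {z : Bool} {x : 𝒳} (he : 0 < propensity Q z x) :
    propensity Q z x * optProb Q B z x = B / sdSum Q * √(outcomeVar Q z x) := by
  rw [optProb_eq]
  field_simp

lemma allocFeasible_optProb (hε : 0 < ε) (hν : 0 < ν) (hB : 0 < B)
    (h : Positivity Q (optProb Q B) ε ν) : AllocFeasible Q B (optProb Q B) := by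
  have hS := sdSum_pos hε hB h
  have h01 : ∀ᵐ x ∂(covLaw Q), ∀ z, 0 < optProb Q B z x ∧ optProb Q B z x ≤ 1 := by
    filter_upwards [h] with x hx z using ⟨hε.trans (hx.1 z).1, (hx.1 z).2⟩
  refine ⟨fun z => by fun_prop, h01, ?_⟩
  rw [← ENNReal.ofReal_le_ofReal_iff hB.le, ofReal_integral_alloc (by fun_prop) h01]
  have h1 : ∀ z, ∫⁻ x, ENNReal.ofReal (propensity Q z x * optProb Q B z x) ∂(covLaw Q) =
      ENNReal.ofReal (B / sdSum Q) * ∫⁻ x, ENNReal.ofReal √(outcomeVar Q z x) ∂(covLaw Q) :=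
    fun z => by
      rw [← lintegral_const_mul _ (by fun_prop)]
      refine lintegral_congr_ae ?_
      filter_upwards [h.propensity_pos hν z] with x hx
      rw [propensity_mul_optProb hx, ENNReal.ofReal_mul (by positivity)]
  simp_rw [h1]
  rw [← Finset.mul_sum, lintegral_sqrt_outcomeVar hε hν hB h, ← ENNReal.ofReal_mul (by positivity),
    div_mul_cancel₀ _ hS.ne']

lemma allocObjective_optProb (hε : 0 < ε) (hν : 0 < ν) (hB : 0 < B)
    (h : Positivity Q (optProb Q B) ε ν) :
    allocObjective Q (optProb Q B) = ENNReal.ofReal (sdSum Q ^ 2 / B) := by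
  have hS := sdSum_pos hε hB h
  have h1 : ∀ z, ∫⁻ x, ENNReal.ofReal (outcomeVar Q z x /
      (propensity Q z x * optProb Q B z x)) ∂(covLaw Q) =
      ENNReal.ofReal (sdSum Q / B) * ∫⁻ x, ENNReal.ofReal √(outcomeVar Q z x) ∂(covLaw Q) :=
    fun z => by
      rw [← lintegral_const_mul _ (by fun_prop)]
      refine lintegral_congr_ae ?_
      filter_upwards [h, h.propensity_pos hν z] with x h2 hx
      have h3 : 0 < propensity Q z x * optProb Q B z x := mul_pos hx (hε.trans (h2.1 z).1)
      rw [propensity_mul_optProb hx] at h3 ⊢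
      have hs : 0 < √(outcomeVar Q z x) := pos_of_mul_pos_right h3 (by positivity)
      rw [← ENNReal.ofReal_mul (by positivity)]
      congr 1
      have h4 : outcomeVar Q z x = √(outcomeVar Q z x) * √(outcomeVar Q z x) :=
        (Real.mul_self_sqrt (outcomeVar_nonneg Q z x)).symm
      rw [div_eq_iff h3.ne']
      field_simp
      rw [_root_.sq]
      exact h4
  rw [allocObjective]
  simp_rw [h1]
  rw [← Finset.mul_sum, lintegral_sqrt_outcomeVar hε hν hB h, ← ENNReal.ofReal_mul (by positivity)]
  congr 1
  ring

/-- Weak duality: for b = eπ, completing the square gives σ²/b + l²b ≥ 2lσ. Integrating and using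
the budget bounds every objective below by 2lS - l²B with S = `sdSum Q`, which equals S²/B, the
value at π*. -/
theorem solvesGlobalBudget_optProb (hε : 0 < ε) (hν : 0 < ν) (hB : 0 < B)
    (h : Positivity Q (optProb Q B) ε ν) : SolvesGlobalBudget Q B (optProb Q B) := by
  refine ⟨allocFeasible_optProb hε hν hB h, fun π hπ => ?_⟩
  obtain ⟨hm, h01, hbud⟩ := hπ
  have hS := sdSum_pos hε hB h
  -- The maximizer of the lower bound 2lS - l²B; its square is the Lagrange multiplier of the
  -- budget.
  set l := sdSum Q / B with hl
  have hl0 : 0 < l := div_pos hS hB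
  have hz : ∀ z, ENNReal.ofReal (2 * l) * ∫⁻ x, ENNReal.ofReal √(outcomeVar Q z x) ∂(covLaw Q) ≤
      ∫⁻ x, ENNReal.ofReal (outcomeVar Q z x / (propensity Q z x * π z x)) ∂(covLaw Q) +
      ENNReal.ofReal (l ^ 2) *
        ∫⁻ x, ENNReal.ofReal (propensity Q z x * π z x) ∂(covLaw Q) := fun z => by
    have := hm z
    rw [← lintegral_const_mul _ (by fun_prop), ← lintegral_const_mul _ (by fun_prop),
      ← lintegral_add_right _ (by fun_prop)]
    refine lintegral_mono_ae ?_
    filter_upwards [h01, h.propensity_pos hν z] with x h2 hx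
    have hb : 0 < propensity Q z x * π z x := mul_pos hx (h2 z).1
    have hv := outcomeVar_nonneg Q z x
    rw [← ENNReal.ofReal_mul (by positivity), ← ENNReal.ofReal_mul (by positivity),
      ← ENNReal.ofReal_add (by positivity) (by positivity)]
    refine ENNReal.ofReal_le_ofReal ?_
    set b := propensity Q z x * π z x
    set s := √(outcomeVar Q z x)
    have hs : outcomeVar Q z x = s ^ 2 := (Real.sq_sqrt hv).symm
    rw [hs, ← sub_nonneg]
    have h3 : s ^ 2 / b + l ^ 2 * b - 2 * l * s = (s - l * b) ^ 2 / b := by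
      field_simp
      ring
    rw [h3]
    positivity
  have hsum := Finset.sum_le_sum fun z (_ : z ∈ (Finset.univ : Finset Bool)) => hz z
  rw [← Finset.mul_sum, lintegral_sqrt_outcomeVar hε hν hB h, Finset.sum_add_distrib,
    ← Finset.mul_sum, ← ofReal_integral_alloc hm h01] at hsum
  rw [allocObjective_optProb hε hν hB h]
  have hfin : ENNReal.ofReal (l ^ 2) * ENNReal.ofReal B = ENNReal.ofReal (sdSum Q ^ 2 / B) := by
    rw [← ENNReal.ofReal_mul (by positivity), hl]
    congr 1
    field_simp
  have h5 : ENNReal.ofReal (sdSum Q ^ 2 / B) + ENNReal.ofReal (sdSum Q ^ 2 / B) ≤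
      allocObjective Q π + ENNReal.ofReal (sdSum Q ^ 2 / B) := by
    calc _ = ENNReal.ofReal (2 * l) * ENNReal.ofReal (sdSum Q) := by
          rw [← ENNReal.ofReal_add (by positivity) (by positivity),
            ← ENNReal.ofReal_mul (by positivity), hl]
          congr 1
          ring
      _ ≤ _ := hsum
      _ ≤ _ := by
          rw [← hfin]
          exact add_le_add le_rfl (mul_le_mul_right (ENNReal.ofReal_le_ofReal hbud) _)
  exact (ENNReal.add_le_add_iff_right ENNReal.ofReal_ne_top).1 h5

end Allocation

/-! ### The estimator as a sum of perturbed scores -/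

section Expansion

variable {𝒳 : Type*} [MeasurableSpace 𝒳] {K : ℕ} (Q : Measure (FullUnit 𝒳))
  [IsProbabilityMeasure Q] (D : Design K) (L : Learners 𝒳)

/-- The annotation probability of batch `t` in the oracle design. -/
noncomputable def oracleBatchProb (t : Fin 2) (z : Bool) (x : 𝒳) : ℝ :=
  if t = 0 then D.π₁ z else 1 / (1 - D.κ) * (optProb Q D.B z x - D.κ * D.π₁ z)

/-- The annotation probability actually used in batch `t` of fold `k`. -/
noncomputable def batchProb (d : ℕ → FullUnit 𝒳 × ℝ) (n : ℕ) (k : Fin K) (t : Fin 2) (z : Bool)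
    (x : 𝒳) : ℝ :=
  if t = 0 then D.π₁ z else secondProb D L d n k z x

/-- The difference of the estimated and of the oracle score for the treatment value `z`, in
batch `t` of fold `k`. -/
noncomputable def scoreDiff (n : ℕ) (t : Fin 2) (k : Fin K) (z : Bool) (d : ℕ → FullUnit 𝒳 × ℝ)
    (w : FullUnit 𝒳 × ℝ) : ℝ :=
  augScore z (meanHat D L d n k z) (propHat D L d n k z) (probHat D L d n k z)
      (batchProb D L d n k t z) w -
    augScore z (outcomeMean Q z) (propensity Q z) (optProb Q D.B z) (oracleBatchProb Q D t z) w

@[fun_prop]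
lemma measurable_oracleBatchProb (t : Fin 2) (z : Bool) :
    Measurable (oracleBatchProb Q D t z) := by
  unfold oracleBatchProb; split_ifs <;> fun_prop

lemma measurable_batchProb (n : ℕ) (k : Fin K) (t : Fin 2) (z : Bool) :
    Measurable fun q : (ℕ → FullUnit 𝒳 × ℝ) × 𝒳 => batchProb D L q.1 n k t z q.2 := by
  unfold batchProb
  split_ifs
  · exact measurable_const
  · exact measurable_secondProb D L n k z

lemma measurable_augScore_param {A : Type*} [MeasurableSpace A] (z : Bool) {m e π p : A → 𝒳 → ℝ}
    (hm : Measurable fun q : A × 𝒳 => m q.1 q.2) (he : Measurable fun q : A × 𝒳 => e q.1 q.2)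
    (hπ : Measurable fun q : A × 𝒳 => π q.1 q.2) (hp : Measurable fun q : A × 𝒳 => p q.1 q.2) :
    Measurable fun q : A × (FullUnit 𝒳 × ℝ) => augScore z (m q.1) (e q.1) (π q.1) (p q.1) q.2 := by
  have hx : Measurable fun q : A × (FullUnit 𝒳 × ℝ) => (q.1, cov q.2.1) := by fun_prop
  have hann : Measurable fun q : A × (FullUnit 𝒳 × ℝ) => annInd (p q.1) (cov q.2.1) q.2.2 :=
    Measurable.ite (measurableSet_le (by fun_prop) (hp.comp hx)) measurable_const measurable_const
  unfold augScore ipw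
  refine Measurable.add (Measurable.mul (by fun_prop) (Measurable.mul (Measurable.sub (by fun_prop)
    (hm.comp hx)) (hann.div ((he.comp hx).mul (hπ.comp hx))))) (hm.comp hx)

lemma measurable_scoreDiff (n : ℕ) (t : Fin 2) (k : Fin K) (z : Bool) :
    Measurable (Function.uncurry (scoreDiff Q D L n t k z)) := by
  refine Measurable.sub (f := fun q : (ℕ → FullUnit 𝒳 × ℝ) × (FullUnit 𝒳 × ℝ) =>
    augScore z (meanHat D L q.1 n k z) (propHat D L q.1 n k z) (probHat D L q.1 n k z)
      (batchProb D L q.1 n k t z) q.2) ?_ ?_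
  · exact measurable_augScore_param (m := fun d => meanHat D L d n k z)
      (e := fun d => propHat D L d n k z) (π := fun d => probHat D L d n k z)
      (p := fun d => batchProb D L d n k t z) z
      (measurable_meanHat D L n k z) (measurable_propHat D L n k z) (measurable_probHat D L n k z)
      (measurable_batchProb D L n k t z)
  · exact (measurable_augScore z (by fun_prop) (by fun_prop) (by fun_prop) (by fun_prop)).comp
      measurable_snd

/-- The indices outside a cell. -/
def offCell (n : ℕ) (t : Fin 2) (k : Fin K) : Finset ℕ := Finset.range n \ D.cell n t k

/-- No estimate applied to a cell uses the units of that cell. In the second batch the design does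
use the first batch of the same fold, which is why cells, and not whole folds, are conditioned upon.
-/
lemma scoreDiff_mask (n : ℕ) (t : Fin 2) (k : Fin K) (z : Bool) (e₀ : FullUnit 𝒳 × ℝ)
    (d : ℕ → FullUnit 𝒳 × ℝ) :
    scoreDiff Q D L n t k z (mask (offCell D n t k) e₀ d) = scoreDiff Q D L n t k z d := by
  have h1 : ∀ i ∈ D.outOfFold n k, mask (offCell D n t k) e₀ d i = d i := fun i hi => by
    refine mask_of_mem ?_
    simp only [Design.outOfFold, offCell, Design.cell, Finset.mem_filter, Finset.mem_sdiff] at hi ⊢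
    exact ⟨hi.1, fun h => hi.2 h.2.2⟩
  have h2 : batchProb D L (mask (offCell D n t k) e₀ d) n k t = batchProb D L d n k t := by
    unfold batchProb
    split_ifs with ht
    · rfl
    · have : designProb D L (mask (offCell D n t k) e₀ d) n k = designProb D L d n k := by
        refine designProb_congr D L fun i hi => mask_of_mem ?_
        simp only [offCell, Design.cell, Finset.mem_filter, Finset.mem_sdiff] at hi ⊢
        -- For the second batch, first-batch units of the same fold lie outside the cell.
        exact ⟨hi.1, fun h => ht (by rw [← h.2.1, hi.2.1])⟩
      unfold secondProb
      rw [this]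
  ext w
  unfold scoreDiff
  rw [h2, meanHat_congr D L h1, propHat_congr D L h1, probHat_congr D L h1]

lemma score_record {d : ℕ → FullUnit 𝒳 × ℝ} {n : ℕ} {t : Fin 2} {k : Fin K} {i : ℕ}
    (hi : i ∈ D.cell n t k) (m e π : Bool → 𝒳 → ℝ) (z : Bool) :
    score m e π z (record D L d n i) =
      augScore z (m z) (e z) (π z) (batchProb D L d n k t z) (d i) := by
  simp only [Design.cell, Finset.mem_filter] at hi
  have h : record D L d n i = annotate (batchProb D L d n k t) (d i).1 (d i).2 := by
    unfold record firstRec batchProb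
    rw [hi.2.1, hi.2.2]
    split_ifs <;> rfl
  rw [h, score_annotate]

lemma sum_cells (n : ℕ) (g : ℕ → ℝ) :
    ∑ t : Fin 2, ∑ k : Fin K, ∑ i ∈ D.cell n t k, g i = ∑ i ∈ Finset.range n, g i := by
  rw [← Finset.sum_fiberwise (Finset.range n) (fun i => (D.batch n i, D.fold n i)),
    Fintype.sum_prod_type]
  refine Finset.sum_congr rfl fun t _ => Finset.sum_congr rfl fun k _ => ?_
  simp only [Design.cell, Prod.mk.injEq]

lemma sum_cells_batch (n : ℕ) (g : Fin 2 → ℕ → ℝ) :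
    ∑ t : Fin 2, ∑ k : Fin K, ∑ i ∈ D.cell n t k, g t i =
      ∑ i ∈ Finset.range n, g (D.batch n i) i := by
  rw [← sum_cells D n fun i => g (D.batch n i) i]
  refine Finset.sum_congr rfl fun t _ => Finset.sum_congr rfl fun k _ =>
    Finset.sum_congr rfl fun i hi => ?_
  simp only [Design.cell, Finset.mem_filter] at hi
  rw [hi.2.1]

lemma sqrt_mul_aipw_sub (d : ℕ → FullUnit 𝒳 × ℝ) (n : ℕ) :
    √(n : ℝ) * (aipw D L d n - ate Q) =
      (√(n : ℝ))⁻¹ * ∑ i ∈ Finset.range n,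
        oracleScore Q (optProb Q D.B) (oracleBatchProb Q D (D.batch n i)) (d i) +
      ∑ t : Fin 2, ∑ k : Fin K, (√(n : ℝ))⁻¹ * ∑ i ∈ D.cell n t k,
        (scoreDiff Q D L n t k true d (d i) - scoreDiff Q D L n t k false d (d i)) := by
  have h1 : √(n : ℝ) * (1 / n) = (√(n : ℝ))⁻¹ := by
    rw [mul_one_div, Real.sqrt_div_self', one_div]
  have h2 : √(n : ℝ) * ate Q = (√(n : ℝ))⁻¹ * ∑ i ∈ Finset.range n, ate Q := by
    rw [Finset.sum_const, Finset.card_range, nsmul_eq_mul, ← mul_assoc, inv_mul_eq_div,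
      Real.div_sqrt]
  rw [mul_sub, h2, aipw, ← mul_assoc, h1, ← sum_cells_batch D n fun t i =>
    oracleScore Q (optProb Q D.B) (oracleBatchProb Q D t) (d i), ← sum_cells D n fun _ => ate Q,
    ← mul_sub]
  simp_rw [← Finset.mul_sum]
  rw [← mul_add]
  congr 1
  simp_rw [← Finset.sum_sub_distrib, ← Finset.sum_add_distrib]
  refine Finset.sum_congr rfl fun t _ => Finset.sum_congr rfl fun k _ =>
    Finset.sum_congr rfl fun i hi => ?_
  rw [score_record D L hi, score_record D L hi, oracleScore, scoreDiff, scoreDiff]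
  ring

end Expansion

/-! ### Consequences of proportional cell sizes. -/

section CellSizes

variable {K : ℕ} {D : Design K}

lemma Design.Proportional.tendsto_batch (h : D.Proportional) (hK : 0 < K) (t : Fin 2) :
    Tendsto (fun n : ℕ => (((Finset.range n).filter fun i => D.batch n i = t).card : ℝ) / n)
      atTop (𝓝 (D.proportion t)) := by
  obtain ⟨C, hC⟩ := h
  have hcard : ∀ n, (((Finset.range n).filter fun i => D.batch n i = t).card : ℝ) =
      ∑ k : Fin K, ((D.cell n t k).card : ℝ) := fun n => by
    rw [Finset.card_eq_sum_card_fiberwise (f := D.fold n) (t := Finset.univ) (by simp)]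
    push_cast
    refine Finset.sum_congr rfl fun k _ => ?_
    rw [Finset.filter_filter, Design.cell]
  have hb : ∀ᶠ n : ℕ in atTop,
      ‖(((Finset.range n).filter fun i => D.batch n i = t).card : ℝ) / n - D.proportion t‖ ≤
        K * C * (√(n : ℝ))⁻¹ := by
    filter_upwards [eventually_gt_atTop 0] with n hn
    have hn0 : (0 : ℝ) < n := by exact_mod_cast hn
    have hs : 0 < √(n : ℝ) := Real.sqrt_pos.2 hn0
    have hK0 : (0 : ℝ) < K := by exact_mod_cast hK
    have h1 : (((Finset.range n).filter fun i => D.batch n i = t).card : ℝ) / n -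
        D.proportion t =
        (∑ k : Fin K, (((D.cell n t k).card : ℝ) - D.proportion t * n / K)) / n := by
      rw [hcard, Finset.sum_sub_distrib, Finset.sum_const, Finset.card_univ, Fintype.card_fin,
        nsmul_eq_mul]
      field_simp
    rw [h1, norm_div, Real.norm_of_nonneg hn0.le, div_le_iff₀ hn0]
    refine (norm_sum_le_of_le _ fun k _ => hC n t k).trans (le_of_eq ?_)
    rw [Finset.sum_const, Finset.card_univ, Fintype.card_fin, nsmul_eq_mul]
    have : (√(n : ℝ))⁻¹ * n = √(n : ℝ) := by rw [inv_mul_eq_div, Real.div_sqrt]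
    rw [mul_assoc (K * C : ℝ), this, mul_assoc]
  have hlim : Tendsto (fun n : ℕ => K * C * (√(n : ℝ))⁻¹) atTop (𝓝 0) := by
    rw [← mul_zero (K * C : ℝ)]
    exact (tendsto_inv_atTop_zero.comp <| Real.tendsto_sqrt_atTop.comp
      tendsto_natCast_atTop_atTop).const_mul _
  exact tendsto_iff_norm_sub_tendsto_zero.2 (squeeze_zero' (Eventually.of_forall fun _ =>
    norm_nonneg _) hb hlim)

/-- The cell sizes turn a bias of order `o(n^{-1/2})` of the mixture into an `o(1)` term. -/
lemma enorm_cell_bias_le {n : ℕ} (hn : 0 < n) (hK : 0 < K) {C : ℝ}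
    {k : Fin K} (hC : ∀ t, |((D.cell n t k).card : ℝ) - D.proportion t * n / K| ≤ C * √(n : ℝ))
    (H : Fin 2 → ℝ) :
    ‖∑ t : Fin 2, (√(n : ℝ))⁻¹ * ((D.cell n t k).card * H t)‖ₑ ≤
      ENNReal.ofReal √(n : ℝ) * ‖D.κ * H 0 + (1 - D.κ) * H 1‖ₑ +
        ENNReal.ofReal C * ∑ t : Fin 2, ‖H t‖ₑ := by
  have hn0 : (0 : ℝ) < n := by exact_mod_cast hn
  have hs : 0 < √(n : ℝ) := Real.sqrt_pos.2 hn0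
  have hK0 : (1 : ℝ) ≤ K := by exact_mod_cast hK
  -- The normalized deviation from proportionality, bounded by `C`; the proportional part produces
  -- the κ-mixture of the biases.
  set r : Fin 2 → ℝ := fun t => (√(n : ℝ))⁻¹ * ((D.cell n t k).card - D.proportion t * n / K)
    with hr
  have hrC : ∀ t, ‖r t‖ₑ ≤ ENNReal.ofReal C := fun t => by
    rw [Real.enorm_eq_ofReal_abs, hr]
    refine ENNReal.ofReal_le_ofReal ?_
    rw [abs_mul, abs_inv, abs_of_pos hs, inv_mul_le_iff₀ hs]
    exact (hC t).trans_eq (mul_comm _ _)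
  have h1 : ∀ t, (√(n : ℝ))⁻¹ * ((D.cell n t k).card * H t) =
      (√(n : ℝ) / K) * (D.proportion t * H t) + r t * H t := fun t => by
    have : (√(n : ℝ))⁻¹ * n = √(n : ℝ) := by rw [inv_mul_eq_div, Real.div_sqrt]
    rw [hr]
    linear_combination (D.proportion t * H t / K) * this
  simp_rw [h1]
  rw [Finset.sum_add_distrib, ← Finset.mul_sum]
  refine (enorm_add_le _ _).trans (add_le_add ?_ ?_)
  · rw [enorm_mul]
    refine mul_le_mul' ?_ (le_of_eq ?_)
    · rw [Real.enorm_eq_ofReal_abs, abs_of_nonneg (by positivity)]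
      exact ENNReal.ofReal_le_ofReal (div_le_self hs.le hK0)
    · rw [Fin.sum_univ_two]
      simp [Design.proportion]
  · refine (enorm_sum_le _ _).trans ?_
    rw [Finset.mul_sum]
    refine Finset.sum_le_sum fun t _ => ?_
    rw [enorm_mul]
    exact mul_le_mul_left (hrC t) _

end CellSizes

/-! ### The remainder is negligible -/

section Remainder

variable {𝒳 : Type*} [MeasurableSpace 𝒳] {Q : Measure (FullUnit 𝒳)} [IsProbabilityMeasure Q]
  {Ω : Type*} [MeasurableSpace Ω] {P : Measure Ω} [IsProbabilityMeasure P]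
  {W : ℕ → Ω → FullUnit 𝒳 × ℝ} {K : ℕ} {D : Design K} {L : Learners 𝒳} {ε ν M : ℝ}

lemma measurable_l2Dist_sq {A : Type*} [MeasurableSpace A] {F : A → 𝒳 → ℝ} {g : 𝒳 → ℝ}
    (hF : Measurable fun q : A × 𝒳 => F q.1 q.2) (hg : Measurable g) :
    Measurable fun a => l2Dist Q (F a) g ^ 2 := by
  simp_rw [l2Dist_sq]
  have : Measurable fun q : A × 𝒳 => ENNReal.ofReal ((F q.1 q.2 - g q.2) ^ 2) := by
    fun_prop
  exact this.lintegral_prod_right'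

lemma measurable_l2Dist_meanHat_sq (hW : ∀ i, Measurable (W i)) (n : ℕ) (k : Fin K) (z : Bool) :
    Measurable fun ω => l2Dist Q (meanHat D L (fun i => W i ω) n k z) (outcomeMean Q z) ^ 2 :=
  (measurable_l2Dist_sq (Q := Q) (F := fun d => meanHat D L d n k z)
    (measurable_meanHat D L n k z) (measurable_outcomeMean Q z)).comp
    (f := fun ω i => W i ω) (measurable_pi_lambda _ hW)

lemma MeanConsistent.eventually_le (h : MeanConsistent Q D L P W) :
    ∃ Kμ rμ : ℝ, 0 < rμ ∧ ∀ᶠ n : ℕ in atTop, ∀ (k : Fin K) (z : Bool),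
      ∫⁻ ω, l2Dist Q (meanHat D L (fun i => W i ω) n k z) (outcomeMean Q z) ^ 2 ∂P ≤
        ENNReal.ofReal (Kμ * (n : ℝ) ^ (-rμ)) := by
  obtain ⟨Kμ, rμ, -, hr, h⟩ := h
  refine ⟨Kμ, rμ, hr, h.mono fun n hn k z => le_trans (le_of_eq ?_) (hn k z)⟩
  refine lintegral_congr fun ω => ?_
  rw [l2Dist_sq]
  refine lintegral_congr fun x => ?_
  congr 1
  ring

lemma MeanConsistent.toZeroInProb (hW : ∀ i, Measurable (W i)) (h : MeanConsistent Q D L P W)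
    (k : Fin K) (z : Bool) :
    ToZeroInProb P fun n ω =>
      l2Dist Q (meanHat D L (fun i => W i ω) n k z) (outcomeMean Q z) := by
  obtain ⟨Kμ, rμ, hr, h⟩ := h.eventually_le
  refine ToZeroInProb.sqrt (toZeroInProb_of_lintegral
    (fun n => (measurable_l2Dist_meanHat_sq hW n k z).aemeasurable) ?_)
  have hlim : Tendsto (fun n : ℕ => ENNReal.ofReal (Kμ * (n : ℝ) ^ (-rμ))) atTop (𝓝 0) := by
    have h1 := ((tendsto_rpow_neg_atTop hr).comp tendsto_natCast_atTop_atTop).const_mul Kμ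
    rw [mul_zero] at h1
    simpa using ENNReal.tendsto_ofReal h1
  exact tendsto_of_tendsto_of_tendsto_of_le_of_le' tendsto_const_nhds hlim
    (Eventually.of_forall fun _ => zero_le) (h.mono fun n hn => hn k z)

/-- Almost sure finiteness supplies the integrability behind the exact bias formula. -/
lemma MeanConsistent.ae_lt_top (hW : ∀ i, Measurable (W i)) (h : MeanConsistent Q D L P W) :
    ∀ᶠ n : ℕ in atTop, ∀ (k : Fin K) (z : Bool), ∀ᵐ ω ∂P,
      l2Dist Q (meanHat D L (fun i => W i ω) n k z) (outcomeMean Q z) < ∞ := by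
  obtain ⟨Kμ, rμ, hr, h⟩ := h.eventually_le
  filter_upwards [h] with n hn k z
  filter_upwards [MeasureTheory.ae_lt_top (measurable_l2Dist_meanHat_sq hW n k z)
    ((hn k z).trans_lt ENNReal.ofReal_lt_top).ne] with ω hω
  rw [lt_top_iff_ne_top] at hω ⊢
  exact fun hc => hω (by simp [hc])

/-- The first batch is annotated exactly as in the oracle design; in the second the design error is
magnified by 1/(1 - κ). -/
lemma l2Dist_batchProb_le (hκ : D.κ < 1) (d : ℕ → FullUnit 𝒳 × ℝ) (n : ℕ) (k : Fin K) (t : Fin 2)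
    (z : Bool) : l2Dist Q (batchProb D L d n k t z) (oracleBatchProb Q D t z) ≤
      ENNReal.ofReal (1 / (1 - D.κ)) * l2Dist Q (designProb D L d n k z) (optProb Q D.B z) := by
  unfold batchProb oracleBatchProb
  split_ifs
  · simp [l2Dist]
  · have h : (fun x => secondProb D L d n k z x -
        1 / (1 - D.κ) * (optProb Q D.B z x - D.κ * D.π₁ z)) =
        (1 / (1 - D.κ)) • fun x => designProb D L d n k z x - optProb Q D.B z x := by
      ext x
      simp only [secondProb, Pi.smul_apply, smul_eq_mul]
      ring
    rw [l2Dist, h, eLpNorm_const_smul, Real.enorm_eq_ofReal_abs, abs_of_nonneg, l2Dist]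
    have : 0 < 1 - D.κ := by linarith
    positivity

lemma measurable_slice {F : (ℕ → FullUnit 𝒳 × ℝ) → 𝒳 → ℝ}
    (hF : Measurable fun q : (ℕ → FullUnit 𝒳 × ℝ) × 𝒳 => F q.1 q.2) (d : ℕ → FullUnit 𝒳 × ℝ) :
    Measurable (F d) := hF.comp (measurable_const.prodMk measurable_id)

section Regular

variable (hW : ∀ i, Measurable (W i)) (hindep : iIndepFun W P)
  (hlaw : ∀ i, P.map (W i) = unitLaw Q) (hκ : 0 < D.κ ∧ D.κ < 1)
  (hσ : ∀ z, ∀ᵐ x ∂(covLaw Q), ∫⁻ y, ENNReal.ofReal ((y - outcomeMean Q z x) ^ 2)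
      ∂(outcomeLaw Q z x) = ENNReal.ofReal (outcomeVar Q z x))
  (hM : ∀ z, ∀ᵐ x ∂(covLaw Q), outcomeVar Q z x ≤ M)
  (hε : 0 < ε) (hν : 0 < ν) (hpos : Positivity Q (optProb Q D.B) ε ν)
  (hmean : MeanConsistent Q D L P W)
  (hcons : PropensityAnnotationConsistent Q D L P W)
  (hestpos : EstimatedPositivity Q D L P W ε ν)

include hW hκ hσ hM hε hν hpos hmean hcons hestpos in
lemma toZeroInProb_scoreDiff_sq (t : Fin 2) (k : Fin K) (z : Bool) :
    ToZeroInProb P fun n ω => ∫⁻ w, ENNReal.ofReal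
      (scoreDiff Q D L n t k z (fun i => W i ω) w ^ 2) ∂(unitLaw Q) := by
  obtain ⟨h1, h2, h3⟩ := hcons k z
  have h4 := hmean.toZeroInProb hW k z
  refine ToZeroInProb.mono
    ((((h1.sq.add h2.sq).add (h3.const_mul (c := ENNReal.ofReal (1 / (1 - D.κ)))
      ENNReal.ofReal_ne_top)).const_mul (c := ENNReal.ofReal (2 * M * weightConst ε ν))
      ENNReal.ofReal_ne_top).add
      (h4.sq.const_mul (c := ENNReal.ofReal (2 * (1 + ν / ε) ^ 2)) ENNReal.ofReal_ne_top)) ?_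
  filter_upwards [hestpos] with n hn
  filter_upwards [hn k] with ω hω
  refine (lintegral_augScore_sub_sq_le Q (hσ z) (hM z)
    (measurable_slice (F := fun d => meanHat D L d n k z) (measurable_meanHat D L n k z) _)
    (measurable_slice (F := fun d => propHat D L d n k z) (measurable_propHat D L n k z) _)
    (measurable_slice (F := fun d => probHat D L d n k z) (measurable_probHat D L n k z) _)
    (measurable_slice (F := fun d => batchProb D L d n k t z) (measurable_batchProb D L n k t z) _)
    (measurable_optProb Q D.B z)
    (measurable_oracleBatchProb Q D t z) hε hν (hω.mono fun x hx => hx z) (hpos.bounds z)).trans ?_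
  gcongr
  exact l2Dist_batchProb_le hκ.2 _ n k t z

include hW hindep hlaw hκ hσ hM hε hν hpos hmean hcons hestpos in
lemma toZeroInProb_fluctuation (t : Fin 2) (k : Fin K) (z : Bool) :
    ToZeroInProb P fun n ω => ‖(√(n : ℝ))⁻¹ * ∑ i ∈ D.cell n t k,
      (scoreDiff Q D L n t k z (fun i => W i ω) (W i ω) -
        ∫ w, scoreDiff Q D L n t k z (fun i => W i ω) w ∂(unitLaw Q))‖ₑ := by
  have hne : Nonempty Ω := nonempty_of_isProbabilityMeasure P
  -- Any value serves as the masking default, since the score difference does not read masked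
  -- entries.
  set e₀ := W 0 (Classical.arbitrary Ω)
  have hcard : ∀ n, (D.cell n t k).card ≤ n := fun n =>
    (Finset.card_filter_le _ _).trans (Finset.card_range n).le
  have h := toZeroInProb_sum_sub_integral hW hindep hlaw (J := fun n => offCell D n t k)
    (C := fun n => D.cell n t k) (fun n => Finset.sdiff_disjoint) hcard e₀
    (h := fun n => scoreDiff Q D L n t k z) (fun n => measurable_scoreDiff Q D L n t k z)
  simp only [scoreDiff_mask] at h
  exact h (toZeroInProb_scoreDiff_sq hW hκ hσ hM hε hν hpos hmean hcons hestpos t k z)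

variable (hπ₁ : ∀ z, 0 < D.π₁ z ∧ D.π₁ z ≤ 1) (hprop : D.Proportional) (hK : 0 < K)
  (hfeas : ∀ᵐ x ∂(covLaw Q), ∀ z, D.κ * D.π₁ z ≤ optProb Q D.B z x ∧
      optProb Q D.B z x ≤ D.κ * D.π₁ z + (1 - D.κ))
  (hrate : ProductRates Q D L P W)

include hW hκ hσ hM hε hν hpos hmean hestpos hπ₁ hprop hK hfeas hrate in
-- The batches must be summed before taking norms: their biases cancel only jointly, and √n times
-- either one need not vanish.
lemma toZeroInProb_bias (k : Fin K) (z : Bool) :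
    ToZeroInProb P fun n ω => ‖∑ t : Fin 2, (√(n : ℝ))⁻¹ * ((D.cell n t k).card *
      ∫ w, scoreDiff Q D L n t k z (fun i => W i ω) w ∂(unitLaw Q))‖ₑ := by
  obtain ⟨C, hC⟩ := hprop
  obtain ⟨h1, h2, h3⟩ := hrate k z
  have h4 := hmean.toZeroInProb hW k z
  refine ToZeroInProb.mono ((((h1.add h3).add h2).const_mul
    (c := ENNReal.ofReal (1 / ε + ν / ε)) ENNReal.ofReal_ne_top).add
    ((ToZeroInProb.sum (s := (Finset.univ : Finset (Fin 2))) fun t _ =>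
      h4.const_mul (c := ENNReal.ofReal (1 + ν / ε)) ENNReal.ofReal_ne_top).const_mul
      (c := ENNReal.ofReal C) ENNReal.ofReal_ne_top)) ?_
  filter_upwards [hestpos, hmean.ae_lt_top hW, eventually_gt_atTop 0] with n hn hfin hn0
  filter_upwards [hn k, hfin k z] with ω hω hf
  set d : ℕ → FullUnit 𝒳 × ℝ := fun i => W i ω with hd
  have hm := measurable_slice (F := fun d => meanHat D L d n k z) (measurable_meanHat D L n k z) d
  have he := measurable_slice (F := fun d => propHat D L d n k z) (measurable_propHat D L n k z) d
  have hp := measurable_slice (F := fun d => probHat D L d n k z) (measurable_probHat D L n k z) d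
  have hdp := measurable_slice (F := fun d => designProb D L d n k z) (measurable_designProb D L n k z) d
  have hω' := hω.mono fun x hx => hx z
  refine (enorm_cell_bias_le hn0 hK (fun t => hC n t k) fun t =>
    ∫ w, scoreDiff Q D L n t k z d w ∂(unitLaw Q)).trans (add_le_add ?_ ?_)
  · have hmix := enorm_mixture_bias_le Q (hσ z) (hM z) hm he hp hdp (measurable_optProb Q D.B z)
      hε hν hω' (hpos.bounds z) hf (hpos.mono fun x hx => (hx.1 z).2) hκ.2 (hπ₁ z).1.le (hπ₁ z).2
      (hfeas.mono fun x hx => hx z)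
    calc _ ≤ ENNReal.ofReal √(n : ℝ) * _ := mul_le_mul_right hmix _
      _ = _ := by ring
  · refine mul_le_mul_right (Finset.sum_le_sum fun t _ => ?_) _
    exact enorm_integral_augScore_sub_le Q (hσ z) (hM z) hm he hp
      (measurable_slice (F := fun d => batchProb D L d n k t z)
        (measurable_batchProb D L n k t z) d) (measurable_optProb Q D.B z)
      (measurable_oracleBatchProb Q D t z) hε hν hω' (hpos.bounds z) hf

include hW hindep hlaw hκ hσ hM hε hν hpos hmean hcons hestpos hπ₁ hprop hK hfeas hrate in
-- Each cell sum is split into its conditionally centered part and its conditional mean; the latter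
-- is grouped by fold to keep the two batches together.
lemma toZeroInProb_remainder :
    ToZeroInProb P fun n ω => ‖∑ t : Fin 2, ∑ k : Fin K, (√(n : ℝ))⁻¹ * ∑ i ∈ D.cell n t k,
        (scoreDiff Q D L n t k true (fun i => W i ω) (W i ω) -
          scoreDiff Q D L n t k false (fun i => W i ω) (W i ω))‖ₑ := by
  have hfl := fun t k z => toZeroInProb_fluctuation hW hindep hlaw hκ hσ hM hε hν hpos hmean hcons
    hestpos t k z
  have hbi := fun k z => toZeroInProb_bias hW hκ hσ hM hε hν hpos hmean hestpos hπ₁ hprop hK hfeas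
    hrate k z
  refine ToZeroInProb.mono (ToZeroInProb.sum (s := (Finset.univ : Finset Bool)) fun z _ =>
    ToZeroInProb.sum (s := (Finset.univ : Finset (Fin K))) fun k _ =>
      (ToZeroInProb.sum (s := (Finset.univ : Finset (Fin 2))) fun t _ => hfl t k z).add
        (hbi k z)) (Eventually.of_forall fun n => ae_of_all _ fun ω => ?_)
  set S : Fin 2 → Fin K → Bool → ℝ := fun t k z => (√(n : ℝ))⁻¹ * ∑ i ∈ D.cell n t k,
    scoreDiff Q D L n t k z (fun i => W i ω) (W i ω) with hS
  set H : Fin 2 → Fin K → Bool → ℝ := fun t k z =>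
    ∫ w, scoreDiff Q D L n t k z (fun i => W i ω) w ∂(unitLaw Q) with hH
  have hz : ∀ z, ‖∑ k : Fin K, ∑ t : Fin 2, S t k z‖ₑ ≤ ∑ k : Fin K, (∑ t : Fin 2,
      ‖(√(n : ℝ))⁻¹ * ∑ i ∈ D.cell n t k,
        (scoreDiff Q D L n t k z (fun i => W i ω) (W i ω) - H t k z)‖ₑ +
      ‖∑ t : Fin 2, (√(n : ℝ))⁻¹ * ((D.cell n t k).card * H t k z)‖ₑ) := fun z => by
    refine (enorm_sum_le _ _).trans (Finset.sum_le_sum fun k _ => ?_)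
    have : ∑ t : Fin 2, S t k z = ∑ t : Fin 2, (√(n : ℝ))⁻¹ * ∑ i ∈ D.cell n t k,
        (scoreDiff Q D L n t k z (fun i => W i ω) (W i ω) - H t k z) +
        ∑ t : Fin 2, (√(n : ℝ))⁻¹ * ((D.cell n t k).card * H t k z) := by
      rw [← Finset.sum_add_distrib]
      refine Finset.sum_congr rfl fun t _ => ?_
      rw [hS, Finset.sum_sub_distrib, Finset.sum_const, nsmul_eq_mul]
      ring
    rw [this]
    exact (enorm_add_le _ _).trans (add_le_add (enorm_sum_le _ _) le_rfl)
  have hsplit : ∑ t : Fin 2, ∑ k : Fin K, (√(n : ℝ))⁻¹ * ∑ i ∈ D.cell n t k,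
        (scoreDiff Q D L n t k true (fun i => W i ω) (W i ω) -
          scoreDiff Q D L n t k false (fun i => W i ω) (W i ω)) =
      ∑ k : Fin K, ∑ t : Fin 2, S t k true - ∑ k : Fin K, ∑ t : Fin 2, S t k false := by
    rw [Finset.sum_comm, ← Finset.sum_sub_distrib]
    refine Finset.sum_congr rfl fun k _ => ?_
    rw [← Finset.sum_sub_distrib]
    refine Finset.sum_congr rfl fun t _ => ?_
    rw [hS, Finset.sum_sub_distrib, mul_sub]
  rw [hsplit, Fintype.sum_bool]
  exact (enorm_sub_le).trans (add_le_add (hz true) (hz false))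

end Regular

end Remainder

end AdaptiveAIPW

/-! ### The limit theorem and the optimality of π*. -/

open AdaptiveAIPW in
theorem mainTheorem1 {𝒳 : Type*} [MeasurableSpace 𝒳]
    -- the population law of (X, Z, (Y(0), Y(1)))
    (Q : Measure (FullUnit 𝒳)) [IsProbabilityMeasure Q]
    -- the i.i.d. units, with independent uniform variables that drive the annotations
    {Ω : Type*} [MeasurableSpace Ω] (P : Measure Ω) [IsProbabilityMeasure P]
    (W : ℕ → Ω → FullUnit 𝒳 × ℝ) (hW : ∀ i, Measurable (W i)) (hindep : iIndepFun W P)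
    (hlaw : ∀ i, P.map (W i) = Q.prod (volume.restrict (Set.Icc (0 : ℝ) 1)))
    -- the design and the nuisance estimators
    {K : ℕ} (hK : 2 ≤ K) (D : Design K) (L : Learners 𝒳)
    (hκ : 0 < D.κ ∧ D.κ < 1) (hπ₁ : ∀ z, 0 < D.π₁ z ∧ D.π₁ z ≤ 1) (hB : 0 < D.B ∧ D.B ≤ 1)
    (hprop : D.Proportional)
    -- ignorability, positivity, second moments
    (hign : TreatmentIgnorable Q)
    {ε ν : ℝ} (hε : 0 < ε) (hν : 0 < ν) (hpos : Positivity Q (optProb Q D.B) ε ν)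
    (hmom : ∀ z, MemLp (pot z) 2 Q)
    -- the second batch can be annotated so that the two batches together achieve the optimum
    (hfeas : ∀ᵐ x ∂(covLaw Q), ∀ z, D.κ * D.π₁ z ≤ optProb Q D.B z x ∧
      optProb Q D.B z x ≤ D.κ * D.π₁ z + (1 - D.κ))
    -- the nuisance estimators
    (hmean : MeanConsistent Q D L P W)
    (hcons : PropensityAnnotationConsistent Q D L P W)
    (hrate : ProductRates Q D L P W)
    (hestpos : EstimatedPositivity Q D L P W ε ν) :
    TendstoInDistribution
      (fun (n : ℕ) (ω : Ω) => √(n : ℝ) * (aipw D L (fun i => W i ω) n - ate Q))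
      atTop (id : ℝ → ℝ) (fun _ => P)
      (gaussianReal 0 (asympVar Q (optProb Q D.B)).toNNReal) ∧
    SolvesGlobalBudget Q D.B (optProb Q D.B) := by
  have hpr := hpos.propensity_pos hν
  have hσ := fun z => ofReal_outcomeVar hign z (hpr z) (hmom z)
  have hM := outcomeVar_le hε hν hB.1 hpos
  have hμ := fun z => memLp_outcomeMean hign z (hpr z) (hmom z)
  have hate : ∫ x, (outcomeMean Q true x - outcomeMean Q false x) ∂(covLaw Q) = ate Q := by
    rw [integral_sub ((hμ _).integrable one_le_two) ((hμ _).integrable one_le_two),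
      integral_outcomeMean hign _ (hpr _) (hmom _), integral_outcomeMean hign _ (hpr _) (hmom _),
      ate, integral_sub ((hmom _).integrable one_le_two) ((hmom _).integrable one_le_two)]
  have hK0 : 0 < K := by omega
  have hκ' : 0 < 1 - D.κ := by linarith [hκ.2]
  -- For the second batch this is the feasibility assumption divided by 1 - κ.
  have h01 : ∀ t z, ∀ᵐ x ∂(covLaw Q), 0 ≤ oracleBatchProb Q D t z x ∧
      oracleBatchProb Q D t z x ≤ 1 := fun t z => by
    unfold oracleBatchProb
    split_ifs
    · exact ae_of_all _ fun _ => ⟨(hπ₁ z).1.le, (hπ₁ z).2⟩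
    · filter_upwards [hfeas] with x hx
      refine ⟨mul_nonneg (by positivity) (by linarith [hx z]), ?_⟩
      rw [one_div, inv_mul_le_iff₀ hκ']
      linarith [hx z]
  have hvar : ∑ t : Fin 2, D.proportion t *
      ∫ w, oracleScore Q (optProb Q D.B) (oracleBatchProb Q D t) w ^ 2 ∂(unitLaw Q) =
      asympVar Q (optProb Q D.B) := by
    rw [Fin.sum_univ_two]
    refine mixture_integral_oracleScore_sq Q hσ hM (fun z => by fun_prop)
      (measurable_oracleBatchProb Q D 0) (measurable_oracleBatchProb Q D 1) hε hν hpos.bounds hμ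
      hate (h01 0) (h01 1) fun z x => ?_
    simp only [oracleBatchProb, Design.proportion, if_true, one_ne_zero, if_false]
    field_simp
    ring
  have hclt := tendstoInDistribution_grouped_sum hW hindep hlaw
    (f := fun t => oracleScore Q (optProb Q D.B) (oracleBatchProb Q D t))
    (fun t => measurable_oracleScore Q (fun z => by fun_prop) (measurable_oracleBatchProb Q D t))
    (fun t => memLp_oracleScore Q hσ hM (fun z => by fun_prop) (measurable_oracleBatchProb Q D t)
      hε hν hpos.bounds hμ)
    (fun t => integral_oracleScore Q hσ hM (fun z => by fun_prop)
      (measurable_oracleBatchProb Q D t) hε hν hpos.bounds hμ hate)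
    (hprop.tendsto_batch hK0) (fun t => by
      unfold Design.proportion; split_ifs
      · exact hκ.1.le
      · exact hκ'.le)
  rw [hvar] at hclt
  -- Slutsky: the estimator and the oracle sum differ by the negligible remainder.
  refine ⟨tendstoInDistribution_of_tendstoInMeasure_sub _ _ hclt
    (ToZeroInProb.tendstoInMeasure ?_) fun n => ?_, solvesGlobalBudget_optProb hε hν hB.1 hpos⟩
  · have hrem := toZeroInProb_remainder hW hindep hlaw hκ hσ hM hε hν hpos hmean hcons hestpos hπ₁
      hprop hK0 hfeas hrate
    refine hrem.mono (Eventually.of_forall fun n => ae_of_all _ fun ω => le_of_eq ?_)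
    simp only [Pi.sub_apply]
    rw [sqrt_mul_aipw_sub Q D L, add_sub_cancel_left]
  · exact (((measurable_aipw D L n).comp (measurable_pi_lambda _ hW)).sub_const _ |>.const_mul
      _).aemeasurable
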